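/- Let $b,B,T>0$, $\mathcal S=\mathbb R\times(0,B)$ and $\mathcal S_T=\mathcal S\times(0,T)$; $(\cdot,\cdot)$ and $\|\cdot\|$ denote the inner product and norm of $L^2(\mathcal S)$. Consider the initial-boundary value problem $$u_t-u_{xx}+uu_x+u_{xxx}+u_{xyy}=0 \ \text{ in } \mathcal S_T,\qquad u(x,0,t)=u(x,B,t)=0,\qquad u(x,y,0)=u_0(x,y).$$ The initial datum $u_0$ is called admissible if $u_0(x,0)=u_0(x,B)=0$ (in the sense of traces) and $$J_0=\int_{\mathcal S}\Big\{u_0^2+e^{2bx}\big[u_0^2+|\nabla u_0|^2+|\nabla u_{0x}|^2+u_0^2u_{0x}^2+|\Delta u_{0x}|^2\big]\Big\}\,dx\,dy<\infty .$$ A regular solution with initial datum $u_0$ is a function $u$ on $\mathcal S_T$ such that $$u\in L^\infty(0,T;L^2(\mathcal S)),\quad u_x\in L^2(0,T;L^2(\mathcal S)),$$ $$e^{bx}u,\ e^{bx}u_x\in L^\infty(0,T;H^2(\mathcal S))\cap L^2(0,T;H^3(\mathcal S)),\quad e^{bx}u_t\in L^\infty(0,T;L^2(\mathcal S))\cap L^2(0,T;H^1(\mathcal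 S)),$$ which for a.e. $t\in(0,T)$ satisfies $$\big(e^{bx}[u_t-u_{xx}+u_{xxx}+uu_x+u_{xyy}],\phi\big)(t)=0\qquad\text{for every }\phi\in L^2(\mathcal S),$$ has zero trace on $y=0$ and $y=B$ for a.e. $t\in(0,T)$, and satisfies $u|_{t=0}=u_0$, in the sense that the representative of $t\mapsto e^{bx}u(\cdot,\cdot,t)$ in $C([0,T];L^2(\mathcal S))$ takes the value $e^{bx}u_0$ at $t=0$. Theorem. (i) (Uniqueness) If $u_0$ is admissible and $u_1,u_2$ are regular solutions with the same initial datum $u_0$, then $u_1=u_2$ a.e. in $\mathcal S_T$. (ii) (Continuous dependence) For all $b,T>0$ and $R\ge 0$ there is a constant $C=C(b,T,R)$ such that, for every $B>0$, all admissible $u_{01},u_{02}$ with $\|u_{01}\|,\|u_{02}\|\le R$ and all regular solutions $u_1,u_2$ with initial data $u_{01},u_{02}$, the difference $z=u_1-u_2$ satisfies, with $z_0=u_{01}-u_{02}$, $$(e^{2bx},z^2)(t)\le C\,(e^{2bx},z_0^2)\qquad\text{for all } t\in[0,T],$$ where $e^{bx}z(\cdot,\cdot,t)$ is understood through the representative in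 $C([0,T];L^2(\mathcal S))$. -/

import Mathlib

open MeasureTheory Set Filter Topology
open scoped ENNReal

noncomputable section

/-- The strip `ℝ × (0, B)`. -/
def strip (B : ℝ) : Set (ℝ × ℝ) := univ ×ˢ Ioo 0 B

/-- The space-time cylinder `strip B × (0, T)`; its points are written `((x, y), t)`. -/
def stripT (B T : ℝ) : Set ((ℝ × ℝ) × ℝ) := strip B ×ˢ Ioo 0 T

/-- Lebesgue measure on the strip. -/
abbrev stripMeasure (B : ℝ) : Measure (ℝ × ℝ) := volume.restrict (strip B)

/-- Lebesgue measure on the time interval `(0, T)`. -/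
abbrev timeMeasure (T : ℝ) : Measure ℝ := volume.restrict (Ioo 0 T)

/-- The unit vector in the `x`-direction. -/
def eX : ℝ × ℝ := (1, 0)

/-- The unit vector in the `y`-direction. -/
def eY : ℝ × ℝ := (0, 1)

/-- The unit vector in the `t`-direction of space-time. -/
def eT : (ℝ × ℝ) × ℝ := (0, 1)

/-- `e^{bx} f` for a function `f` of `(x, y)`. -/
def expMul (b : ℝ) (f : ℝ × ℝ → ℝ) : ℝ × ℝ → ℝ := fun p => Real.exp (b * p.1) * f p

/-- `e^{bx} f` for a function `f` of `((x, y), t)`. -/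
def expMulT (b : ℝ) (f : (ℝ × ℝ) × ℝ → ℝ) : (ℝ × ℝ) × ℝ → ℝ :=
  fun q => Real.exp (b * q.1.1) * f q

/-- The function `f(·, ·, t)` of `(x, y)`. -/
def slice (f : (ℝ × ℝ) × ℝ → ℝ) (t : ℝ) : ℝ × ℝ → ℝ := fun p => f (p, t)

section WeakDerivatives

variable {E : Type*} [NormedAddCommGroup E] [NormedSpace ℝ E] [MeasureSpace E]

/-- `φ ∈ C_c^∞(Ω)`. -/
def IsTestFunction (Ω : Set E) (φ : E → ℝ) : Prop :=
  ContDiff ℝ ((⊤ : ℕ∞) : WithTop ℕ∞) φ ∧ HasCompactSupport φ ∧ tsupport φ ⊆ Ω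

/-- `g` is the weak (distributional) derivative of `f` in the direction `v` on the open set `Ω`. -/
def IsWeakDeriv (Ω : Set E) (v : E) (f g : E → ℝ) : Prop :=
  LocallyIntegrableOn f Ω volume ∧ LocallyIntegrableOn g Ω volume ∧
    ∀ φ : E → ℝ, IsTestFunction Ω φ →
      ∫ p in Ω, f p * fderiv ℝ φ p v = -∫ p in Ω, g p * φ p

end WeakDerivatives

/-- `g` is the weak (distributional) Laplacian of `f` on the open set `Ω` of the plane. -/
def IsWeakLaplacian (Ω : Set (ℝ × ℝ)) (f g : ℝ × ℝ → ℝ) : Prop :=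
  LocallyIntegrableOn f Ω volume ∧ LocallyIntegrableOn g Ω volume ∧
    ∀ φ : ℝ × ℝ → ℝ, IsTestFunction Ω φ →
      ∫ p in Ω, f p * (fderiv ℝ (fun q => fderiv ℝ φ q eX) p eX
          + fderiv ℝ (fun q => fderiv ℝ φ q eY) p eY)
        = ∫ p in Ω, g p * φ p

/-- `f ∈ H¹₀(Ω)`: `f` lies in `H¹(Ω)` and is a limit of test functions in the `H¹(Ω)`-norm.
For the strip these are exactly the functions of `H¹` whose traces on the lines
`y = 0` and `y = B` vanish. -/
def MemH10 (Ω : Set (ℝ × ℝ)) (f : ℝ × ℝ → ℝ) : Prop :=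
  ∃ fx fy : ℝ × ℝ → ℝ,
    IsWeakDeriv Ω eX f fx ∧ IsWeakDeriv Ω eY f fy ∧
    MemLp f 2 (volume.restrict Ω) ∧ MemLp fx 2 (volume.restrict Ω) ∧
    MemLp fy 2 (volume.restrict Ω) ∧
    ∃ φ : ℕ → ℝ × ℝ → ℝ, (∀ n, IsTestFunction Ω (φ n)) ∧
      Tendsto (fun n => eLpNorm (fun p => f p - φ n p) 2 (volume.restrict Ω)) atTop (𝓝 0) ∧
      Tendsto (fun n => eLpNorm (fun p => fx p - fderiv ℝ (φ n) p eX) 2 (volume.restrict Ω))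
        atTop (𝓝 0) ∧
      Tendsto (fun n => eLpNorm (fun p => fy p - fderiv ℝ (φ n) p eY) 2 (volume.restrict Ω))
        atTop (𝓝 0)

/-- `f ∈ L^p(0, T; L²(strip B))`. -/
def MemLpL2 (B T : ℝ) (p : ℝ≥0∞) (f : (ℝ × ℝ) × ℝ → ℝ) : Prop :=
  AEStronglyMeasurable f (volume.restrict (stripT B T)) ∧
    eLpNorm (fun t => eLpNorm (slice f t) 2 (stripMeasure B)) p (timeMeasure T) < ∞

/-- `g(·, ·, t)` is the weak derivative of `f(·, ·, t)` on the strip in the direction `v`,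
for almost every `t ∈ (0, T)`. -/
def IsSpaceDeriv (B T : ℝ) (v : ℝ × ℝ) (f g : (ℝ × ℝ) × ℝ → ℝ) : Prop :=
  ∀ᵐ t ∂(timeMeasure T), IsWeakDeriv (strip B) v (slice f t) (slice g t)

/-- `f ∈ L^p(0, T; H^k(strip B))`, by recursion on `k`: `f ∈ L^p(0, T; L²)` and, if `k ≥ 1`, the
weak derivatives `f_x`, `f_y` belong to `L^p(0, T; H^{k-1})`. -/
def MemLpH (B T : ℝ) (p : ℝ≥0∞) : ℕ → ((ℝ × ℝ) × ℝ → ℝ) → Prop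
  | 0, f => MemLpL2 B T p f
  | k + 1, f => MemLpL2 B T p f ∧ ∃ fx fy : (ℝ × ℝ) × ℝ → ℝ,
      IsSpaceDeriv B T eX f fx ∧ IsSpaceDeriv B T eY f fy ∧
      MemLpH B T p k fx ∧ MemLpH B T p k fy

/-- The admissible initial data: `u₀` vanishes on `y = 0` and `y = B`, and
`∫ u₀² + e^{2bx} (u₀² + |∇u₀|² + |∇u₀ₓ|² + u₀² u₀ₓ² + |Δu₀ₓ|²)` over the strip is finite. -/
def IsAdmissibleDatum (b B : ℝ) (u₀ : ℝ × ℝ → ℝ) : Prop :=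
  MemH10 (strip B) (expMul b u₀) ∧
  ∃ ux uy uxx uxy lap : ℝ × ℝ → ℝ,
    IsWeakDeriv (strip B) eX u₀ ux ∧ IsWeakDeriv (strip B) eY u₀ uy ∧
    IsWeakDeriv (strip B) eX ux uxx ∧ IsWeakDeriv (strip B) eY ux uxy ∧
    IsWeakLaplacian (strip B) ux lap ∧
    MemLp u₀ 2 (stripMeasure B) ∧
    MemLp (expMul b u₀) 2 (stripMeasure B) ∧
    MemLp (expMul b ux) 2 (stripMeasure B) ∧
    MemLp (expMul b uy) 2 (stripMeasure B) ∧
    MemLp (expMul b uxx) 2 (stripMeasure B) ∧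
    MemLp (expMul b uxy) 2 (stripMeasure B) ∧
    MemLp (expMul b fun p => u₀ p * ux p) 2 (stripMeasure B) ∧
    MemLp (expMul b lap) 2 (stripMeasure B)

/-- `U` is the continuous representative on `[0, T]`, with values in `L²(strip B)`, of the curve
`t ↦ e^{bx} u(·, ·, t)`. -/
def IsContRep (b B T : ℝ) (u : (ℝ × ℝ) × ℝ → ℝ) (U : ℝ → Lp ℝ 2 (stripMeasure B)) : Prop :=
  ContinuousOn U (Icc 0 T) ∧
    ∀ᵐ t ∂(timeMeasure T), U t =ᵐ[stripMeasure B] expMul b (slice u t)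

/-- `u` is a regular solution on `strip B × (0, T)` of
`u_t - u_xx + u u_x + u_xxx + u_xyy = 0`, `u = 0` for `y = 0` and `y = B`, `u = u₀` for `t = 0`,
where `ux`, `uxx`, … are the weak derivatives of `u`. -/
structure IsRegularSolutionWith (b B T : ℝ) (u₀ : ℝ × ℝ → ℝ)
    (u ux uxx uxy uxxx uxyy ut : (ℝ × ℝ) × ℝ → ℝ) : Prop where
  deriv_x : IsSpaceDeriv B T eX u ux
  deriv_xx : IsSpaceDeriv B T eX ux uxx
  deriv_xy : IsSpaceDeriv B T eY ux uxy
  deriv_xxx : IsSpaceDeriv B T eX uxx uxxx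
  deriv_xyy : IsSpaceDeriv B T eY uxy uxyy
  deriv_t : IsWeakDeriv (stripT B T) eT u ut
  mem_u : MemLpL2 B T ∞ u
  mem_ux : MemLpL2 B T 2 ux
  mem_weighted_u : MemLpH B T ∞ 2 (expMulT b u) ∧ MemLpH B T 2 3 (expMulT b u)
  mem_weighted_ux : MemLpH B T ∞ 2 (expMulT b ux) ∧ MemLpH B T 2 3 (expMulT b ux)
  mem_weighted_ut : MemLpL2 B T ∞ (expMulT b ut) ∧ MemLpH B T 2 1 (expMulT b ut)
  equation : ∀ᵐ t ∂(timeMeasure T), ∀ φ : ℝ × ℝ → ℝ, MemLp φ 2 (stripMeasure B) →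
    ∫ p in strip B, Real.exp (b * p.1) *
      (ut (p, t) - uxx (p, t) + uxxx (p, t) + u (p, t) * ux (p, t) + uxyy (p, t)) * φ p = 0
  boundary : ∀ᵐ t ∂(timeMeasure T), MemH10 (strip B) (expMul b (slice u t))
  initial : ∃ U : ℝ → Lp ℝ 2 (stripMeasure B),
    IsContRep b B T u U ∧ U 0 =ᵐ[stripMeasure B] expMul b u₀

/-- `u` is a regular solution with initial value `u₀`. -/
def IsRegularSolution (b B T : ℝ) (u₀ : ℝ × ℝ → ℝ) (u : (ℝ × ℝ) × ℝ → ℝ) : Prop :=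
  ∃ ux uxx uxy uxxx uxyy ut : (ℝ × ℝ) × ℝ → ℝ,
    IsRegularSolutionWith b B T u₀ u ux uxx uxy uxxx uxyy ut

end

/-!
Both parts follow from weighted energy estimates: multiply the equation by `2 ρ u`, respectively the
difference of two equations by `2 ρ z`, with a weight `ρ(x) > 0` and integrate over the strip. With
zero boundary values, integration by parts gives for the linear operator
`∫ ρ u (-u_xx + u_xxx + u_xyy) = ∫ (ρ + 3/2 ρ') u_x² - 1/2 (ρ'' + ρ''') u² + 1/2 ρ' u_y²`
(`WeightedProfile.integral_linear`). For increasing `ρ` the terms with `ρ'` are a gain of one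
derivative in both directions; through the Ladyzhenskaya inequality `‖f‖₄² ≤ C ‖f‖₂ ‖∇f‖₂`
(`exists_ladyzhenskaya`) they absorb the contribution of the nonlinearity.

The solution is controlled with the weight `e^{2bx}` only, so the unweighted estimate
`‖u(t)‖² + 2 ∫ ‖u_x‖² ≤ ‖u₀‖²` is not obtained by taking `ρ = 1`. Instead `ρ = S` with
`S = e^{4bx} / (e^{4bx} + δ)`, which decays at `-∞` and tends to one as `δ → 0`. Its derivatives are
bounded by multiples of `S (1 - S)`, so that all error terms, the cubic one included, are at most a
constant times `(1 + ‖u‖²) ∫ S (1 - S) u²` (`exists_energy_slice`), which vanishes in the limit by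
dominated convergence (`IsRegularSolutionWith.integral_sq_le`).

For the difference `z` of two solutions, `ρ = e^{2bx}` gives
`d/dt ∫ e^{2bx} z² ≤ k(t) ∫ e^{2bx} z²`, where
`k = C (1 + ‖u₁ₓ‖² + ‖u₂ₓ‖² + ‖u₂‖²)` (`exists_difference_slice`). The `L²` estimate bounds `∫ k`
by a quantity depending only on `b`, `T` and the bound `R` for the data, and Grönwall's inequality
(`le_two_pow_mul_of_sub_le_integral`) yields continuous dependence. Uniqueness is the case of equal
data.

Two further points are needed to carry this out for weak derivatives. In space, the multipliers are
products of functions on the strip whose boundary values enter only through approximation by test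
functions (`IsTestLimit`) in the `y`-direction, while in the `x`-direction no boundary is present
and cut-offs suffice (`IsWeakDeriv.strip_integral_add_eq_zero`). In time, the energy
identity (`energy_identity`) is derived from the distributional time derivative and holds for the
continuous representative at every time.
-/

/-! ### Test functions and weak derivatives -/

section WeakDerivCalculus

set_option linter.unusedSectionVars false

variable {E : Type*} [NormedAddCommGroup E] [NormedSpace ℝ E] [MeasureSpace E]
  {Ω : Set E} {v w : E} {f g f' g' φ ψ a : E → ℝ}

theorem IsTestFunction.continuous (h : IsTestFunction Ω φ) : Continuous φ := h.1.continuous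

theorem IsTestFunction.differentiable (h : IsTestFunction Ω φ) : Differentiable ℝ φ :=
  h.1.differentiable (by simp)

theorem IsTestFunction.smooth_mul (h : IsTestFunction Ω φ)
    (ha : ContDiff ℝ ((⊤ : ℕ∞) : WithTop ℕ∞) a) : IsTestFunction Ω (fun p => a p * φ p) :=
  ⟨ha.mul h.1, h.2.1.mul_left, (tsupport_mul_subset_right (f := a)).trans h.2.2⟩

theorem IsTestFunction.sub (h : IsTestFunction Ω φ) (h' : IsTestFunction Ω ψ) :
    IsTestFunction Ω (fun p => φ p - ψ p) := by
  refine ⟨h.1.sub h'.1, h.2.1.sub h'.2.1, ?_⟩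
  exact (tsupport_sub φ ψ).trans (union_subset h.2.2 h'.2.2)

theorem ContDiff.fderiv_apply_const (ha : ContDiff ℝ ((⊤ : ℕ∞) : WithTop ℕ∞) a) (v : E) :
    ContDiff ℝ ((⊤ : ℕ∞) : WithTop ℕ∞) (fun p => fderiv ℝ a p v) :=
  (ha.fderiv_right (m := ((⊤ : ℕ∞) : WithTop ℕ∞)) (by simp)).clm_apply contDiff_const

theorem IsTestFunction.fderiv_apply (h : IsTestFunction Ω φ) (v : E) :
    IsTestFunction Ω (fun p => fderiv ℝ φ p v) :=
  ⟨h.1.fderiv_apply_const v, h.2.1.fderiv_apply ℝ v,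
    (tsupport_fderiv_apply_subset ℝ v).trans h.2.2⟩

theorem fderiv_mul_apply (ha : DifferentiableAt ℝ a w) (hφ : DifferentiableAt ℝ φ w) :
    fderiv ℝ (fun p => a p * φ p) w v = a w * fderiv ℝ φ w v + fderiv ℝ a w v * φ w := by
  rw [fderiv_fun_mul ha hφ]
  simp [mul_comm]

variable [BorelSpace E]

theorem IsTestFunction.integrable_mul (hφ : IsTestFunction Ω φ)
    (hf : LocallyIntegrableOn f Ω volume) :
    Integrable (fun p => f p * φ p) (volume.restrict Ω) := by
  have h1 : IntegrableOn f (tsupport φ) volume :=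
    hf.integrableOn_compact_subset hφ.2.2 hφ.2.1
  have h2 : IntegrableOn (fun p => f p * φ p) (tsupport φ) volume :=
    h1.mul_continuousOn hφ.continuous.continuousOn hφ.2.1
  have h3 : Integrable (fun p => f p * φ p) volume := by
    refine (integrableOn_iff_integrable_of_support_subset ?_).1 h2
    exact (Function.support_mul_subset_right _ _).trans (subset_tsupport φ)
  exact h3.restrict

theorem IsWeakDeriv.add (h : IsWeakDeriv Ω v f f') (k : IsWeakDeriv Ω v g g') :
    IsWeakDeriv Ω v (fun p => f p + g p) (fun p => f' p + g' p) := by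
  refine ⟨h.1.add k.1, h.2.1.add k.2.1, fun φ hφ => ?_⟩
  have hv := hφ.fderiv_apply v
  simp only [add_mul]
  rw [integral_add (hv.integrable_mul h.1) (hv.integrable_mul k.1),
    integral_add (hφ.integrable_mul h.2.1) (hφ.integrable_mul k.2.1),
    h.2.2 φ hφ, k.2.2 φ hφ]
  ring

theorem IsWeakDeriv.sub (h : IsWeakDeriv Ω v f f') (k : IsWeakDeriv Ω v g g') :
    IsWeakDeriv Ω v (fun p => f p - g p) (fun p => f' p - g' p) := by
  refine ⟨h.1.sub k.1, h.2.1.sub k.2.1, fun φ hφ => ?_⟩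
  have hv := hφ.fderiv_apply v
  simp only [sub_mul]
  rw [integral_sub (hv.integrable_mul h.1) (hv.integrable_mul k.1),
    integral_sub (hφ.integrable_mul h.2.1) (hφ.integrable_mul k.2.1),
    h.2.2 φ hφ, k.2.2 φ hφ]
  ring

theorem LocallyIntegrableOn.congr_ae_restrict
    (h : LocallyIntegrableOn f Ω volume) (hfg : f =ᵐ[volume.restrict Ω] g) :
    LocallyIntegrableOn g Ω volume := by
  intro x hx
  obtain ⟨s, hs, hi⟩ := h x hx
  refine ⟨s ∩ Ω, inter_mem hs self_mem_nhdsWithin, ?_⟩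
  refine (hi.mono_set inter_subset_left).congr_fun_ae ?_
  exact ae_restrict_of_ae_restrict_of_subset inter_subset_right hfg

theorem IsWeakDeriv.congr (h : IsWeakDeriv Ω v f f')
    (h1 : f =ᵐ[volume.restrict Ω] g) (h2 : f' =ᵐ[volume.restrict Ω] g') :
    IsWeakDeriv Ω v g g' := by
  refine ⟨LocallyIntegrableOn.congr_ae_restrict h.1 h1,
    LocallyIntegrableOn.congr_ae_restrict h.2.1 h2, fun φ hφ => ?_⟩
  have e1 : ∫ p in Ω, g p * fderiv ℝ φ p v = ∫ p in Ω, f p * fderiv ℝ φ p v :=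
    integral_congr_ae (by filter_upwards [h1] with p hp; rw [hp])
  have e2 : ∫ p in Ω, g' p * φ p = ∫ p in Ω, f' p * φ p :=
    integral_congr_ae (by filter_upwards [h2] with p hp; rw [hp])
  rw [e1, e2, h.2.2 φ hφ]

/-- Product rule for a weakly differentiable function and a smooth one. -/
theorem IsWeakDeriv.smooth_mul [LocallyCompactSpace E] (hΩ : IsOpen Ω)
    (h : IsWeakDeriv Ω v f f')
    (ha : ContDiff ℝ ((⊤ : ℕ∞) : WithTop ℕ∞) a) :
    IsWeakDeriv Ω v (fun p => a p * f p) (fun p => a p * f' p + fderiv ℝ a p v * f p) := by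
  have hlc : IsLocallyClosed Ω := hΩ.isLocallyClosed
  have hav := ha.fderiv_apply_const v
  have l2 : LocallyIntegrableOn (fun p => fderiv ℝ a p v * f p) Ω volume :=
    h.1.continuousOn_mul hav.continuous.continuousOn hlc
  refine ⟨h.1.continuousOn_mul ha.continuous.continuousOn hlc,
    (h.2.1.continuousOn_mul ha.continuous.continuousOn hlc).add l2, fun φ hφ => ?_⟩
  have key := h.2.2 _ (hφ.smooth_mul ha)
  have e : ∀ p, fderiv ℝ (fun q => a q * φ q) p v
      = a p * fderiv ℝ φ p v + fderiv ℝ a p v * φ p := fun p =>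
    fderiv_mul_apply (ha.differentiable (by simp) p) (hφ.differentiable p)
  simp only [e, mul_add, add_mul] at key ⊢
  rw [integral_add (((hφ.fderiv_apply v).smooth_mul ha).integrable_mul h.1)
    ((hφ.smooth_mul hav).integrable_mul h.1)] at key
  have i1 := (hφ.smooth_mul ha).integrable_mul h.2.1
  have i2 := (hφ.smooth_mul hav).integrable_mul h.1
  have r1 : ∀ p, a p * f' p * φ p = f' p * (a p * φ p) := fun p => by ring
  have r2 : ∀ p, fderiv ℝ a p v * f p * φ p = f p * (fderiv ℝ a p v * φ p) := fun p => by ring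
  have r3 : ∀ p, a p * f p * fderiv ℝ φ p v = f p * (a p * fderiv ℝ φ p v) := fun p => by ring
  simp only [r1, r2, r3]
  rw [integral_add i1 i2]
  linarith

theorem IsWeakDeriv.ae_unique [FiniteDimensional ℝ E] (hΩ : IsOpen Ω)
    (h : IsWeakDeriv Ω v f f') (k : IsWeakDeriv Ω v f g') : f' =ᵐ[volume.restrict Ω] g' := by
  have := hΩ.ae_eq_zero_of_integral_contDiff_smul_eq_zero (μ := volume)
    (f := fun p => f' p - g' p) (h.2.1.sub k.2.1) (by
      intro φ h1 h2 h3
      have hφ : IsTestFunction Ω φ := ⟨h1, h2, h3⟩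
      have i1 := hφ.integrable_mul h.2.1
      have i2 := hφ.integrable_mul k.2.1
      have e : ∫ p, φ p • (f' p - g' p) = ∫ p in Ω, (f' p * φ p - g' p * φ p) := by
        rw [setIntegral_eq_integral_of_forall_compl_eq_zero]
        · refine integral_congr_ae (.of_forall fun p => ?_)
          simp only [smul_eq_mul]; ring
        · intro p hp
          have : φ p = 0 := image_eq_zero_of_notMem_tsupport fun h => hp (h3 h)
          simp [this]
      rw [e, integral_sub i1 i2]
      have := h.2.2 φ hφ
      have := k.2.2 φ hφ
      linarith)
  refine (ae_restrict_iff' hΩ.measurableSet).2 ?_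
  filter_upwards [this] with p hp hpΩ
  have := hp hpΩ
  linarith

/-- If `∂_v f`, `∂_w ∂_v f` and `∂_w f` exist weakly, then so does `∂_v ∂_w f`, and the mixed
derivatives agree. -/
theorem IsWeakDeriv.comm {fv fw fvw : E → ℝ} (hv : IsWeakDeriv Ω v f fv)
    (hw : IsWeakDeriv Ω w f fw) (hvw : IsWeakDeriv Ω w fv fvw) : IsWeakDeriv Ω v fw fvw := by
  refine ⟨hw.2.1, hvw.2.1, fun φ hφ => ?_⟩
  have h1 := hw.2.2 _ (hφ.fderiv_apply v)
  have h2 := hv.2.2 _ (hφ.fderiv_apply w)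
  have h3 := hvw.2.2 _ hφ
  have e : ∀ p, fderiv ℝ (fun q => fderiv ℝ φ q v) p w
      = fderiv ℝ (fun q => fderiv ℝ φ q w) p v := by
    intro p
    have hd : DifferentiableAt ℝ (fderiv ℝ φ) p :=
      (hφ.1.fderiv_right (m := 1) (by norm_cast)).differentiable (by simp) p
    have hs : IsSymmSndFDerivAt ℝ φ p :=
      hφ.1.contDiffAt.isSymmSndFDerivAt (by simpa using (by norm_cast))
    have := hs.eq v w
    rw [fderiv_clm_apply hd (differentiableAt_const _),
      fderiv_clm_apply hd (differentiableAt_const _)]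
    simpa using this.symm
  simp only [e] at h1
  linarith

end WeakDerivCalculus

/-! ### Integration by parts for weak derivatives in `L²` of the whole space -/

section WholeSpace

set_option linter.unusedSectionVars false

variable {E : Type*} [NormedAddCommGroup E] [NormedSpace ℝ E] [MeasureSpace E] [BorelSpace E]
  [FiniteDimensional ℝ E] [(volume : Measure E).IsAddHaarMeasure] {v : E} {f g f' g' : E → ℝ}

/-- The translate `x ↦ F (x + h v)` of an `L²` function. -/
noncomputable def Lp.translate (v : E) (h : ℝ) (F : Lp ℝ 2 (volume : Measure E)) :
    Lp ℝ 2 (volume : Measure E) :=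
  Lp.compMeasurePreserving (fun x => x + h • v) (measurePreserving_add_right volume (h • v)) F

theorem Lp.coeFn_translate (v : E) (h : ℝ) (F : Lp ℝ 2 (volume : Measure E)) :
    Lp.translate v h F =ᵐ[volume] fun x => F (x + h • v) :=
  Lp.coeFn_compMeasurePreserving _ _

theorem Lp.translate_zero (v : E) (F : Lp ℝ 2 (volume : Measure E)) :
    Lp.translate v 0 F = F := by
  apply Lp.ext
  filter_upwards [Lp.coeFn_translate v 0 F] with x hx
  simpa using hx

theorem Lp.continuous_translate (v : E) (F : Lp ℝ 2 (volume : Measure E)) :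
    Continuous fun h : ℝ => Lp.translate v h F := by
  let k : C(ℝ, C(E, E)) :=
    ContinuousMap.curry ⟨fun q : ℝ × E => q.2 + q.1 • v, by fun_prop⟩
  exact Continuous.compMeasurePreservingLp (f := fun _ : ℝ => F) (g := k) continuous_const
    k.continuous (fun h => measurePreserving_add_right volume (h • v)) (by norm_num)

theorem Lp.inner_translate_translate (v : E) (h : ℝ) (F G : Lp ℝ 2 (volume : Measure E)) :
    inner ℝ (Lp.translate v h F) (Lp.translate v h G) = inner ℝ F G := by
  rw [L2.inner_def, L2.inner_def,
    ← integral_add_right_eq_self (fun x => inner ℝ (F x) (G x)) (h • v)]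
  refine integral_congr_ae ?_
  filter_upwards [Lp.coeFn_translate v h F, Lp.coeFn_translate v h G] with x h1 h2
  rw [h1, h2]

/-- Pairing translates of `g` with a test function is differentiable in the translation parameter:
the difference quotient can be moved to the test function. -/
theorem hasDerivAt_integral_translate (hw : IsWeakDeriv univ v g g') {φ : E → ℝ}
    (hφ : IsTestFunction univ φ) (s : ℝ) :
    HasDerivAt (fun h : ℝ => ∫ x, φ (x - h • v) * g x) (∫ x, φ (x - s • v) * g' x) s := by
  have hgl : LocallyIntegrable g volume := locallyIntegrableOn_univ.1 hw.1
  obtain ⟨R, hR⟩ := hφ.2.1.isCompact.isBounded.subset_closedBall (0 : E)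
  set K : Set E := Metric.closedBall 0 (R + (|s| + 1) * ‖v‖) with hK
  have hKc : IsCompact K := isCompact_closedBall _ _
  have hdc : Continuous fun p => fderiv ℝ φ p v := (hφ.fderiv_apply v).continuous
  obtain ⟨C, hC⟩ := hdc.bounded_above_of_compact_support (hφ.fderiv_apply v).2.1
  have hT : ∀ h : ℝ, IsTestFunction univ fun x => φ (x - h • v) := fun h =>
    ⟨hφ.1.comp (contDiff_id.sub contDiff_const),
      hφ.2.1.comp_homeomorph (Homeomorph.subRight (h • v)), subset_univ _⟩
  have hd : ∀ (h : ℝ) (x : E), HasDerivAt (fun h : ℝ => φ (x - h • v))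
      (-(fderiv ℝ φ (x - h • v) v)) h := by
    intro h x
    have h1 : HasDerivAt (fun h : ℝ => x - h • v) (-v) h := by
      simpa using ((hasDerivAt_id h).smul_const v).const_sub x
    have := (hφ.differentiable (x - h • v)).hasFDerivAt.comp_hasDerivAt h h1
    rw [map_neg] at this
    exact this
  have hder := (hasDerivAt_integral_of_dominated_loc_of_deriv_le (μ := (volume : Measure E))
    (F := fun h x => φ (x - h • v) * g x)
    (F' := fun h x => -(fderiv ℝ φ (x - h • v) v) * g x) (x₀ := s)
    (s := Metric.ball s 1)
    (bound := K.indicator fun x => C * ‖g x‖) (Metric.ball_mem_nhds s one_pos) ?_ ?_ ?_ ?_ ?_ ?_).2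
  · have e := hw.2.2 _ (hT s)
    have e' : ∀ x, fderiv ℝ (fun x => φ (x - s • v)) x v = fderiv ℝ φ (x - s • v) v := by
      intro x
      have h1 : HasFDerivAt (fun x => φ (x - s • v)) (fderiv ℝ φ (x - s • v)) x := by
        have := (hφ.differentiable (x - s • v)).hasFDerivAt.comp x
          ((hasFDerivAt_id x).sub_const (s • v))
        rw [ContinuousLinearMap.comp_id] at this
        exact this
      rw [h1.fderiv]
    simp only [e', Measure.restrict_univ] at e
    have e2 : ∫ x, φ (x - s • v) * g' x = ∫ x, -(fderiv ℝ φ (x - s • v) v) * g x := by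
      simp only [neg_mul, integral_neg]
      simp only [mul_comm] at e ⊢
      linarith
    rw [e2]
    exact hder
  · refine .of_forall fun h => ?_
    exact ((hT h).continuous.aestronglyMeasurable).mul hgl.aestronglyMeasurable
  · have := (hT s).integrable_mul hw.1
    simpa [mul_comm] using this
  · exact ((hdc.comp (by fun_prop : Continuous fun x => x - s • v)).neg.aestronglyMeasurable).mul
      hgl.aestronglyMeasurable
  · refine .of_forall fun x h hh => ?_
    by_cases hx : x ∈ K
    · rw [indicator_of_mem hx, norm_mul, norm_neg]
      exact mul_le_mul_of_nonneg_right (hC _) (norm_nonneg _)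
    · rw [indicator_of_notMem hx]
      have : fderiv ℝ φ (x - h • v) v = 0 := by
        refine image_eq_zero_of_notMem_tsupport (f := fun p => fderiv ℝ φ p v) fun hmem => hx ?_
        have h1 := hR (tsupport_fderiv_apply_subset ℝ v hmem)
        simp only [Metric.mem_closedBall, dist_zero_right, hK, Metric.mem_ball,
          Real.dist_eq] at h1 hh ⊢
        have h2 : |h| ≤ |s| + 1 := by
          have := abs_sub_abs_le_abs_sub h s
          linarith
        calc ‖x‖ = ‖(x - h • v) + h • v‖ := by simp
          _ ≤ ‖x - h • v‖ + |h| * ‖v‖ := by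
            refine (norm_add_le _ _).trans ?_
            rw [norm_smul, Real.norm_eq_abs]
          _ ≤ R + (|s| + 1) * ‖v‖ := by gcongr
      simp [this]
  · refine IntegrableOn.integrable_indicator ?_ hKc.measurableSet
    exact (hgl.integrableOn_isCompact hKc).norm.const_mul C
  · refine .of_forall fun x h _ => ?_
    exact (hd h x).mul_const _

theorem inner_toLp_translate {φ : E → ℝ} (hφ : MemLp φ 2 volume) (hg : MemLp g 2 volume) (h : ℝ) :
    inner ℝ (hφ.toLp φ) (Lp.translate v h (hg.toLp g)) = ∫ x, φ (x - h • v) * g x := by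
  rw [L2.inner_def, ← integral_add_right_eq_self (fun x => φ (x - h • v) * g x) (h • v)]
  have hq : Measure.QuasiMeasurePreserving (fun x : E => x + h • v) volume volume :=
    (measurePreserving_add_right volume (h • v)).quasiMeasurePreserving
  refine integral_congr_ae ?_
  filter_upwards [Lp.coeFn_translate v h (hg.toLp g), hφ.coeFn_toLp,
    hq.ae hg.coeFn_toLp] with x h1 h2 h3
  rw [h1, h2, h3]
  simp [mul_comm]

/-- An `L²` function with an `L²` weak derivative is strongly differentiable along translations. -/
theorem hasDerivAt_translate (hw : IsWeakDeriv univ v g g') (hg : MemLp g 2 volume)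
    (hg' : MemLp g' 2 volume) :
    HasDerivAt (fun h : ℝ => Lp.translate v h (hg.toLp g)) (hg'.toLp g') 0 := by
  set G := hg.toLp g
  set G' := hg'.toLp g'
  rw [hasDerivAt_iff_isLittleO_nhds_zero, Asymptotics.isLittleO_iff]
  intro ε hε
  have hc : Tendsto (fun h : ℝ => Lp.translate v h G') (𝓝 0) (𝓝 G') := by
    have := (Lp.continuous_translate v G').tendsto 0
    rwa [Lp.translate_zero] at this
  obtain ⟨δ, hδ, hball⟩ := Metric.eventually_nhds_iff_ball.1
    (hc.eventually (Metric.closedBall_mem_nhds G' hε))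
  filter_upwards [Metric.ball_mem_nhds (0 : ℝ) hδ] with h hh
  simp only [zero_add, Lp.translate_zero]
  set X := Lp.translate v h G - G - h • G' with hX
  -- The estimate is first proved against smooth compactly supported functions.
  have key : ∀ F : Lp ℝ 2 (volume : Measure E), inner ℝ F X ≤ ε * ‖h‖ * ‖F‖ := by
    have hcl : IsClosed {F : Lp ℝ 2 (volume : Measure E) | inner ℝ F X ≤ ε * ‖h‖ * ‖F‖} :=
      isClosed_le (by fun_prop) (by fun_prop)
    have hdense := Lp.dense_hasCompactSupport_contDiff (E := E) (F := ℝ) (μ := volume)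
      (p := 2) (by norm_num)
    intro F
    refine hcl.closure_subset_iff.2 ?_ (hdense F)
    rintro Φ ⟨φ, hΦ, hsupp, hsmooth⟩
    have hφ : IsTestFunction univ φ := ⟨hsmooth, hsupp, subset_univ _⟩
    have hφ2 : MemLp φ 2 volume := hφ.continuous.memLp_of_hasCompactSupport hsupp
    have hΦ' : Φ = hφ2.toLp φ := by
      apply Lp.ext
      exact hΦ.trans hφ2.coeFn_toLp.symm
    have hder : ∀ s : ℝ, HasDerivAt (fun h : ℝ => inner ℝ Φ (Lp.translate v h G) - h * inner ℝ Φ G')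
        (inner ℝ Φ (Lp.translate v s G' - G')) s := by
      intro s
      have h1 := hasDerivAt_integral_translate hw hφ s
      simp only [← inner_toLp_translate hφ2 hg, ← inner_toLp_translate hφ2 hg', ← hΦ'] at h1
      rw [inner_sub_right]
      exact h1.sub (by simpa using (hasDerivAt_id s).mul_const (inner ℝ Φ G'))
    -- The derivative of `s ↦ ⟪Φ, τₛ G⟫ - s ⟪Φ, G'⟫` is small near `0` because translations are
    -- strongly continuous; the mean value inequality gives a bound that is linear in `‖Φ‖`.
    have hmv := (convex_ball (0 : ℝ) δ).norm_image_sub_le_of_norm_hasDerivWithin_le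
      (f := fun h : ℝ => inner ℝ Φ (Lp.translate v h G) - h * inner ℝ Φ G')
      (C := ‖Φ‖ * ε) (fun s _ => (hder s).hasDerivWithinAt)
      (fun s hs => (norm_inner_le_norm _ _).trans (by
        gcongr
        have := hball s hs
        rwa [dist_eq_norm] at this))
      (Metric.mem_ball_self hδ) hh
    simp only [Lp.translate_zero, zero_mul, sub_zero] at hmv
    have e : inner ℝ Φ X = inner ℝ Φ (Lp.translate v h G) - h * inner ℝ Φ G' - inner ℝ Φ G := by
      rw [hX, inner_sub_right, inner_sub_right, real_inner_smul_right]
      ring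
    change inner ℝ Φ X ≤ ε * ‖h‖ * ‖Φ‖
    rw [e]
    refine (le_abs_self _).trans (hmv.trans (le_of_eq ?_))
    ring
  have h1 := key X
  rw [real_inner_self_eq_norm_sq] at h1
  by_contra hlt
  push Not at hlt
  have h0 : 0 ≤ ε * ‖h‖ := by positivity
  nlinarith

/-- Integration by parts for two `L²` functions with `L²` weak derivatives: the correlation of
the translates is constant. -/
theorem IsWeakDeriv.integral_add_eq_zero (hf : IsWeakDeriv univ v f f')
    (hg : IsWeakDeriv univ v g g') (mf : MemLp f 2 volume) (mf' : MemLp f' 2 volume)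
    (mg : MemLp g 2 volume) (mg' : MemLp g' 2 volume) :
    ∫ x, (f' x * g x + f x * g' x) = 0 := by
  have h1 := (hasDerivAt_translate hf mf mf').inner ℝ (hasDerivAt_translate hg mg mg')
  simp only [Lp.inner_translate_translate, Lp.translate_zero] at h1
  have h2 := h1.unique (hasDerivAt_const (0 : ℝ) _)
  have e : ∀ {a b : E → ℝ} (ha : MemLp a 2 volume) (hb : MemLp b 2 volume),
      inner ℝ (ha.toLp a) (hb.toLp b) = ∫ x, a x * b x := by
    intro a b ha hb
    have := inner_toLp_translate (v := v) ha hb 0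
    simpa [Lp.translate_zero] using this
  rw [e, e] at h2
  have i1 : Integrable (fun x => f' x * g x) volume := mf'.integrable_mul mg
  have i2 : Integrable (fun x => f x * g' x) volume := mf.integrable_mul mg'
  rw [integral_add i1 i2]
  linarith

end WholeSpace

/-! ### Extension by zero across the lateral boundary -/

section Extension

set_option linter.unusedSectionVars false

variable {E : Type*} [NormedAddCommGroup E] [NormedSpace ℝ E] [MeasureSpace E] [BorelSpace E]
  [FiniteDimensional ℝ E] [(volume : Measure E).IsAddHaarMeasure]
  {Ω : Set E} {v : E} {f f' a : E → ℝ}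

/-- If cutoffs `ζ n → 1` on `Ω` do not depend on the direction `v`, then weak differentiation of
`a f` along `v` commutes with extension by zero, as soon as the functions `a ζ n` are supported
in `Ω`. -/
theorem IsWeakDeriv.indicator_univ (hΩ : IsOpen Ω) (h : IsWeakDeriv Ω v f f')
    (mf : MemLp f 2 (volume.restrict Ω)) (mf' : MemLp f' 2 (volume.restrict Ω))
    (ha : ContDiff ℝ ((⊤ : ℕ∞) : WithTop ℕ∞) a) (ζ : ℕ → E → ℝ)
    (hζ : ∀ n, ContDiff ℝ ((⊤ : ℕ∞) : WithTop ℕ∞) (ζ n))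
    (hsupp : ∀ n, tsupport (fun p => a p * ζ n p) ⊆ Ω) (hb : ∀ n p, |ζ n p| ≤ 1)
    (hlim : ∀ p ∈ Ω, Tendsto (fun n => ζ n p) atTop (𝓝 1))
    (hdv : ∀ n p, fderiv ℝ (ζ n) p v = 0) :
    IsWeakDeriv univ v (Ω.indicator fun p => a p * f p)
      (Ω.indicator fun p => a p * f' p + fderiv ℝ a p v * f p) := by
  have hav := ha.fderiv_apply_const v
  have loc : ∀ {k : E → ℝ}, MemLp k 2 (volume.restrict Ω) →
      LocallyIntegrable (Ω.indicator k) volume := fun hk =>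
    ((memLp_indicator_iff_restrict hΩ.measurableSet).2 hk).locallyIntegrable (by norm_num)
  have cloc : ∀ {c k : E → ℝ}, Continuous c → MemLp k 2 (volume.restrict Ω) →
      LocallyIntegrable (Ω.indicator fun p => c p * k p) volume := by
    intro c k hc hk
    have := (locallyIntegrableOn_univ.2 (loc hk)).continuousOn_mul hc.continuousOn
      isOpen_univ.isLocallyClosed
    rw [locallyIntegrableOn_univ] at this
    convert this using 2 with p
    by_cases hp : p ∈ Ω <;> simp [hp]
  refine ⟨locallyIntegrableOn_univ.2 (cloc ha.continuous mf), locallyIntegrableOn_univ.2 ?_, ?_⟩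
  · rw [indicator_add]
    exact (cloc ha.continuous mf').add (cloc hav.continuous mf)
  intro φ hφ
  have hφv := hφ.fderiv_apply v
  have hψ : ∀ n, IsTestFunction Ω (fun p => (a p * ζ n p) * φ p) := fun n =>
    ⟨(ha.mul (hζ n)).mul hφ.1, hφ.2.1.mul_left,
      (tsupport_mul_subset_left (f := fun p => a p * ζ n p)).trans (hsupp n)⟩
  have hder : ∀ n p, fderiv ℝ (fun q => (a q * ζ n q) * φ q) p v
      = ζ n p * (a p * fderiv ℝ φ p v + fderiv ℝ a p v * φ p) := by
    intro n p
    have d1 := ha.differentiable (by simp) p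
    have d2 := (hζ n).differentiable (by simp) p
    rw [fderiv_mul_apply (a := fun q => a q * ζ n q) (d1.mul d2) (hφ.differentiable p),
      fderiv_mul_apply d1 d2, hdv]
    ring
  have dct : ∀ F : E → ℝ, Integrable F (volume.restrict Ω) →
      Tendsto (fun n => ∫ p in Ω, ζ n p * F p) atTop (𝓝 (∫ p in Ω, F p)) := by
    intro F hF
    refine tendsto_integral_of_dominated_convergence (fun p => ‖F p‖)
      (fun n => (hζ n).continuous.aestronglyMeasurable.mul hF.aestronglyMeasurable) hF.norm ?_ ?_
    · refine fun n => .of_forall fun p => ?_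
      rw [norm_mul, Real.norm_eq_abs]
      exact mul_le_of_le_one_left (norm_nonneg _) (hb n p)
    · refine (ae_restrict_iff' hΩ.measurableSet).2 (.of_forall fun p hp => ?_)
      simpa using (hlim p hp).mul_const (F p)
  have mtest : ∀ {ψ : E → ℝ}, IsTestFunction univ ψ → MemLp ψ 2 (volume.restrict Ω) :=
    fun hψ => (hψ.continuous.memLp_of_hasCompactSupport hψ.2.1).restrict Ω
  have i1 : Integrable (fun p => f p * (a p * fderiv ℝ φ p v + fderiv ℝ a p v * φ p))
      (volume.restrict Ω) :=
    mf.integrable_mul ((mtest (hφv.smooth_mul ha)).add (mtest (hφ.smooth_mul hav)))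
  have i1a : Integrable (fun p => f p * (a p * fderiv ℝ φ p v)) (volume.restrict Ω) :=
    mf.integrable_mul (mtest (hφv.smooth_mul ha))
  have i1b : Integrable (fun p => f p * (fderiv ℝ a p v * φ p)) (volume.restrict Ω) :=
    mf.integrable_mul (mtest (hφ.smooth_mul hav))
  have i2 : Integrable (fun p => f' p * (a p * φ p)) (volume.restrict Ω) :=
    mf'.integrable_mul (mtest (hφ.smooth_mul ha))
  have t1 := dct _ i1
  have t2 := (dct _ i2).neg
  have e : ∀ n, ∫ p in Ω, ζ n p * (f p * (a p * fderiv ℝ φ p v + fderiv ℝ a p v * φ p))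
      = -∫ p in Ω, ζ n p * (f' p * (a p * φ p)) := by
    intro n
    have := h.2.2 _ (hψ n)
    simp only [hder] at this
    refine Eq.trans ?_ (this.trans ?_)
    · exact integral_congr_ae (.of_forall fun p => by ring)
    · exact congrArg _ (integral_congr_ae (.of_forall fun p => by ring))
  have lim := tendsto_nhds_unique (t1.congr e) t2
  have ind : ∀ k ψ : E → ℝ, ∫ p in univ, Ω.indicator k p * ψ p = ∫ p in Ω, k p * ψ p := by
    intro k ψ
    rw [Measure.restrict_univ, ← integral_indicator hΩ.measurableSet]
    exact integral_congr_ae (.of_forall fun p => (indicator_mul_left Ω k ψ).symm)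
  rw [ind, ind]
  have e1 : ∫ p in Ω, f p * (a p * fderiv ℝ φ p v + fderiv ℝ a p v * φ p)
      = (∫ p in Ω, f p * (a p * fderiv ℝ φ p v)) + ∫ p in Ω, f p * (fderiv ℝ a p v * φ p) := by
    rw [← integral_add i1a i1b]
    exact integral_congr_ae (.of_forall fun p => by ring)
  have e2 : ∫ p in Ω, (a p * f' p + fderiv ℝ a p v * f p) * φ p
      = (∫ p in Ω, f' p * (a p * φ p)) + ∫ p in Ω, f p * (fderiv ℝ a p v * φ p) := by
    rw [← integral_add i2 i1b]
    exact integral_congr_ae (.of_forall fun p => by ring)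
  have e3 : ∫ p in Ω, a p * f p * fderiv ℝ φ p v = ∫ p in Ω, f p * (a p * fderiv ℝ φ p v) :=
    integral_congr_ae (.of_forall fun p => by ring)
  rw [e3, e2]
  linarith

end Extension

/-- A smooth cutoff of the interval `(0, L)` that equals `1` on a given compact subset. -/
theorem exists_cutoff_Ioo {L : ℝ} (hL : 0 < L) {K : Set ℝ} (hK : IsClosed K) (hKL : K ⊆ Ioo 0 L) :
    ∃ η : ℝ → ℝ, IsTestFunction (Ioo 0 L) η ∧ (∀ y, |η y| ≤ 1) ∧ ∀ y ∈ K, η y = 1 := by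
  have hball : Metric.ball (L / 2) (L / 2) = Ioo 0 L := by
    rw [Real.ball_eq_Ioo]; congr 1 <;> ring
  obtain ⟨r, hr, hKr⟩ := exists_lt_subset_ball hK (hball ▸ hKL)
  let β : ContDiffBump (L / 2) :=
    ⟨max r (L / 4), (max r (L / 4) + L / 2) / 2, by positivity, by
      have : max r (L / 4) < L / 2 := max_lt hr (by linarith)
      linarith⟩
  refine ⟨β, ⟨β.contDiff, β.hasCompactSupport, ?_⟩, fun y => ?_, fun y hy => ?_⟩
  · rw [β.tsupport_eq, ← hball]
    refine Metric.closedBall_subset_ball ?_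
    have : max r (L / 4) < L / 2 := max_lt hr (by linarith)
    change (max r (L / 4) + L / 2) / 2 < L / 2
    linarith
  · rw [abs_of_nonneg β.nonneg]
    exact β.le_one
  · refine β.one_of_mem_closedBall ?_
    exact Metric.closedBall_subset_closedBall (le_max_left _ _)
      (Metric.ball_subset_closedBall (hKr hy))

/-- Cutoffs of the interval `(0, L)` that converge to `1` on it. -/
theorem exists_cutoff_seq {L : ℝ} (hL : 0 < L) :
    ∃ η : ℕ → ℝ → ℝ, (∀ n, IsTestFunction (Ioo 0 L) (η n)) ∧ (∀ n y, |η n y| ≤ 1) ∧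
      ∀ y ∈ Ioo 0 L, Tendsto (fun n => η n y) atTop (𝓝 1) := by
  have h : ∀ n : ℕ, ∃ η : ℝ → ℝ, IsTestFunction (Ioo 0 L) η ∧ (∀ y, |η y| ≤ 1) ∧
      ∀ y ∈ Icc (1 / (n + 1 : ℝ)) (L - 1 / (n + 1 : ℝ)), η y = 1 := fun n => by
    refine exists_cutoff_Ioo hL isClosed_Icc fun y hy => ?_
    have : (0 : ℝ) < 1 / (n + 1 : ℝ) := by positivity
    exact ⟨by linarith [hy.1], by linarith [hy.2]⟩
  choose η h1 h2 h3 using h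
  refine ⟨η, h1, h2, fun y hy => ?_⟩
  refine tendsto_const_nhds.congr' ?_
  have t := tendsto_one_div_add_atTop_nhds_zero_nat (𝕜 := ℝ)
  filter_upwards [t.eventually_lt_const hy.1,
    t.eventually_lt_const (sub_pos.2 hy.2)] with n hn1 hn2
  exact (h3 n y ⟨hn1.le, by linarith⟩).symm

theorem isOpen_strip (B : ℝ) : IsOpen (strip B) := isOpen_univ.prod isOpen_Ioo

theorem measurableSet_strip (B : ℝ) : MeasurableSet (strip B) := (isOpen_strip B).measurableSet

theorem isOpen_stripT (B T : ℝ) : IsOpen (stripT B T) := (isOpen_strip B).prod isOpen_Ioo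

theorem measurableSet_stripT (B T : ℝ) : MeasurableSet (stripT B T) :=
  (isOpen_stripT B T).measurableSet

/-- On the strip no boundary terms arise from integration by parts in `x`. -/
theorem IsWeakDeriv.strip_integral_add_eq_zero {B : ℝ} (hB : 0 < B) {f f' g g' : ℝ × ℝ → ℝ}
    (hf : IsWeakDeriv (strip B) eX f f') (hg : IsWeakDeriv (strip B) eX g g')
    (mf : MemLp f 2 (stripMeasure B)) (mf' : MemLp f' 2 (stripMeasure B))
    (mg : MemLp g 2 (stripMeasure B)) (mg' : MemLp g' 2 (stripMeasure B)) :
    ∫ p in strip B, (f' p * g p + f p * g' p) = 0 := by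
  obtain ⟨η, h1, h2, h3⟩ := exists_cutoff_seq hB
  have ext : ∀ {k k' : ℝ × ℝ → ℝ}, IsWeakDeriv (strip B) eX k k' → MemLp k 2 (stripMeasure B) →
      MemLp k' 2 (stripMeasure B) →
      IsWeakDeriv univ eX ((strip B).indicator k) ((strip B).indicator k') := by
    intro k k' hk mk mk'
    have := hk.indicator_univ (isOpen_strip B) mk mk' (a := fun _ => 1) contDiff_const
      (fun n p => η n p.2) (fun n => (h1 n).1.comp contDiff_snd) ?_ (fun n p => h2 n p.2)
      (fun p hp => h3 p.2 hp.2) ?_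
    · simpa using this
    · intro n p hp
      simp only [one_mul] at hp
      exact ⟨mem_univ _, (h1 n).2.2
        (tsupport_comp_subset_preimage (η n) continuous_snd hp)⟩
    · intro n p
      have hd := ((h1 n).differentiable p.2).hasFDerivAt.comp p (hasFDerivAt_snd (p := p))
      rw [show (fun p : ℝ × ℝ => η n p.2) = η n ∘ Prod.snd from rfl, hd.fderiv]
      simp [eX]
  have key := (ext hf mf mf').integral_add_eq_zero (ext hg mg mg')
    ((memLp_indicator_iff_restrict (measurableSet_strip B)).2 mf)
    ((memLp_indicator_iff_restrict (measurableSet_strip B)).2 mf')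
    ((memLp_indicator_iff_restrict (measurableSet_strip B)).2 mg)
    ((memLp_indicator_iff_restrict (measurableSet_strip B)).2 mg')
  rw [← key, ← integral_indicator (measurableSet_strip B)]
  refine integral_congr_ae (.of_forall fun p => ?_)
  by_cases hp : p ∈ strip B <;> simp [hp]

/-! ### Weights depending on `x` only -/

/-- A smooth bounded weight `m` on the line whose derivative `m'` is bounded. -/
structure IsWeight (m m' : ℝ → ℝ) : Prop where
  smooth : ContDiff ℝ ((⊤ : ℕ∞) : WithTop ℕ∞) m
  deriv : ∀ x, HasDerivAt m (m' x) x
  bdd : ∃ C, ∀ x, |m x| ≤ C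
  bdd' : ∃ C, ∀ x, |m' x| ≤ C

namespace IsWeight

variable {m m' k k' : ℝ → ℝ}

theorem deriv_eq (h : IsWeight m m') : m' = _root_.deriv m :=
  funext fun x => (h.deriv x).deriv.symm

theorem continuous (h : IsWeight m m') : Continuous m := h.smooth.continuous

theorem continuous' (h : IsWeight m m') : Continuous m' := by
  rw [h.deriv_eq]
  exact h.smooth.continuous_deriv (by simp)

theorem const (c : ℝ) : IsWeight (fun _ => c) (fun _ => 0) :=
  ⟨contDiff_const, fun x => hasDerivAt_const x c, ⟨|c|, fun _ => le_rfl⟩, ⟨0, by simp⟩⟩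

theorem mul (h : IsWeight m m') (l : IsWeight k k') :
    IsWeight (fun x => m x * k x) (fun x => m' x * k x + m x * k' x) := by
  obtain ⟨C1, h1⟩ := h.bdd
  obtain ⟨C2, h2⟩ := h.bdd'
  obtain ⟨C3, h3⟩ := l.bdd
  obtain ⟨C4, h4⟩ := l.bdd'
  have b : ∀ {s t S T : ℝ}, |s| ≤ S → |t| ≤ T → |s * t| ≤ S * T := fun hs ht => by
    rw [abs_mul]
    exact mul_le_mul hs ht (abs_nonneg _) ((abs_nonneg _).trans hs)
  exact ⟨h.smooth.mul l.smooth, fun x => (h.deriv x).mul (l.deriv x),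
    ⟨C1 * C3, fun x => b (h1 x) (h3 x)⟩, ⟨C2 * C3 + C1 * C4, fun x =>
      (abs_add_le _ _).trans (add_le_add (b (h2 x) (h3 x)) (b (h1 x) (h4 x)))⟩⟩

theorem add (h : IsWeight m m') (l : IsWeight k k') :
    IsWeight (fun x => m x + k x) (fun x => m' x + k' x) := by
  obtain ⟨C1, h1⟩ := h.bdd
  obtain ⟨C2, h2⟩ := h.bdd'
  obtain ⟨C3, h3⟩ := l.bdd
  obtain ⟨C4, h4⟩ := l.bdd'
  exact ⟨h.smooth.add l.smooth, fun x => (h.deriv x).add (l.deriv x),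
    ⟨C1 + C3, fun x => (abs_add_le _ _).trans (add_le_add (h1 x) (h3 x))⟩,
    ⟨C2 + C4, fun x => (abs_add_le _ _).trans (add_le_add (h2 x) (h4 x))⟩⟩

theorem congr (h : IsWeight m m') (e : m = k) (e' : m' = k') : IsWeight k k' := e ▸ e' ▸ h

theorem smooth_fst (h : IsWeight m m') :
    ContDiff ℝ ((⊤ : ℕ∞) : WithTop ℕ∞) (fun p : ℝ × ℝ => m p.1) :=
  h.smooth.comp contDiff_fst

theorem fderiv_eX (h : IsWeight m m') (p : ℝ × ℝ) :
    fderiv ℝ (fun p : ℝ × ℝ => m p.1) p eX = m' p.1 := by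
  have hd := (h.deriv p.1).hasFDerivAt.comp p (hasFDerivAt_fst (p := p))
  rw [show (fun p : ℝ × ℝ => m p.1) = m ∘ Prod.fst from rfl, hd.fderiv]
  simp [eX]

theorem fderiv_eY (h : IsWeight m m') (p : ℝ × ℝ) :
    fderiv ℝ (fun p : ℝ × ℝ => m p.1) p eY = 0 := by
  have hd := (h.deriv p.1).hasFDerivAt.comp p (hasFDerivAt_fst (p := p))
  rw [show (fun p : ℝ × ℝ => m p.1) = m ∘ Prod.fst from rfl, hd.fderiv]
  simp [eY]

end IsWeight

theorem MeasureTheory.MemLp.bdd_fst_mul {μ : Measure (ℝ × ℝ)} {q : ℝ≥0∞} {m : ℝ → ℝ} {f : ℝ × ℝ → ℝ}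
    (hf : MemLp f q μ) (hm : Continuous m) (hb : ∃ C, ∀ x, |m x| ≤ C) :
    MemLp (fun p => m p.1 * f p) q μ := by
  obtain ⟨C, hC⟩ := hb
  refine (hf.const_mul C).mono (by
    exact (hm.comp continuous_fst).aestronglyMeasurable.mul hf.aestronglyMeasurable) ?_
  refine .of_forall fun p => ?_
  rw [norm_mul, norm_mul, Real.norm_eq_abs, Real.norm_eq_abs C]
  exact mul_le_mul_of_nonneg_right ((hC p.1).trans (le_abs_self C)) (norm_nonneg _)

theorem IsWeight.memLp_mul {μ : Measure (ℝ × ℝ)} {q : ℝ≥0∞} {m m' : ℝ → ℝ} {f : ℝ × ℝ → ℝ}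
    (h : IsWeight m m') (hf : MemLp f q μ) : MemLp (fun p => m p.1 * f p) q μ :=
  hf.bdd_fst_mul h.continuous h.bdd

theorem IsWeight.memLp_mul' {μ : Measure (ℝ × ℝ)} {q : ℝ≥0∞} {m m' : ℝ → ℝ} {f : ℝ × ℝ → ℝ}
    (h : IsWeight m m') (hf : MemLp f q μ) : MemLp (fun p => m' p.1 * f p) q μ :=
  hf.bdd_fst_mul h.continuous' h.bdd'

/-- Integration by parts in `x` for `f = e^{bx} F` and `g = e^{bx} G`, with `f₁ = e^{bx} F_x` and
`g₁ = e^{bx} G_x`; in these terms `∂ₓ f = f₁ + b f` and `∂ₓ g = g₁ + b g`. -/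
theorem IsWeight.integral_by_parts {B b : ℝ} (hB : 0 < B) {m m' : ℝ → ℝ} (hm : IsWeight m m')
    {f f₁ g g₁ : ℝ × ℝ → ℝ}
    (hf : IsWeakDeriv (strip B) eX f (fun p => f₁ p + b * f p))
    (hg : IsWeakDeriv (strip B) eX g (fun p => g₁ p + b * g p))
    (mf : MemLp f 2 (stripMeasure B)) (mf₁ : MemLp f₁ 2 (stripMeasure B))
    (mg : MemLp g 2 (stripMeasure B)) (mg₁ : MemLp g₁ 2 (stripMeasure B)) :
    (∫ p in strip B, m p.1 * (f₁ p * g p)) + (∫ p in strip B, m p.1 * (f p * g₁ p))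
      + ∫ p in strip B, (m' p.1 + 2 * b * m p.1) * (f p * g p) = 0 := by
  have h1 := hf.smooth_mul (isOpen_strip B) hm.smooth_fst
  simp only [hm.fderiv_eX] at h1
  have key := h1.strip_integral_add_eq_zero hB hg (hm.memLp_mul mf)
    ((hm.memLp_mul (mf₁.add (mf.const_mul b))).add (hm.memLp_mul' mf)) mg
    (mg₁.add (mg.const_mul b))
  have i1 : Integrable (fun p => m p.1 * (f₁ p * g p)) (stripMeasure B) :=
    ((hm.memLp_mul mf₁).integrable_mul mg).congr (.of_forall fun p => mul_assoc _ _ _)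
  have i2 : Integrable (fun p => m p.1 * (f p * g₁ p)) (stripMeasure B) :=
    ((hm.memLp_mul mf).integrable_mul mg₁).congr (.of_forall fun p => mul_assoc _ _ _)
  have i3 : Integrable (fun p => (m' p.1 + 2 * b * m p.1) * (f p * g p)) (stripMeasure B) := by
    have := ((hm.memLp_mul' mf).add ((hm.memLp_mul mf).const_mul (2 * b))).integrable_mul mg
    refine this.congr (.of_forall fun p => ?_)
    simp only [Pi.mul_apply, Pi.add_apply]
    ring
  rw [← integral_add i1 i2, ← integral_add (by exact i1.add i2) i3, ← key]
  refine integral_congr_ae (.of_forall fun p => ?_)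
  simp only
  ring

/-! ### Convergence in `Lᵖ` and limits of integrals of products -/

section LpTendsto

variable {α : Type*} [MeasurableSpace α] {μ : Measure α} {q : ℝ≥0∞} {f g k : α → ℝ}
  {F G : ℕ → α → ℝ}

/-- The sequence `F` converges to `f` in the `Lᵠ`-seminorm. -/
abbrev LpTendsto (q : ℝ≥0∞) (μ : Measure α) (F : ℕ → α → ℝ) (f : α → ℝ) : Prop :=
  Tendsto (fun n => eLpNorm (fun p => f p - F n p) q μ) atTop (𝓝 0)

theorem LpTendsto.add (hq : 1 ≤ q) (hF : LpTendsto q μ F f) (hG : LpTendsto q μ G g)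
    (mF : ∀ n, MemLp (F n) q μ) (mf : MemLp f q μ) (mG : ∀ n, MemLp (G n) q μ) (mg : MemLp g q μ) :
    LpTendsto q μ (fun n p => F n p + G n p) (fun p => f p + g p) := by
  have h := Tendsto.add hF hG
  rw [add_zero] at h
  refine tendsto_of_tendsto_of_tendsto_of_le_of_le tendsto_const_nhds h (fun n => zero_le) ?_
  intro n
  have e : (fun p => f p + g p - (F n p + G n p)) = (f - F n) + (g - G n) := by
    funext p
    simp only [Pi.add_apply, Pi.sub_apply]
    ring
  simp only [e]
  exact eLpNorm_add_le (mf.sub (mF n)).1 (mg.sub (mG n)).1 hq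

theorem LpTendsto.sub (hq : 1 ≤ q) (hF : LpTendsto q μ F f) (hG : LpTendsto q μ G g)
    (mF : ∀ n, MemLp (F n) q μ) (mf : MemLp f q μ) (mG : ∀ n, MemLp (G n) q μ) (mg : MemLp g q μ) :
    LpTendsto q μ (fun n p => F n p - G n p) (fun p => f p - g p) := by
  have h := Tendsto.add hF hG
  rw [add_zero] at h
  refine tendsto_of_tendsto_of_tendsto_of_le_of_le tendsto_const_nhds h (fun n => zero_le) ?_
  intro n
  have e : (fun p => f p - g p - (F n p - G n p)) = (f - F n) - (g - G n) := by
    funext p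
    simp only [Pi.sub_apply]
    ring
  simp only [e]
  exact eLpNorm_sub_le (mf.sub (mF n)).1 (mg.sub (mG n)).1 hq

theorem LpTendsto.bdd_mul (hF : LpTendsto q μ F f) {c : α → ℝ} (hc : ∃ C, ∀ x, |c x| ≤ C) :
    LpTendsto q μ (fun n p => c p * F n p) (fun p => c p * f p) := by
  obtain ⟨C, hC⟩ := hc
  have h : Tendsto (fun n => ENNReal.ofReal |C| * eLpNorm (fun p => f p - F n p) q μ) atTop
      (𝓝 0) := by
    simpa using ENNReal.Tendsto.const_mul hF (Or.inr ENNReal.ofReal_ne_top)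
  refine tendsto_of_tendsto_of_tendsto_of_le_of_le tendsto_const_nhds h (fun n => zero_le) ?_
  intro n
  refine eLpNorm_le_mul_eLpNorm_of_ae_le_mul (.of_forall fun p => ?_) q
  rw [← mul_sub, norm_mul, Real.norm_eq_abs]
  exact mul_le_mul_of_nonneg_right ((hC p).trans (le_abs_self C)) (norm_nonneg _)

instance : ENNReal.HolderTriple 4 4 2 := ⟨by
  rw [← two_mul, show (4 : ℝ≥0∞) = 2 * 2 by norm_num, ENNReal.mul_inv (by simp) (by simp),
    ← mul_assoc, ENNReal.mul_inv_cancel (by simp) (by simp), one_mul]⟩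

theorem LpTendsto.mul_left {q r s : ℝ≥0∞} [ENNReal.HolderTriple q r s] (hF : LpTendsto r μ F f)
    (mF : ∀ n, MemLp (F n) r μ) (mf : MemLp f r μ) (mk : MemLp k q μ) :
    LpTendsto s μ (fun n p => k p * F n p) (fun p => k p * f p) := by
  have h : Tendsto (fun n => eLpNorm k q μ * eLpNorm (fun p => f p - F n p) r μ) atTop
      (𝓝 0) := by
    simpa using ENNReal.Tendsto.const_mul hF (Or.inr mk.2.ne)
  refine tendsto_of_tendsto_of_tendsto_of_le_of_le tendsto_const_nhds h (fun n => zero_le) ?_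
  intro n
  have e : (fun p => k p * f p - k p * F n p) = k • (f - F n) := by
    funext p
    simp only [Pi.smul_apply', Pi.sub_apply, smul_eq_mul]
    ring
  simp only [e]
  exact eLpNorm_smul_le_mul_eLpNorm (p := q) (q := r) (r := s) (mf.sub (mF n)).1 mk.1

theorem LpTendsto.integral_mul (hF : LpTendsto 2 μ F f)
    (mF : ∀ n, MemLp (F n) 2 μ) (mf : MemLp f 2 μ) (mk : MemLp k 2 μ) :
    Tendsto (fun n => ∫ p, k p * F n p ∂μ) atTop (𝓝 (∫ p, k p * f p ∂μ)) := by
  have h := hF.mul_left (s := 1) mF mf mk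
  refine tendsto_integral_of_L1' _ (mk.integrable_mul mf).1
    (.of_forall fun n => mk.integrable_mul (mF n)) (h.congr fun n => ?_)
  exact eLpNorm_sub_comm _ _ _ _

end LpTendsto

/-! ### Limits of test functions and the Ladyzhenskaya inequality -/

/-- `f` is the `L²`-limit of test functions on `Ω` whose first derivatives converge in `L²` to
`fx` and `fy`. -/
structure IsTestLimit (Ω : Set (ℝ × ℝ)) (f fx fy : ℝ × ℝ → ℝ) : Prop where
  mem : MemLp f 2 (volume.restrict Ω)
  mem_x : MemLp fx 2 (volume.restrict Ω)
  mem_y : MemLp fy 2 (volume.restrict Ω)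
  approx : ∃ φ : ℕ → ℝ × ℝ → ℝ, (∀ n, IsTestFunction Ω (φ n)) ∧
    LpTendsto 2 (volume.restrict Ω) φ f ∧
    LpTendsto 2 (volume.restrict Ω) (fun n p => fderiv ℝ (φ n) p eX) fx ∧
    LpTendsto 2 (volume.restrict Ω) (fun n p => fderiv ℝ (φ n) p eY) fy

section TestLimit

variable {Ω : Set (ℝ × ℝ)}

theorem MemH10.exists_isTestLimit {f : ℝ × ℝ → ℝ} (h : MemH10 Ω f) :
    ∃ fx fy, IsWeakDeriv Ω eX f fx ∧ IsWeakDeriv Ω eY f fy ∧ IsTestLimit Ω f fx fy := by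
  obtain ⟨fx, fy, h1, h2, h3, h4, h5, h6⟩ := h
  exact ⟨fx, fy, h1, h2, h3, h4, h5, h6⟩

theorem IsTestFunction.memLp {φ : ℝ × ℝ → ℝ} (hφ : IsTestFunction Ω φ) (q : ℝ≥0∞)
    (S : Set (ℝ × ℝ)) : MemLp φ q (volume.restrict S) :=
  (hφ.continuous.memLp_of_hasCompactSupport hφ.2.1).restrict S

theorem IsTestFunction.fderiv_sub_apply {φ ψ : ℝ × ℝ → ℝ} (hφ : IsTestFunction Ω φ)
    (hψ : IsTestFunction Ω ψ) (p v : ℝ × ℝ) :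
    fderiv ℝ (fun p => φ p - ψ p) p v = fderiv ℝ φ p v - fderiv ℝ ψ p v := by
  rw [fderiv_fun_sub (hφ.differentiable p) (hψ.differentiable p)]
  rfl

theorem IsTestLimit.sub {f fx fy g gx gy : ℝ × ℝ → ℝ} (hf : IsTestLimit Ω f fx fy)
    (hg : IsTestLimit Ω g gx gy) :
    IsTestLimit Ω (fun p => f p - g p) (fun p => fx p - gx p) (fun p => fy p - gy p) := by
  obtain ⟨φ, h1, h2, h3, h4⟩ := hf.approx
  obtain ⟨ψ, k1, k2, k3, k4⟩ := hg.approx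
  refine ⟨hf.mem.sub hg.mem, hf.mem_x.sub hg.mem_x, hf.mem_y.sub hg.mem_y,
    fun n p => φ n p - ψ n p, fun n => (h1 n).sub (k1 n), ?_, ?_, ?_⟩
  · exact h2.sub (by norm_num) k2 (fun n => (h1 n).memLp _ _) hf.mem (fun n => (k1 n).memLp _ _)
      hg.mem
  · simp only [(h1 _).fderiv_sub_apply (k1 _)]
    exact h3.sub (by norm_num) k3 (fun n => ((h1 n).fderiv_apply _).memLp _ _) hf.mem_x
      (fun n => ((k1 n).fderiv_apply _).memLp _ _) hg.mem_x
  · simp only [(h1 _).fderiv_sub_apply (k1 _)]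
    exact h4.sub (by norm_num) k4 (fun n => ((h1 n).fderiv_apply _).memLp _ _) hf.mem_y
      (fun n => ((k1 n).fderiv_apply _).memLp _ _) hg.mem_y

theorem IsTestFunction.isTestLimit {φ : ℝ × ℝ → ℝ} (hφ : IsTestFunction Ω φ) :
    IsTestLimit Ω φ (fun p => fderiv ℝ φ p eX) (fun p => fderiv ℝ φ p eY) :=
  ⟨hφ.memLp _ _, (hφ.fderiv_apply _).memLp _ _, (hφ.fderiv_apply _).memLp _ _, fun _ => φ,
    fun _ => hφ, by simp [LpTendsto], by simp [LpTendsto], by simp [LpTendsto]⟩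

theorem IsTestLimit.weight_mul {f fx fy : ℝ × ℝ → ℝ} (hf : IsTestLimit Ω f fx fy)
    {m m' : ℝ → ℝ} (hm : IsWeight m m') :
    IsTestLimit Ω (fun p => m p.1 * f p) (fun p => m p.1 * fx p + m' p.1 * f p)
      (fun p => m p.1 * fy p) := by
  obtain ⟨φ, h1, h2, h3, h4⟩ := hf.approx
  have hb : ∃ C, ∀ p : ℝ × ℝ, |m p.1| ≤ C := hm.bdd.imp fun C hC p => hC p.1
  have hb' : ∃ C, ∀ p : ℝ × ℝ, |m' p.1| ≤ C := hm.bdd'.imp fun C hC p => hC p.1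
  have dm : ∀ p, DifferentiableAt ℝ (fun p : ℝ × ℝ => m p.1) p :=
    hm.smooth_fst.differentiable (by simp)
  refine ⟨hm.memLp_mul hf.mem, (hm.memLp_mul hf.mem_x).add (hm.memLp_mul' hf.mem),
    hm.memLp_mul hf.mem_y, fun n p => m p.1 * φ n p, fun n => (h1 n).smooth_mul hm.smooth_fst,
    h2.bdd_mul hb, ?_, ?_⟩
  · simp only [fderiv_mul_apply (dm _) ((h1 _).differentiable _), hm.fderiv_eX]
    exact (h3.bdd_mul hb).add (by norm_num) (h2.bdd_mul hb')
      (fun n => hm.memLp_mul (((h1 n).fderiv_apply _).memLp _ _)) (hm.memLp_mul hf.mem_x)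
      (fun n => hm.memLp_mul' ((h1 n).memLp _ _)) (hm.memLp_mul' hf.mem)
  · simp only [fderiv_mul_apply (dm _) ((h1 _).differentiable _), hm.fderiv_eY, zero_mul, add_zero]
    exact h4.bdd_mul hb

theorem IsTestLimit.congr_x {f fx fx' fy : ℝ × ℝ → ℝ} (hf : IsTestLimit Ω f fx fy)
    (h : fx =ᵐ[volume.restrict Ω] fx') : IsTestLimit Ω f fx' fy := by
  obtain ⟨φ, h1, h2, h3, h4⟩ := hf.approx
  refine ⟨hf.mem, hf.mem_x.ae_eq h, hf.mem_y, φ, h1, h2, h3.congr fun n => ?_, h4⟩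
  exact eLpNorm_congr_ae (by filter_upwards [h] with p hp; rw [hp])

/-- Limits of test functions satisfy the integration by parts formula in `y` without boundary
terms. -/
theorem IsTestLimit.integral_y {f fx fy g gy : ℝ × ℝ → ℝ} (hf : IsTestLimit Ω f fx fy)
    (hg : IsWeakDeriv Ω eY g gy) (mg : MemLp g 2 (volume.restrict Ω))
    (mgy : MemLp gy 2 (volume.restrict Ω)) :
    ∫ p in Ω, gy p * f p = -∫ p in Ω, g p * fy p := by
  obtain ⟨φ, h1, h2, h3, h4⟩ := hf.approx
  have t1 := h2.integral_mul (fun n => (h1 n).memLp _ _) hf.mem mgy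
  have t2 := (h4.integral_mul (fun n => ((h1 n).fderiv_apply _).memLp _ _) hf.mem_y mg).neg
  refine tendsto_nhds_unique t1 (t2.congr fun n => ?_)
  rw [hg.2.2 _ (h1 n), neg_neg]

theorem eLpNorm_sq_two {α : Type*} [MeasurableSpace α] (f : α → ℝ) (μ : Measure α) :
    eLpNorm (fun p => f p ^ 2) 2 μ = eLpNorm f 4 μ ^ 2 := by
  have h := eLpNorm_norm_rpow (p := 2) (q := 2) (μ := μ) f (by norm_num)
  have e : (2 : ℝ≥0∞) * ENNReal.ofReal 2 = 4 := by norm_num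
  rw [e] at h
  have e2 : ∀ x : ℝ≥0∞, x ^ (2 : ℝ) = x ^ 2 := fun x => by
    rw [← ENNReal.rpow_natCast]; norm_num
  rw [e2] at h
  rw [← h]
  congr 1
  funext p
  rw [Real.rpow_two, Real.norm_eq_abs, sq_abs]

/-- The Ladyzhenskaya inequality for test functions of the plane, from the
Gagliardo–Nirenberg–Sobolev inequality `‖φ²‖₂ ≤ C ‖∇(φ²)‖₁`. -/
theorem exists_ladyzhenskaya_test : ∃ C : NNReal, ∀ φ : ℝ × ℝ → ℝ, IsTestFunction univ φ →
    eLpNorm φ 4 volume ^ 2 ≤ C * (eLpNorm φ 2 volume *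
      (eLpNorm (fun p => fderiv ℝ φ p eX) 2 volume
        + eLpNorm (fun p => fderiv ℝ φ p eY) 2 volume)) := by
  refine ⟨eLpNormLESNormFDerivOneConst (volume : Measure (ℝ × ℝ)) 2 * 2, fun φ hφ => ?_⟩
  have hx := (hφ.fderiv_apply eX).continuous
  have hy := (hφ.fderiv_apply eY).continuous
  have hsm : IsTestFunction univ fun p => φ p * φ p := hφ.smooth_mul hφ.1
  have h1 := eLpNorm_le_eLpNorm_fderiv_one (volume : Measure (ℝ × ℝ)) (p := 2)
    (hsm.1.of_le (by exact_mod_cast le_top)) hsm.2.1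
    (by simpa using NNReal.HolderConjugate.two_two)
  have h2 : eLpNorm (fderiv ℝ fun p => φ p * φ p) 1 volume
      ≤ 2 * eLpNorm (φ • fun p => |fderiv ℝ φ p eX| + |fderiv ℝ φ p eY|) 1 volume := by
    have := eLpNorm_le_mul_eLpNorm_of_ae_le_mul (c := 2) (μ := (volume : Measure (ℝ × ℝ)))
      (f := fderiv ℝ fun p => φ p * φ p)
      (g := φ • fun p => |fderiv ℝ φ p eX| + |fderiv ℝ φ p eY|) (.of_forall fun p => ?_) 1
    · simpa using this
    · have hd := hφ.differentiable p
      rw [fderiv_fun_mul hd hd, ← two_smul ℝ (φ p • fderiv ℝ φ p), norm_smul, norm_smul]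
      simp only [Pi.smul_apply', smul_eq_mul, norm_mul, Real.norm_ofNat]
      gcongr
      rw [Real.norm_of_nonneg (by positivity)]
      refine ContinuousLinearMap.opNorm_le_bound _ (by positivity) fun w => ?_
      have hw : w = w.1 • eX + w.2 • eY := by simp [eX, eY]
      have e : fderiv ℝ φ p w = w.1 * fderiv ℝ φ p eX + w.2 * fderiv ℝ φ p eY := by
        conv_lhs => rw [hw]
        simp
      have n1 : |w.1| ≤ ‖w‖ := norm_fst_le w
      have n2 : |w.2| ≤ ‖w‖ := norm_snd_le w
      rw [e, Real.norm_eq_abs]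
      refine (abs_add_le _ _).trans ?_
      rw [abs_mul, abs_mul, add_mul]
      refine add_le_add ?_ ?_
      · rw [mul_comm]; gcongr
      · rw [mul_comm]; gcongr
  have h3 : eLpNorm (φ • fun p => |fderiv ℝ φ p eX| + |fderiv ℝ φ p eY|) 1 volume
      ≤ eLpNorm φ 2 volume * (eLpNorm (fun p => fderiv ℝ φ p eX) 2 volume
        + eLpNorm (fun p => fderiv ℝ φ p eY) 2 volume) := by
    refine (eLpNorm_smul_le_mul_eLpNorm (p := 2) (q := 2) (hx.abs.add hy.abs).aestronglyMeasurable
      hφ.continuous.aestronglyMeasurable).trans ?_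
    gcongr
    refine (eLpNorm_add_le hx.abs.aestronglyMeasurable hy.abs.aestronglyMeasurable
      (by norm_num)).trans (le_of_eq ?_)
    congr 1
    · exact eLpNorm_norm (fun p => fderiv ℝ φ p eX)
    · exact eLpNorm_norm (fun p => fderiv ℝ φ p eY)
  simp only [NNReal.coe_ofNat, ENNReal.coe_ofNat] at h1
  rw [← eLpNorm_sq_two]
  simp only [sq]
  refine h1.trans ?_
  rw [ENNReal.coe_mul, mul_assoc]
  gcongr
  refine h2.trans ?_
  norm_cast
  gcongr

/-- The Ladyzhenskaya inequality `‖f‖₄² ≤ C ‖f‖₂ ‖∇f‖₂` for limits of test functions, with a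
constant that does not depend on the domain. -/
theorem exists_ladyzhenskaya : ∃ C : NNReal, ∀ Ω : Set (ℝ × ℝ), MeasurableSet Ω →
    ∀ f fx fy : ℝ × ℝ → ℝ, IsTestLimit Ω f fx fy →
    eLpNorm f 4 (volume.restrict Ω) ^ 2 ≤ C * (eLpNorm f 2 (volume.restrict Ω) *
      (eLpNorm fx 2 (volume.restrict Ω) + eLpNorm fy 2 (volume.restrict Ω))) := by
  obtain ⟨C, hC⟩ := exists_ladyzhenskaya_test
  refine ⟨C, fun Ω hΩ f fx fy hf => ?_⟩
  obtain ⟨φ, h1, h2, h3, h4⟩ := hf.approx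
  set μ := (volume : Measure (ℝ × ℝ)).restrict Ω
  have hr : ∀ {ψ : ℝ × ℝ → ℝ}, IsTestFunction Ω ψ → ∀ q, eLpNorm ψ q volume = eLpNorm ψ q μ :=
    fun hψ q => (eLpNorm_restrict_eq_of_support_subset
      ((subset_tsupport _).trans hψ.2.2)).symm
  have hbd : ∀ n, eLpNorm (φ n) 4 μ ^ 2 ≤ C * ((eLpNorm f 2 μ + eLpNorm (fun p => f p - φ n p) 2 μ)
      * ((eLpNorm fx 2 μ + eLpNorm (fun p => fx p - fderiv ℝ (φ n) p eX) 2 μ)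
        + (eLpNorm fy 2 μ + eLpNorm (fun p => fy p - fderiv ℝ (φ n) p eY) 2 μ))) := by
    intro n
    have tri : ∀ {k ψ : ℝ × ℝ → ℝ}, MemLp k 2 μ → MemLp ψ 2 μ →
        eLpNorm ψ 2 μ ≤ eLpNorm k 2 μ + eLpNorm (fun p => k p - ψ p) 2 μ := by
      intro k ψ hk hψ
      refine le_trans (le_of_eq ?_) (eLpNorm_sub_le hk.1 (hk.sub hψ).1 (by norm_num))
      congr 1
      funext p
      simp
    have := hC (φ n) ⟨(h1 n).1, (h1 n).2.1, subset_univ _⟩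
    rw [hr (h1 n), hr (h1 n), hr ((h1 n).fderiv_apply _), hr ((h1 n).fderiv_apply _)] at this
    refine this.trans ?_
    gcongr
    · exact tri hf.mem ((h1 n).memLp _ _)
    · exact tri hf.mem_x (((h1 n).fderiv_apply _).memLp _ _)
    · exact tri hf.mem_y (((h1 n).fderiv_apply _).memLp _ _)
  -- Fatou's lemma along a subsequence that converges almost everywhere
  obtain ⟨ns, hns, hae⟩ := (tendstoInMeasure_of_tendsto_eLpNorm (two_ne_zero)
    (fun n => ((h1 n).memLp 2 Ω).1) hf.mem.1 (h2.congr fun n => by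
      exact eLpNorm_sub_comm _ _ _ _)).exists_seq_tendsto_ae
  have hfatou := Lp.eLpNorm_lim_le_liminf_eLpNorm (p := 2) (μ := μ)
    (f := fun k p => φ (ns k) p ^ 2)
    (fun k => ((h1 (ns k)).continuous.pow 2).aestronglyMeasurable) (fun p => f p ^ 2)
    (by filter_upwards [hae] with p hp using hp.pow 2)
  rw [eLpNorm_sq_two] at hfatou
  simp only [eLpNorm_sq_two] at hfatou
  refine hfatou.trans ?_
  have lim : ∀ {k : ℝ × ℝ → ℝ} {F : ℕ → ℝ × ℝ → ℝ}, LpTendsto 2 μ F k →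
      Tendsto (fun n => eLpNorm k 2 μ + eLpNorm (fun p => k p - F n p) 2 μ) atTop
        (𝓝 (eLpNorm k 2 μ)) := by
    intro k F hF
    simpa using hF.const_add (eLpNorm k 2 μ)
  have hlim := ENNReal.Tendsto.const_mul (a := (C : ℝ≥0∞)) (ENNReal.Tendsto.mul (lim h2)
    (Or.inr (ENNReal.add_lt_top.2 ⟨hf.mem_x.2, hf.mem_y.2⟩).ne) ((lim h3).add (lim h4))
    (Or.inr hf.mem.2.ne)) (Or.inr ENNReal.coe_ne_top)
  rw [← (hlim.comp hns.tendsto_atTop).liminf_eq]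
  exact liminf_le_liminf (.of_forall fun k => hbd (ns k))

theorem IsTestLimit.memLp_four {f fx fy : ℝ × ℝ → ℝ} (hΩ : MeasurableSet Ω)
    (hf : IsTestLimit Ω f fx fy) : MemLp f 4 (volume.restrict Ω) := by
  obtain ⟨C, hC⟩ := exists_ladyzhenskaya
  refine ⟨hf.mem.1, ?_⟩
  have h := (hC Ω hΩ f fx fy hf).trans_lt (ENNReal.mul_lt_top ENNReal.coe_lt_top
    (ENNReal.mul_lt_top hf.mem.2 (ENNReal.add_lt_top.2 ⟨hf.mem_x.2, hf.mem_y.2⟩)))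
  by_contra hc
  rw [not_lt, top_le_iff] at hc
  simp [hc] at h

/-- By the Ladyzhenskaya inequality the approximating test functions also converge in `L⁴`. -/
theorem IsTestLimit.exists_approx_four {f fx fy : ℝ × ℝ → ℝ} (hΩ : MeasurableSet Ω)
    (hf : IsTestLimit Ω f fx fy) : ∃ φ : ℕ → ℝ × ℝ → ℝ, (∀ n, IsTestFunction Ω (φ n)) ∧
      LpTendsto 2 (volume.restrict Ω) φ f ∧
      LpTendsto 2 (volume.restrict Ω) (fun n p => fderiv ℝ (φ n) p eX) fx ∧
      LpTendsto 4 (volume.restrict Ω) φ f := by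
  obtain ⟨C, hC⟩ := exists_ladyzhenskaya
  obtain ⟨φ, h1, h2, h3, h4⟩ := hf.approx
  refine ⟨φ, h1, h2, h3, ?_⟩
  have h5 : Tendsto (fun n => (C : ℝ≥0∞) * (eLpNorm (fun p => f p - φ n p) 2 (volume.restrict Ω) *
      (eLpNorm (fun p => fx p - fderiv ℝ (φ n) p eX) 2 (volume.restrict Ω)
        + eLpNorm (fun p => fy p - fderiv ℝ (φ n) p eY) 2 (volume.restrict Ω)))) atTop (𝓝 0) := by
    have := ENNReal.Tendsto.const_mul (a := (C : ℝ≥0∞)) (ENNReal.Tendsto.mul h2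
      (Or.inr (by simp)) (Tendsto.add h3 h4) (Or.inr (by simp))) (Or.inr ENNReal.coe_ne_top)
    simpa using this
  have h6 : Tendsto (fun n => eLpNorm (fun p => f p - φ n p) 4 (volume.restrict Ω) ^ 2) atTop
      (𝓝 0) := tendsto_of_tendsto_of_tendsto_of_le_of_le tendsto_const_nhds h5
    (fun n => zero_le) fun n => hC Ω hΩ _ _ _ (hf.sub (h1 n).isTestLimit)
  have h7 := (ENNReal.continuous_rpow_const (y := 1 / 2)).tendsto 0 |>.comp h6
  rw [ENNReal.zero_rpow_of_pos (by norm_num)] at h7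
  refine h7.congr fun n => ?_
  simp only [Function.comp]
  rw [← ENNReal.rpow_natCast, ← ENNReal.rpow_mul]
  norm_num

end TestLimit

/-! ### Trilinear integrals -/

theorem MeasureTheory.MemLp.mul_four {α : Type*} [MeasurableSpace α] {μ : Measure α} {f g : α → ℝ}
    (hf : MemLp f 4 μ) (hg : MemLp g 4 μ) : MemLp (fun p => f p * g p) 2 μ :=
  MemLp.mul (p := 4) (q := 4) (r := 2) hg hf

/-- Integration by parts in `x` for a weighted product of three functions, two of which are limits
of test functions. -/
theorem IsWeight.integral_by_parts_three {Ω : Set (ℝ × ℝ)} (hΩ : MeasurableSet Ω) {m m' : ℝ → ℝ}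
    (hm : IsWeight m m')
    {f fx g gx gy h hx hy : ℝ × ℝ → ℝ} (wf : IsWeakDeriv Ω eX f fx)
    (mf : MemLp f 2 (volume.restrict Ω)) (mf4 : MemLp f 4 (volume.restrict Ω))
    (mfx : MemLp fx 2 (volume.restrict Ω))
    (hg : IsTestLimit Ω g gx gy) (hh : IsTestLimit Ω h hx hy) :
    (∫ p in Ω, m p.1 * fx p * (g p * h p)) + (∫ p in Ω, m p.1 * f p * h p * gx p)
      + (∫ p in Ω, m p.1 * f p * g p * hx p) + ∫ p in Ω, m' p.1 * f p * (g p * h p) = 0 := by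
  obtain ⟨ψ, a1, a2, a3, -⟩ := hg.exists_approx_four hΩ
  obtain ⟨θ, b1, b2, b3, b4⟩ := hh.exists_approx_four hΩ
  have dm : ∀ p, DifferentiableAt ℝ (fun p : ℝ × ℝ => m p.1) p :=
    hm.smooth_fst.differentiable (by simp)
  have hdx : ∀ {ψ θ : ℝ × ℝ → ℝ}, IsTestFunction Ω ψ → IsTestFunction Ω θ → ∀ p,
      fderiv ℝ (fun p => m p.1 * (θ p * ψ p)) p eX = m p.1 * (θ p * fderiv ℝ ψ p eX
        + fderiv ℝ θ p eX * ψ p) + m' p.1 * (θ p * ψ p) := by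
    intro ψ θ hψ hθ p
    rw [fderiv_mul_apply (φ := fun p => θ p * ψ p) (dm p)
        ((hθ.differentiable p).mul (hψ.differentiable p)),
      fderiv_mul_apply (hθ.differentiable p) (hψ.differentiable p), hm.fderiv_eX]
  have bddtest : ∀ {θ k : ℝ × ℝ → ℝ}, IsTestFunction Ω θ → MemLp k 2 (volume.restrict Ω) →
      MemLp (fun p => k p * θ p) 2 (volume.restrict Ω) := by
    intro θ k hθ hk
    exact MemLp.mul (p := 2) (q := ∞) (r := 2) (hθ.memLp ∞ Ω) hk
  have M2 := hm.memLp_mul mf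
  have M2' := hm.memLp_mul' mf
  have M2x := hm.memLp_mul mfx
  -- two test functions
  have s1 : ∀ {ψ θ : ℝ × ℝ → ℝ}, IsTestFunction Ω ψ → IsTestFunction Ω θ →
      (∫ p in Ω, m p.1 * fx p * θ p * ψ p) + (∫ p in Ω, m p.1 * f p * θ p * fderiv ℝ ψ p eX)
      + (∫ p in Ω, m p.1 * f p * fderiv ℝ θ p eX * ψ p)
      + (∫ p in Ω, m' p.1 * f p * θ p * ψ p) = 0 := by
    intro ψ θ hψ hθ
    have key := wf.2.2 _ ((hψ.smooth_mul hθ.1).smooth_mul hm.smooth_fst)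
    simp only [hdx hψ hθ] at key
    have i1 : Integrable (fun p => m p.1 * f p * θ p * fderiv ℝ ψ p eX) (volume.restrict Ω) :=
      (bddtest hθ M2).integrable_mul ((hψ.fderiv_apply eX).memLp 2 Ω)
    have i2 : Integrable (fun p => m p.1 * f p * fderiv ℝ θ p eX * ψ p) (volume.restrict Ω) :=
      (bddtest (hθ.fderiv_apply eX) M2).integrable_mul (hψ.memLp 2 Ω)
    have i3 : Integrable (fun p => m' p.1 * f p * θ p * ψ p) (volume.restrict Ω) :=
      (bddtest hθ M2').integrable_mul (hψ.memLp 2 Ω)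
    have e1 : ∫ p in Ω, fx p * (m p.1 * (θ p * ψ p)) = ∫ p in Ω, m p.1 * fx p * θ p * ψ p :=
      integral_congr_ae (.of_forall fun p => by ring)
    have e2 : ∫ p in Ω, f p * (m p.1 * (θ p * fderiv ℝ ψ p eX + fderiv ℝ θ p eX * ψ p)
        + m' p.1 * (θ p * ψ p)) = (∫ p in Ω, m p.1 * f p * θ p * fderiv ℝ ψ p eX)
      + (∫ p in Ω, m p.1 * f p * fderiv ℝ θ p eX * ψ p)
      + (∫ p in Ω, m' p.1 * f p * θ p * ψ p) := by
      rw [← integral_add i1 i2, ← integral_add (by exact i1.add i2) i3]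
      exact integral_congr_ae (.of_forall fun p => by ring)
    rw [e1, e2] at key
    linarith
  -- one test function
  have s2 : ∀ {θ : ℝ × ℝ → ℝ}, IsTestFunction Ω θ →
      (∫ p in Ω, m p.1 * fx p * θ p * g p) + (∫ p in Ω, m p.1 * f p * θ p * gx p)
      + (∫ p in Ω, m p.1 * f p * fderiv ℝ θ p eX * g p)
      + (∫ p in Ω, m' p.1 * f p * θ p * g p) = 0 := by
    intro θ hθ
    have mψ : ∀ n, MemLp (ψ n) 2 (volume.restrict Ω) := fun n => (a1 n).memLp _ _
    have t1 := a2.integral_mul mψ hg.mem (bddtest hθ M2x)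
    have t2 := a3.integral_mul (fun n => ((a1 n).fderiv_apply _).memLp _ _) hg.mem_x
      (bddtest hθ M2)
    have t3 := a2.integral_mul mψ hg.mem (bddtest (hθ.fderiv_apply eX) M2)
    have t4 := a2.integral_mul mψ hg.mem (bddtest hθ M2')
    refine tendsto_nhds_unique (((t1.add t2).add t3).add t4) ?_
    exact tendsto_const_nhds.congr fun n => (s1 (a1 n) hθ).symm
  have g4 := hg.memLp_four hΩ
  have h4 := hh.memLp_four hΩ
  have mθ : ∀ n, MemLp (θ n) 4 (volume.restrict Ω) := fun n => (b1 n).memLp _ _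
  have t1 := (b4.mul_left (s := 2) mθ h4 g4).integral_mul (fun n => g4.mul_four (mθ n))
    (g4.mul_four h4) M2x
  have t2 := (b4.mul_left (s := 2) mθ h4 (hm.memLp_mul mf4)).integral_mul
    (fun n => (hm.memLp_mul mf4).mul_four (mθ n)) ((hm.memLp_mul mf4).mul_four h4) hg.mem_x
  have t3 := b3.integral_mul (fun n => ((b1 n).fderiv_apply _).memLp _ _) hh.mem_x
    ((hm.memLp_mul mf4).mul_four g4)
  have t4 := (b4.mul_left (s := 2) mθ h4 g4).integral_mul (fun n => g4.mul_four (mθ n))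
    (g4.mul_four h4) M2'
  have e : ∀ p, gx p * (m p.1 * f p * h p) = m p.1 * f p * h p * gx p := fun p => by ring
  simp only [e] at t2
  refine tendsto_nhds_unique (((t1.add t2).add t3).add t4) ?_
  refine tendsto_const_nhds.congr fun n => ?_
  rw [← s2 (b1 n)]
  refine congrArg₂ _ (congrArg₂ _ (congrArg₂ _ ?_ ?_) ?_) ?_
  all_goals exact integral_congr_ae (.of_forall fun p => by ring)

theorem integral_sq_eq_toReal {α : Type*} [MeasurableSpace α] {μ : Measure α} {f : α → ℝ}
    (hf : MemLp f 2 μ) : ∫ p, f p ^ 2 ∂μ = (eLpNorm f 2 μ).toReal ^ 2 := by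
  have h := hf.eLpNorm_eq_integral_rpow_norm (by norm_num) (by norm_num)
  rw [h]
  have h0 : 0 ≤ ∫ p, f p ^ 2 ∂μ := integral_nonneg fun p => sq_nonneg _
  simp only [ENNReal.toReal_ofNat, Real.rpow_two, Real.norm_eq_abs, sq_abs]
  rw [ENNReal.toReal_ofReal (by positivity), ← Real.rpow_natCast, ← Real.rpow_mul h0]
  norm_num

theorem integral_mul_sq_le {α : Type*} [MeasurableSpace α] {μ : Measure α} {f g : α → ℝ}
    (hf : MemLp f 2 μ) (hg : MemLp g 2 μ) :
    ∫ p, |f p| * |g p| ∂μ ≤ (eLpNorm f 2 μ).toReal * (eLpNorm g 2 μ).toReal := by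
  have h := integral_mul_norm_le_Lp_mul_Lq (μ := μ) (f := f) (g := g) Real.HolderConjugate.two_two
    (by simpa using hf) (by simpa using hg)
  have e : ∀ {k : α → ℝ}, MemLp k 2 μ →
      (∫ a, ‖k a‖ ^ (2 : ℝ) ∂μ) ^ (1 / (2 : ℝ)) = (eLpNorm k 2 μ).toReal := by
    intro k hk
    simp only [Real.rpow_two, Real.norm_eq_abs, sq_abs]
    rw [integral_sq_eq_toReal hk, ← Real.sqrt_eq_rpow, Real.sqrt_sq ENNReal.toReal_nonneg]
  rw [e hf, e hg] at h
  simpa only [Real.norm_eq_abs] using h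

/-- The form in which the Ladyzhenskaya inequality is used: the quadratic form `∫ |k| f²` is
controlled by an arbitrarily small multiple of `‖∇f‖²`, at the price of `‖k‖² ‖f‖²`. -/
theorem exists_integral_mul_sq_le : ∃ C : ℝ, 0 ≤ C ∧ ∀ Ω : Set (ℝ × ℝ), MeasurableSet Ω →
    ∀ k f fx fy : ℝ × ℝ → ℝ, MemLp k 2 (volume.restrict Ω) → IsTestLimit Ω f fx fy →
    ∀ ε : ℝ, 0 < ε →
    ∫ p in Ω, |k p| * f p ^ 2 ≤ ε * ((∫ p in Ω, fx p ^ 2) + ∫ p in Ω, fy p ^ 2)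
      + C / ε * (∫ p in Ω, k p ^ 2) * ∫ p in Ω, f p ^ 2 := by
  obtain ⟨C, hC⟩ := exists_ladyzhenskaya
  refine ⟨(C : ℝ) ^ 2, by positivity, fun Ω hΩ k f fx fy hk hf ε hε => ?_⟩
  have h4 := hf.memLp_four hΩ
  have h1 := integral_mul_sq_le hk (by simpa only [sq] using h4.mul_four h4 :
    MemLp (fun p => f p ^ 2) 2 (volume.restrict Ω))
  rw [eLpNorm_sq_two, ENNReal.toReal_pow] at h1
  have h2 := ENNReal.toReal_mono (ENNReal.mul_lt_top ENNReal.coe_lt_top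
    (ENNReal.mul_lt_top hf.mem.2 (ENNReal.add_lt_top.2 ⟨hf.mem_x.2, hf.mem_y.2⟩))).ne
    (hC Ω hΩ f fx fy hf)
  rw [ENNReal.toReal_pow, ENNReal.toReal_mul, ENNReal.toReal_mul,
    ENNReal.toReal_add hf.mem_x.2.ne hf.mem_y.2.ne, ENNReal.coe_toReal] at h2
  rw [integral_sq_eq_toReal hk, integral_sq_eq_toReal hf.mem, integral_sq_eq_toReal hf.mem_x,
    integral_sq_eq_toReal hf.mem_y]
  simp only [abs_pow, sq_abs] at h1
  set K := (eLpNorm k 2 (volume.restrict Ω)).toReal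
  set F := (eLpNorm f 2 (volume.restrict Ω)).toReal
  set X := (eLpNorm fx 2 (volume.restrict Ω)).toReal
  set Y := (eLpNorm fy 2 (volume.restrict Ω)).toReal
  have hK : 0 ≤ K := ENNReal.toReal_nonneg
  have h3 := h1.trans (mul_le_mul_of_nonneg_left h2 hK)
  refine h3.trans ?_
  have hsq : ∀ Z : ℝ, C * K * F * Z ≤ ε * Z ^ 2 + C ^ 2 / (4 * ε) * K ^ 2 * F ^ 2 := by
    intro Z
    have : ε * Z ^ 2 + C ^ 2 / (4 * ε) * K ^ 2 * F ^ 2 - C * K * F * Z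
        = ε * (Z - C * K * F / (2 * ε)) ^ 2 := by
      field_simp
      ring
    have h0 : 0 ≤ ε * (Z - C * K * F / (2 * ε)) ^ 2 := by positivity
    linarith
  have e1 : C ^ 2 / ε * K ^ 2 * F ^ 2 = 4 * (C ^ 2 / (4 * ε) * K ^ 2 * F ^ 2) := by
    field_simp
  have e0 : 0 ≤ (C : ℝ) ^ 2 / (4 * ε) * K ^ 2 * F ^ 2 := by positivity
  rw [e1]
  nlinarith [hsq X, hsq Y]

/-! ### Logistic weights -/

/-- The weight `e^{ax} / (e^{cx} + δ)`. For `a = c` it is a logistic cutoff of the left half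
line, which increases to `1` as `δ → 0`. -/
noncomputable def expWeight (c δ a x : ℝ) : ℝ := Real.exp (a * x) / (Real.exp (c * x) + δ)

section ExpWeight

variable {c δ a : ℝ}

theorem expWeight_nonneg (hδ : 0 < δ) (x : ℝ) : 0 ≤ expWeight c δ a x := by
  unfold expWeight; positivity

theorem expWeight_self_le_one (hδ : 0 < δ) (x : ℝ) : expWeight c δ c x ≤ 1 := by
  unfold expWeight
  rw [div_le_one (by positivity)]
  linarith

theorem isWeight_expWeight (hδ : 0 < δ) (ha : 0 ≤ a) (hac : a ≤ c) :
    IsWeight (expWeight c δ a) (fun x => (a - c * expWeight c δ c x) * expWeight c δ a x) := by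
  have hpos : ∀ x, 0 < Real.exp (c * x) + δ := fun x => by positivity
  have hb : ∀ x, |expWeight c δ a x| ≤ 1 / δ + 1 := by
    intro x
    rw [abs_of_nonneg (expWeight_nonneg hδ x)]
    unfold expWeight
    have h1 : Real.exp (a * x) ≤ 1 + Real.exp (c * x) := by
      rcases le_total x 0 with hx | hx
      · have : Real.exp (a * x) ≤ 1 := Real.exp_le_one_iff.2 (mul_nonpos_of_nonneg_of_nonpos ha hx)
        have := Real.exp_pos (c * x)
        linarith
      · have : Real.exp (a * x) ≤ Real.exp (c * x) := Real.exp_le_exp.2 (by gcongr)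
        linarith
    rw [div_le_iff₀ (hpos x)]
    have h2 : (1 / δ + 1) * (Real.exp (c * x) + δ)
        = 1 + Real.exp (c * x) + Real.exp (c * x) / δ + δ := by
      field_simp
      ring
    have h3 : 0 ≤ Real.exp (c * x) / δ := by positivity
    linarith
  refine ⟨?_, fun x => ?_, ⟨_, hb⟩, (|a| + |c|) * (1 / δ + 1), fun x => ?_⟩
  · exact ContDiff.div (by fun_prop) (by fun_prop) fun x => (hpos x).ne'
  · have e : ∀ t : ℝ, HasDerivAt (fun x => Real.exp (t * x)) (Real.exp (t * x) * t) x := fun t => by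
      simpa using ((hasDerivAt_id x).const_mul t).exp
    refine ((e a).div ((e c).add_const δ) (hpos x).ne').congr_deriv ?_
    unfold expWeight
    have := (hpos x).ne'
    field_simp
  · rw [abs_mul]
    refine mul_le_mul ?_ (hb x) (abs_nonneg _) (by positivity)
    refine (abs_sub _ _).trans ?_
    rw [abs_mul, abs_of_nonneg (expWeight_nonneg hδ x)]
    gcongr
    exact mul_le_of_le_one_right (abs_nonneg _) (expWeight_self_le_one hδ x)

theorem expWeight_add (s x : ℝ) :
    expWeight c δ (a + s) x = Real.exp (s * x) * expWeight c δ a x := by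
  unfold expWeight
  rw [add_mul, Real.exp_add]
  ring

theorem tendsto_expWeight_self (c x : ℝ) :
    Tendsto (fun n : ℕ => expWeight c (1 / (n + 1 : ℝ)) c x) atTop (𝓝 1) := by
  have t := tendsto_one_div_add_atTop_nhds_zero_nat (𝕜 := ℝ)
  have h := (tendsto_const_nhds (x := Real.exp (c * x))).div (t.const_add (Real.exp (c * x)))
    (by simp)
  rw [add_zero, div_self (Real.exp_pos _).ne'] at h
  exact h

end ExpWeight

/-! ### The spatial operator at a fixed time -/

/-- The functions `w = e^{bx} u`, `p = e^{bx} uₓ`, `q = e^{bx} uₓₓ`, `r = e^{bx} uₓₓₓ`,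
`s = e^{bx} uₓᵧ`, `k = e^{bx} uₓᵧᵧ` and `wy = e^{bx} uᵧ` of a function `u` on the strip with
`e^{bx} u ∈ H¹₀`, described by the weak differential relations between them. -/
structure WeightedProfile (b B : ℝ) (w p q r s k wy : ℝ × ℝ → ℝ) : Prop where
  w_x : IsWeakDeriv (strip B) eX w (fun z => p z + b * w z)
  w_y : IsWeakDeriv (strip B) eY w wy
  p_x : IsWeakDeriv (strip B) eX p (fun z => q z + b * p z)
  p_y : IsWeakDeriv (strip B) eY p s
  q_x : IsWeakDeriv (strip B) eX q (fun z => r z + b * q z)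
  s_y : IsWeakDeriv (strip B) eY s k
  mem_p : MemLp p 2 (stripMeasure B)
  mem_q : MemLp q 2 (stripMeasure B)
  mem_r : MemLp r 2 (stripMeasure B)
  mem_s : MemLp s 2 (stripMeasure B)
  mem_k : MemLp k 2 (stripMeasure B)
  lim : IsTestLimit (strip B) w (fun z => p z + b * w z) wy

namespace WeightedProfile

variable {b B : ℝ} {w p q r s k wy w' p' q' r' s' k' wy' : ℝ × ℝ → ℝ}

theorem mem_w (h : WeightedProfile b B w p q r s k wy) : MemLp w 2 (stripMeasure B) := h.lim.mem

theorem mem_wy (h : WeightedProfile b B w p q r s k wy) : MemLp wy 2 (stripMeasure B) := h.lim.mem_y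

theorem sub (h : WeightedProfile b B w p q r s k wy)
    (h' : WeightedProfile b B w' p' q' r' s' k' wy') :
    WeightedProfile b B (fun z => w z - w' z) (fun z => p z - p' z) (fun z => q z - q' z)
      (fun z => r z - r' z) (fun z => s z - s' z) (fun z => k z - k' z) (fun z => wy z - wy' z) := by
  have e : ∀ f g f' g' : ℝ × ℝ → ℝ, (fun z => (f z + b * g z) - (f' z + b * g' z))
      = fun z => (f z - f' z) + b * (g z - g' z) := fun f g f' g' => by
    funext z; ring
  refine ⟨?_, h.w_y.sub h'.w_y, ?_, h.p_y.sub h'.p_y, ?_, h.s_y.sub h'.s_y, h.mem_p.sub h'.mem_p,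
    h.mem_q.sub h'.mem_q, h.mem_r.sub h'.mem_r, h.mem_s.sub h'.mem_s, h.mem_k.sub h'.mem_k, ?_⟩
  · rw [← e]; exact h.w_x.sub h'.w_x
  · rw [← e]; exact h.p_x.sub h'.p_x
  · rw [← e]; exact h.q_x.sub h'.q_x
  · rw [← e]; exact h.lim.sub h'.lim

theorem wy_x (h : WeightedProfile b B w p q r s k wy) :
    IsWeakDeriv (strip B) eX wy (fun z => s z + b * wy z) := by
  refine h.w_x.comm h.w_y (h.p_y.add ?_)
  have := h.w_y.smooth_mul (isOpen_strip B) (a := fun _ => b) contDiff_const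
  simpa using this

theorem integrable_weight {m m' : ℝ → ℝ} (hm : IsWeight m m') {f g : ℝ × ℝ → ℝ}
    (hf : MemLp f 2 (stripMeasure B)) (hg : MemLp g 2 (stripMeasure B)) :
    Integrable (fun z => m z.1 * (f z * g z)) (stripMeasure B) :=
  ((hm.memLp_mul hf).integrable_mul hg).congr (.of_forall fun _ => mul_assoc _ _ _)

/-- The quadratic identity behind all energy estimates. With `ρ = e^{2bx} m` and
`mᵢ = e^{-2bx} ρ⁽ⁱ⁾` it says that `∫ ρ u (-uₓₓ + uₓₓₓ + uₓᵧᵧ)` equals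
`∫ (ρ + 3/2 ρ') uₓ² - 1/2 (ρ'' + ρ''') u² + 1/2 ρ' uᵧ²`. -/
theorem integral_linear (hB : 0 < B) (h : WeightedProfile b B w p q r s k wy)
    {m m₁ m₂ m₃ : ℝ → ℝ} (hm : IsWeight m (fun x => m₁ x - 2 * b * m x))
    (hm₁ : IsWeight m₁ (fun x => m₂ x - 2 * b * m₁ x))
    (hm₂ : IsWeight m₂ (fun x => m₃ x - 2 * b * m₂ x)) :
    ∫ z in strip B, m z.1 * (w z * (-q z + r z + k z))
      = (∫ z in strip B, m z.1 * p z ^ 2) + 3 / 2 * (∫ z in strip B, m₁ z.1 * p z ^ 2)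
        - 1 / 2 * (∫ z in strip B, m₂ z.1 * w z ^ 2)
        - 1 / 2 * (∫ z in strip B, m₃ z.1 * w z ^ 2)
        + 1 / 2 * ∫ z in strip B, m₁ z.1 * wy z ^ 2 := by
  have ibp : ∀ {n n₁ : ℝ → ℝ}, IsWeight n (fun x => n₁ x - 2 * b * n x) →
      ∀ {f f₁ g g₁ : ℝ × ℝ → ℝ}, IsWeakDeriv (strip B) eX f (fun p => f₁ p + b * f p) →
      IsWeakDeriv (strip B) eX g (fun p => g₁ p + b * g p) →
      MemLp f 2 (stripMeasure B) → MemLp f₁ 2 (stripMeasure B) →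
      MemLp g 2 (stripMeasure B) → MemLp g₁ 2 (stripMeasure B) →
      (∫ z in strip B, n z.1 * (f₁ z * g z)) + (∫ z in strip B, n z.1 * (f z * g₁ z))
      + ∫ z in strip B, n₁ z.1 * (f z * g z) = 0 := by
    intro n n₁ hn f f₁ g g₁ hf hg mf mf₁ mg mg₁
    simpa using hn.integral_by_parts hB hf hg mf mf₁ mg mg₁
  have a1 := ibp hm h.p_x h.w_x h.mem_p h.mem_q h.mem_w h.mem_p
  have a2 := ibp hm₁ h.w_x h.w_x h.mem_w h.mem_p h.mem_w h.mem_p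
  have a3 := ibp hm h.q_x h.w_x h.mem_q h.mem_r h.mem_w h.mem_p
  have a4 := ibp hm h.p_x h.p_x h.mem_p h.mem_q h.mem_p h.mem_q
  have a5 := ibp hm₁ h.p_x h.w_x h.mem_p h.mem_q h.mem_w h.mem_p
  have a6 := ibp hm₂ h.w_x h.w_x h.mem_w h.mem_p h.mem_w h.mem_p
  have a7 := ibp hm h.wy_x h.wy_x h.mem_wy h.mem_s h.mem_wy h.mem_s
  have a8 := (h.lim.weight_mul hm).integral_y h.s_y h.mem_s h.mem_k
  have e8 : ∫ z in strip B, k z * (m z.1 * w z) = ∫ z in strip B, m z.1 * (w z * k z) :=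
    integral_congr_ae (.of_forall fun z => by ring)
  have e8' : ∫ z in strip B, s z * (m z.1 * wy z) = ∫ z in strip B, m z.1 * (s z * wy z) :=
    integral_congr_ae (.of_forall fun z => by ring)
  rw [e8, e8'] at a8
  have comm : ∀ (n : ℝ → ℝ) (f g : ℝ × ℝ → ℝ),
      ∫ z in strip B, n z.1 * (f z * g z) = ∫ z in strip B, n z.1 * (g z * f z) := fun n f g =>
    integral_congr_ae (.of_forall fun z => by ring)
  have i1 := integrable_weight hm h.mem_w h.mem_q
  have i2 := integrable_weight hm h.mem_w h.mem_r
  have i3 := integrable_weight hm h.mem_w h.mem_k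
  have split : ∫ z in strip B, m z.1 * (w z * (-q z + r z + k z))
      = -(∫ z in strip B, m z.1 * (w z * q z)) + (∫ z in strip B, m z.1 * (w z * r z))
        + ∫ z in strip B, m z.1 * (w z * k z) := by
    have i1' : Integrable (fun z => -(m z.1 * (w z * q z))) (stripMeasure B) := i1.neg
    rw [← integral_neg, ← integral_add i1' i2, ← integral_add (by exact i1'.add i2) i3]
    exact integral_congr_ae (.of_forall fun z => by ring)
  simp only [sq]
  rw [split, a8]
  rw [comm m q w] at a1
  rw [comm m₁ p w] at a2 a1
  rw [comm m r w] at a3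
  rw [comm m q p] at a4 a3
  rw [comm m₁ q w] at a5 a3
  rw [comm m₂ p w] at a6 a5
  rw [comm m wy s] at a7
  linarith

end WeightedProfile

/-! ### The localized energy inequality at a fixed time -/

/-- The data of a solution at a fixed time: a weighted profile of `u ∈ L²` with `uₓ ∈ L²`, for which
the equation `e^{bx} (u_t - uₓₓ + uₓₓₓ + u uₓ + uₓᵧᵧ) = 0` holds almost everywhere, where
`wt = e^{bx} u_t`. -/
structure SolutionSlice (b B : ℝ) (u ux w p q r s k wy wt : ℝ × ℝ → ℝ) : Prop extends
    WeightedProfile b B w p q r s k wy where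
  w_eq : ∀ z, w z = Real.exp (b * z.1) * u z
  p_eq : ∀ z, p z = Real.exp (b * z.1) * ux z
  mem_u : MemLp u 2 (stripMeasure B)
  mem_ux : MemLp ux 2 (stripMeasure B)
  mem_wt : MemLp wt 2 (stripMeasure B)
  equation : ∀ᵐ z ∂stripMeasure B, wt z - q z + r z + u z * p z + k z = 0

namespace SolutionSlice

variable {b B : ℝ} {u ux w p q r s k wy wt u' ux' w' p' q' r' s' k' wy' wt' : ℝ × ℝ → ℝ}

/-- By the equation the nonlinear term `e^{bx} u uₓ` is square integrable. -/
theorem mem_nonlinear (h : SolutionSlice b B u ux w p q r s k wy wt) :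
    MemLp (fun z => u z * p z) 2 (stripMeasure B) := by
  refine (((h.mem_q.sub h.mem_wt).sub h.mem_r).sub h.mem_k).ae_eq ?_
  filter_upwards [h.equation] with z hz
  simp only [Pi.sub_apply]
  linarith

theorem memLp_four (h : SolutionSlice b B u ux w p q r s k wy wt) : MemLp w 4 (stripMeasure B) :=
  h.lim.memLp_four (measurableSet_strip B)

theorem integrable_sq_weight {m m' : ℝ → ℝ} (hm : IsWeight m m') {f : ℝ × ℝ → ℝ}
    (hf : MemLp f 2 (stripMeasure B)) : Integrable (fun z => m z.1 * f z ^ 2) (stripMeasure B) :=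
  (WeightedProfile.integrable_weight hm hf hf).congr (.of_forall fun z => by ring)

end SolutionSlice

theorem integral_bdd_mul_le {α : Type*} [MeasurableSpace α] {μ : Measure α} {f g : α → ℝ} {C : ℝ}
    (hf : Integrable f μ) (hg : Integrable g μ) (h : ∀ x, f x ≤ C * g x) :
    ∫ x, f x ∂μ ≤ C * ∫ x, g x ∂μ := by
  rw [← integral_const_mul]
  exact integral_mono hf (hg.const_mul C) h

/-- The `L²` energy inequality at a fixed time, localized by the weight
`ρ = e^{4bx} / (e^{4bx} + δ)`. In terms of `w = e^{bx} u` and `p = e^{bx} uₓ` one has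
`ρ uₓ² = m p²` and `ρ' u² = 4 b δ μ² w²`, with `m = e^{2bx} / (e^{4bx} + δ)` and
`μ = e^{bx} / (e^{4bx} + δ)`. The cubic term is absorbed by the dissipation `ρ' (3 uₓ² + uᵧ²) / 2`
that comes from the third order terms. -/
theorem exists_energy_slice {b : ℝ} (hb : 0 < b) : ∃ C : ℝ, 0 ≤ C ∧
    ∀ B : ℝ, 0 < B → ∀ u ux w p q r s k wy wt : ℝ × ℝ → ℝ,
    SolutionSlice b B u ux w p q r s k wy wt → ∀ δ : ℝ, 0 < δ →
    (∫ z in strip B, expWeight (4 * b) δ (2 * b) z.1 * (w z * wt z))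
      + (∫ z in strip B, expWeight (4 * b) δ (2 * b) z.1 * p z ^ 2)
      ≤ C * (1 + ∫ z in strip B, u z ^ 2)
        * ∫ z in strip B, 4 * b * δ * expWeight (4 * b) δ b z.1 ^ 2 * w z ^ 2 := by
  obtain ⟨C, hC0, hC⟩ := exists_integral_mul_sq_le
  refine ⟨(2 * b + 8 * b ^ 2) + 4 * b ^ 2 + C, by positivity,
    fun B hB u ux w p q r s k wy wt h δ hδ => ?_⟩
  set S : ℝ → ℝ := expWeight (4 * b) δ (4 * b) with hS
  set m : ℝ → ℝ := expWeight (4 * b) δ (2 * b) with hm_def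
  set μ : ℝ → ℝ := expWeight (4 * b) δ b with hμ_def
  set c : ℝ := 2 * Real.sqrt (b * δ) with hc_def
  have hc : c ^ 2 = 4 * b * δ := by
    rw [hc_def, mul_pow, Real.sq_sqrt (by positivity)]; ring
  have S0 : ∀ x, 0 ≤ S x := expWeight_nonneg hδ
  have S1 : ∀ x, S x ≤ 1 := expWeight_self_le_one hδ
  have hSw : IsWeight S (fun x => (4 * b - 4 * b * S x) * S x) :=
    isWeight_expWeight hδ (by positivity) le_rfl
  have hmw : IsWeight m (fun x => (2 * b - 4 * b * S x) * m x) :=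
    isWeight_expWeight hδ (by positivity) (by linarith)
  have hμw : IsWeight μ (fun x => (b - 4 * b * S x) * μ x) :=
    isWeight_expWeight hδ hb.le (by linarith)
  have hμm : ∀ x, m x = Real.exp (b * x) * μ x := fun x => by
    rw [hm_def, hμ_def, ← expWeight_add, two_mul]
  -- `δ = (1 - S)(e^{4bx} + δ)` identifies `ρ'` in terms of `μ`.
  have hμS : ∀ x, δ * μ x ^ 2 = (1 - S x) * m x := fun x => by
    have hpos : Real.exp (4 * b * x) + δ ≠ 0 := by positivity
    have e : Real.exp (2 * b * x) = Real.exp (b * x) ^ 2 := by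
      rw [← Real.exp_nat_mul]; congr 1; push_cast; ring
    simp only [hS, hm_def, hμ_def, expWeight, e]
    field_simp
    ring
  -- `mᵢ = e^{-2bx} ρ⁽ⁱ⁾`, and `κ = √m₁`, so that `κ w = √ρ' u` enters the Ladyzhenskaya inequality
  set κ : ℝ → ℝ := fun x => c * μ x with hκ_def
  have hκw : IsWeight κ (fun x => (b - 4 * b * S x) * κ x) :=
    ((IsWeight.const c).mul hμw).congr rfl (by funext x; simp only [hκ_def]; ring)
  set m₁ : ℝ → ℝ := fun x => κ x * κ x with hm₁_def
  have m₁_eq : ∀ x, m₁ x = 4 * b * δ * μ x ^ 2 := fun x => by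
    simp only [hm₁_def, hκ_def]; rw [← hc]; ring
  have m₁0 : ∀ x, 0 ≤ m₁ x := fun x => mul_self_nonneg _
  set m₂ : ℝ → ℝ := fun x => 4 * b * (1 - 2 * S x) * m₁ x with hm₂_def
  set m₃ : ℝ → ℝ := fun x => 16 * b ^ 2 * ((1 - 2 * S x) ^ 2 - 2 * S x * (1 - S x)) * m₁ x
    with hm₃_def
  have w0 : IsWeight m (fun x => m₁ x - 2 * b * m x) := hmw.congr rfl (by
    funext x
    have := hμS x
    rw [m₁_eq]
    linear_combination (-4 * b) * this)
  have w1' : IsWeight m₁ (fun x => 2 * (b - 4 * b * S x) * m₁ x) :=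
    (hκw.mul hκw).congr rfl (by funext x; simp only [hm₁_def]; ring)
  have w1 : IsWeight m₁ (fun x => m₂ x - 2 * b * m₁ x) :=
    w1'.congr rfl (by funext x; simp only [hm₂_def]; ring)
  have w2' := (((IsWeight.const (4 * b)).add ((IsWeight.const (-8 * b)).mul hSw)).mul w1')
  have w2 : IsWeight m₂ (fun x => m₃ x - 2 * b * m₂ x) :=
    w2'.congr (by funext x; simp only [hm₂_def]; ring)
      (by funext x; simp only [hm₃_def, hm₂_def]; ring)
  have w3 : IsWeight m₃ _ := (((IsWeight.const (16 * b ^ 2)).add (((IsWeight.const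
    (-96 * b ^ 2)).mul hSw).add ((IsWeight.const (96 * b ^ 2)).mul (hSw.mul hSw)))).mul w1').congr
      (by funext x; simp only [hm₃_def]; ring) rfl
  have lin := h.integral_linear hB w0 w1 w2
  have I := fun {n n' : ℝ → ℝ} (hn : IsWeight n n') {f : ℝ × ℝ → ℝ}
    (hf : MemLp f 2 (stripMeasure B)) => SolutionSlice.integrable_sq_weight hn hf
  -- the lower order terms
  have b2 : ∫ z in strip B, m₂ z.1 * w z ^ 2 ≤ 4 * b * ∫ z in strip B, m₁ z.1 * w z ^ 2 := by
    refine integral_bdd_mul_le (I w2 h.mem_w) (I w1 h.mem_w) fun z => ?_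
    have h0 : 0 ≤ 4 * b * m₁ z.1 * w z ^ 2 := by have := m₁0 z.1; positivity
    have : m₂ z.1 * w z ^ 2 = (1 - 2 * S z.1) * (4 * b * m₁ z.1 * w z ^ 2) := by
      simp only [hm₂_def]; ring
    nlinarith [S0 z.1]
  have b3 : ∫ z in strip B, m₃ z.1 * w z ^ 2 ≤ 16 * b ^ 2 * ∫ z in strip B, m₁ z.1 * w z ^ 2 := by
    refine integral_bdd_mul_le (I w3 h.mem_w) (I w1 h.mem_w) fun z => ?_
    have h0 : 0 ≤ 16 * b ^ 2 * m₁ z.1 * w z ^ 2 := by have := m₁0 z.1; positivity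
    have e : m₃ z.1 * w z ^ 2 = ((1 - 2 * S z.1) ^ 2 - 2 * S z.1 * (1 - S z.1))
        * (16 * b ^ 2 * m₁ z.1 * w z ^ 2) := by
      simp only [hm₃_def]; ring
    have h1 : (1 - 2 * S z.1) ^ 2 - 2 * S z.1 * (1 - S z.1) ≤ 1 := by
      nlinarith [S0 z.1, S1 z.1, mul_nonneg (S0 z.1) (sub_nonneg.2 (S1 z.1))]
    rw [e]
    nlinarith
  -- the cubic term: `-∫ ρ u² uₓ = 1/3 ∫ ρ' u³`
  have h4 := h.memLp_four
  have tri := hμw.integral_by_parts_three (measurableSet_strip B) h.w_x h.mem_w h4 h.lim.mem_x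
    h.lim h.lim
  have iw3 : Integrable (fun z => |u z| * (m₁ z.1 * w z ^ 2)) (stripMeasure B) := by
    have := h.mem_u.abs.integrable_mul (w1.memLp_mul (h4.mul_four h4))
    exact this.congr (.of_forall fun z => by simp only [Pi.mul_apply, Pi.abs_apply]; ring)
  have iμp : Integrable (fun z => μ z.1 * p z * w z ^ 2) (stripMeasure B) := by
    have := (hμw.memLp_mul h.mem_p).integrable_mul (h4.mul_four h4)
    exact this.congr (.of_forall fun z => by simp only [Pi.mul_apply]; ring)
  have iμw : ∀ n n' : ℝ → ℝ, IsWeight n n' →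
      Integrable (fun z => n z.1 * w z ^ 3) (stripMeasure B) := fun n n' hn => by
    have := (hn.memLp_mul h.mem_w).integrable_mul (h4.mul_four h4)
    exact this.congr (.of_forall fun z => by simp only [Pi.mul_apply]; ring)
  have cubic : -(∫ z in strip B, μ z.1 * p z * w z ^ 2)
      ≤ 1 / 3 * ∫ z in strip B, |u z| * (m₁ z.1 * w z ^ 2) := by
    have hW : IsWeight (fun x => (4 * b) * μ x + (-(4 * b)) * (S x * μ x)) _ :=
      ((IsWeight.const (4 * b)).mul hμw).add ((IsWeight.const (-(4 * b))).mul (hSw.mul hμw))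
    have iW := iμw _ _ hW
    have iμμ := iμw _ _ hμw
    have iSμ := iμw _ _ (hSw.mul hμw)
    have t1 : ∀ {f : ℝ × ℝ → ℝ}, (∀ z, f z = μ z.1 * p z * w z ^ 2 + b * (μ z.1 * w z ^ 3)) →
        ∫ z in strip B, f z = (∫ z in strip B, μ z.1 * p z * w z ^ 2)
          + b * ∫ z in strip B, μ z.1 * w z ^ 3 := fun hf => by
      rw [← integral_const_mul, ← integral_add iμp (iμμ.const_mul b)]
      exact integral_congr_ae (.of_forall hf)
    have t2 : ∫ z in strip B, (b - 4 * b * S z.1) * μ z.1 * w z * (w z * w z)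
        = (∫ z in strip B, (4 * b * μ z.1 + -(4 * b) * (S z.1 * μ z.1)) * w z ^ 3)
          - 3 * b * ∫ z in strip B, μ z.1 * w z ^ 3 := by
      rw [← integral_const_mul, ← integral_sub iW (iμμ.const_mul _)]
      exact integral_congr_ae (.of_forall fun z => by ring)
    have tA := t1 (f := fun z => μ z.1 * (p z + b * w z) * (w z * w z)) (fun z => by ring)
    have tB := t1 (f := fun z => μ z.1 * w z * w z * (p z + b * w z)) (fun z => by ring)
    rw [tA, tB, t2] at tri
    have t3 : ∫ z in strip B, (4 * b * μ z.1 + -(4 * b) * (S z.1 * μ z.1)) * w z ^ 3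
        ≤ ∫ z in strip B, |u z| * (m₁ z.1 * w z ^ 2) := by
      refine integral_mono iW iw3 fun z => ?_
      have e : (4 * b * μ z.1 + -(4 * b) * (S z.1 * μ z.1)) * w z ^ 3
          = u z * (m₁ z.1 * w z ^ 2) := by
        rw [m₁_eq]
        have := hμS z.1
        rw [hμm] at this
        have hw := h.w_eq z
        calc _ = 4 * b * ((1 - S z.1) * μ z.1) * w z * w z ^ 2 := by ring
          _ = u z * (4 * b * ((1 - S z.1) * (Real.exp (b * z.1) * μ z.1))) * w z ^ 2 := by
            rw [hw]; ring
          _ = _ := by rw [← this]; ring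
      simp only [e]
      exact mul_le_mul_of_nonneg_right (le_abs_self _) (mul_nonneg (m₁0 _) (sq_nonneg _))
    linarith
  -- With `ε = 3/2` the gradient terms `1/3 · ε ∫ ρ' (2 uₓ² + uᵧ²)` do not exceed the dissipation
  -- `1/2 ∫ ρ' (3 uₓ² + uᵧ²)`.
  have limκ := h.lim.weight_mul hκw
  have lady := hC (strip B) (measurableSet_strip B) u _ _ _ h.mem_u limκ (3 / 2) (by norm_num)
  have eκ : ∀ f : ℝ × ℝ → ℝ, ∫ z in strip B, (κ z.1 * f z) ^ 2 = ∫ z in strip B, m₁ z.1 * f z ^ 2 :=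
    fun f => integral_congr_ae (.of_forall fun z => by simp only [hm₁_def]; ring)
  have eκu : ∫ z in strip B, |u z| * (κ z.1 * w z) ^ 2
      = ∫ z in strip B, |u z| * (m₁ z.1 * w z ^ 2) :=
    integral_congr_ae (.of_forall fun z => by simp only [hm₁_def]; ring)
  rw [eκ w, eκ wy, eκu] at lady
  have grad : ∫ z in strip B, (κ z.1 * (p z + b * w z) + (b - 4 * b * S z.1) * κ z.1 * w z) ^ 2
      ≤ 2 * (∫ z in strip B, m₁ z.1 * p z ^ 2) + 8 * b ^ 2 * ∫ z in strip B, m₁ z.1 * w z ^ 2 := by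
    rw [← integral_const_mul, ← integral_const_mul, ← integral_add ((I w1 h.mem_p).const_mul 2)
      ((I w1 h.mem_w).const_mul _)]
    refine integral_mono limκ.mem_x.integrable_sq
      (((I w1 h.mem_p).const_mul 2).add ((I w1 h.mem_w).const_mul _)) fun z => ?_
    simp only [hm₁_def]
    have e : κ z.1 * (p z + b * w z) + (b - 4 * b * S z.1) * κ z.1 * w z
        = κ z.1 * p z + (2 * b * (1 - 2 * S z.1)) * (κ z.1 * w z) := by ring
    rw [e]
    have h1 : (1 - 2 * S z.1) ^ 2 ≤ 1 := by nlinarith [S0 z.1, S1 z.1]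
    have h2 : 0 ≤ b ^ 2 * (κ z.1 * w z) ^ 2 := by positivity
    nlinarith [sq_nonneg (κ z.1 * p z - (2 * b * (1 - 2 * S z.1)) * (κ z.1 * w z))]
  -- combination by means of the equation
  have hwt : ∫ z in strip B, m z.1 * (w z * wt z)
      = -(∫ z in strip B, m z.1 * (w z * (-q z + r z + k z)))
        - ∫ z in strip B, μ z.1 * p z * w z ^ 2 := by
    have i1 := WeightedProfile.integrable_weight w0 h.mem_w ((h.mem_q.neg.add h.mem_r).add h.mem_k)
    have i1' : Integrable (fun z => -(m z.1 * (w z * (-q z + r z + k z)))) (stripMeasure B) := i1.neg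
    rw [← integral_neg, ← integral_sub i1' iμp]
    refine integral_congr_ae ?_
    filter_upwards [h.equation] with z hz
    have e : wt z = -(-q z + r z + k z) - u z * p z := by linarith
    have e2 : m z.1 * (w z * (u z * p z)) = μ z.1 * p z * w z ^ 2 := by
      rw [hμm, h.w_eq]; ring
    rw [e, ← e2]
    ring
  have goal_eq : ∫ z in strip B, 4 * b * δ * μ z.1 ^ 2 * w z ^ 2
      = ∫ z in strip B, m₁ z.1 * w z ^ 2 :=
    integral_congr_ae (.of_forall fun z => by simp only [m₁_eq])
  rw [hwt, lin, goal_eq]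
  have n1 : 0 ≤ ∫ z in strip B, m₁ z.1 * w z ^ 2 :=
    integral_nonneg fun z => mul_nonneg (m₁0 _) (sq_nonneg _)
  have n2 : 0 ≤ ∫ z in strip B, m₁ z.1 * p z ^ 2 :=
    integral_nonneg fun z => mul_nonneg (m₁0 _) (sq_nonneg _)
  have n3 : 0 ≤ ∫ z in strip B, u z ^ 2 := integral_nonneg fun z => sq_nonneg _
  set A := ∫ z in strip B, m₁ z.1 * w z ^ 2
  set P := ∫ z in strip B, m₁ z.1 * p z ^ 2
  set Y := ∫ z in strip B, m₁ z.1 * wy z ^ 2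
  set U := ∫ z in strip B, u z ^ 2
  have n4 : 0 ≤ C * U * A := by positivity
  have n5 : 0 ≤ (2 * b + 8 * b ^ 2 + 4 * b ^ 2) * U * A := by positivity
  have n6 : 0 ≤ C * A := by positivity
  have lady' : 1 / 3 * ∫ z in strip B, |u z| * (m₁ z.1 * w z ^ 2)
      ≤ P + 4 * b ^ 2 * A + 1 / 2 * Y + C * U * A := by
    have e : C / (3 / 2) * U * A = 2 / 3 * (C * U * A) := by ring
    rw [e] at lady
    linarith
  nlinarith

/-! ### The difference of two solutions at a fixed time -/

section DifferenceSlice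

variable {b B : ℝ} {u ux w p q r s k wy wt u' ux' w' p' q' r' s' k' wy' wt' : ℝ × ℝ → ℝ}

/-- The nonlinear contribution to the energy balance of the difference of two solutions. After
inserting the cutoff `χ = e^{bx} / (e^{bx} + δ)`, which makes the trilinear integration by parts
legitimate although the solutions carry no weight at `x = -∞`, the bound is uniform in `δ`. -/
theorem SolutionSlice.neg_integral_nonlinear_sub_le (hb : 0 < b)
    (h : SolutionSlice b B u ux w p q r s k wy wt)
    (h' : SolutionSlice b B u' ux' w' p' q' r' s' k' wy' wt') :
    -(∫ z in strip B, (w z - w' z) * (u z * p z - u' z * p' z))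
      ≤ ∫ z in strip B, abs (|ux z| + |ux' z| + 2 * b * |u' z|) * (w z - w' z) ^ 2 := by
  have hd := h.toWeightedProfile.sub h'.toWeightedProfile
  set W : ℝ × ℝ → ℝ := fun z => w z - w' z with hW
  set P : ℝ × ℝ → ℝ := fun z => p z - p' z with hP
  set κ : ℝ × ℝ → ℝ := fun z => |ux z| + |ux' z| + 2 * b * |u' z| with hκ
  have mκ : MemLp κ 2 (stripMeasure B) :=
    (h.mem_ux.abs.add h'.mem_ux.abs).add (h'.mem_u.abs.const_mul (2 * b))
  have hW4 : MemLp W 4 (stripMeasure B) := hd.lim.memLp_four (measurableSet_strip B)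
  have hWW := hW4.mul_four hW4
  have iκ : Integrable (fun z => |κ z| * W z ^ 2) (stripMeasure B) :=
    (mκ.abs.integrable_mul hWW).congr (.of_forall fun z => by
      simp only [Pi.mul_apply, Pi.abs_apply]; ring)
  have iWG : Integrable (fun z => W z * (u z * p z - u' z * p' z)) (stripMeasure B) :=
    hd.mem_w.integrable_mul (h.mem_nonlinear.sub h'.mem_nonlinear)
  have key : ∀ δ : ℝ, 0 < δ →
      -(∫ z in strip B, expWeight b δ b z.1 * (W z * (u z * p z - u' z * p' z)))
        ≤ ∫ z in strip B, |κ z| * W z ^ 2 := by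
    intro δ hδ
    set χ : ℝ → ℝ := expWeight b δ b with hχ
    set μ : ℝ → ℝ := expWeight b δ 0 with hμ
    have χ0 : ∀ x, 0 ≤ χ x := expWeight_nonneg hδ
    have χ1 : ∀ x, χ x ≤ 1 := expWeight_self_le_one hδ
    have hχw : IsWeight χ (fun x => (b - b * χ x) * χ x) := isWeight_expWeight hδ hb.le le_rfl
    have hμw : IsWeight μ (fun x => (0 - b * χ x) * μ x) := isWeight_expWeight hδ le_rfl hb.le
    have hχμ : ∀ x, χ x = Real.exp (b * x) * μ x := fun x => by
      rw [hχ, hμ, ← expWeight_add, zero_add]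
    -- `∫ ρ u' z zₓ = -1/2 ∫ (ρ u')ₓ z²` for `ρ = e^{2bx} χ`
    have tri := hμw.integral_by_parts_three (measurableSet_strip B) h'.w_x h'.mem_w h'.memLp_four
      h'.lim.mem_x hd.lim hd.lim
    have iA : Integrable (fun z => χ z.1 * ux' z * W z ^ 2) (stripMeasure B) :=
      ((hχw.memLp_mul h'.mem_ux).integrable_mul hWW).congr (.of_forall fun z => by
        simp only [Pi.mul_apply]; ring)
    have iA' : Integrable (fun z => χ z.1 * ux z * W z ^ 2) (stripMeasure B) :=
      ((hχw.memLp_mul h.mem_ux).integrable_mul hWW).congr (.of_forall fun z => by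
        simp only [Pi.mul_apply]; ring)
    have iB : Integrable (fun z => χ z.1 * u' z * W z ^ 2) (stripMeasure B) :=
      ((hχw.memLp_mul h'.mem_u).integrable_mul hWW).congr (.of_forall fun z => by
        simp only [Pi.mul_apply]; ring)
    have iD : Integrable (fun z => χ z.1 * (χ z.1 * u' z) * W z ^ 2) (stripMeasure B) :=
      ((hχw.memLp_mul (hχw.memLp_mul h'.mem_u)).integrable_mul hWW).congr (.of_forall fun z => by
        simp only [Pi.mul_apply]; ring)
    have iE : Integrable (fun z => μ z.1 * w' z * W z * P z) (stripMeasure B) :=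
      (((hμw.memLp_mul h'.memLp_four).mul_four hW4).integrable_mul hd.mem_p)
    have t1 : ∫ z in strip B, μ z.1 * (p' z + b * w' z) * (W z * W z)
        = (∫ z in strip B, χ z.1 * ux' z * W z ^ 2) + b * ∫ z in strip B, χ z.1 * u' z * W z ^ 2 := by
      rw [← integral_const_mul, ← integral_add iA (iB.const_mul b)]
      refine integral_congr_ae (.of_forall fun z => ?_)
      simp only [hχμ, h'.p_eq z, h'.w_eq z]
      ring
    have t2 : ∫ z in strip B, μ z.1 * w' z * W z * (P z + b * W z)
        = (∫ z in strip B, μ z.1 * w' z * W z * P z) + b * ∫ z in strip B, χ z.1 * u' z * W z ^ 2 := by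
      rw [← integral_const_mul, ← integral_add iE (iB.const_mul b)]
      refine integral_congr_ae (.of_forall fun z => ?_)
      simp only [hχμ, h'.w_eq z]
      ring
    have t3 : ∫ z in strip B, (0 - b * χ z.1) * μ z.1 * w' z * (W z * W z)
        = -b * ∫ z in strip B, χ z.1 * (χ z.1 * u' z) * W z ^ 2 := by
      rw [← integral_const_mul]
      refine integral_congr_ae (.of_forall fun z => ?_)
      simp only [h'.w_eq z]
      rw [show χ z.1 * (χ z.1 * u' z) = χ z.1 * ((Real.exp (b * z.1) * μ z.1) * u' z) by
        rw [← hχμ]]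
      ring
    have t4 : ∫ z in strip B, χ z.1 * (W z * (u z * p z - u' z * p' z))
        = (∫ z in strip B, χ z.1 * ux z * W z ^ 2) + ∫ z in strip B, μ z.1 * w' z * W z * P z := by
      rw [← integral_add iA' iE]
      refine integral_congr_ae (.of_forall fun z => ?_)
      simp only [hχμ, hW, hP, h.w_eq z, h'.w_eq z, h.p_eq z, h'.p_eq z]
      ring
    change _ + (∫ z in strip B, μ z.1 * w' z * W z * (P z + b * W z))
      + (∫ z in strip B, μ z.1 * w' z * W z * (P z + b * W z)) + _ = _ at tri
    rw [t1, t2, t3] at tri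
    rw [t4]
    have j1 := (iA.const_mul (1 / 2)).add (iB.const_mul (3 / 2 * b))
    have j2 := j1.sub (iD.const_mul (b / 2))
    have iS := j2.sub iA'
    have e : -((∫ z in strip B, χ z.1 * ux z * W z ^ 2) + ∫ z in strip B, μ z.1 * w' z * W z * P z)
        = ∫ z in strip B, (1 / 2 * (χ z.1 * ux' z * W z ^ 2)
          + 3 / 2 * b * (χ z.1 * u' z * W z ^ 2)
          - b / 2 * (χ z.1 * (χ z.1 * u' z) * W z ^ 2) - χ z.1 * ux z * W z ^ 2) := by
      rw [integral_sub (by exact j2) iA', integral_sub (by exact j1) (iD.const_mul _),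
        integral_add (iA.const_mul _) (iB.const_mul _), integral_const_mul, integral_const_mul,
        integral_const_mul]
      linarith
    rw [e]
    refine integral_mono iS iκ fun z => ?_
    have hκ0 : 0 ≤ κ z := by simp only [hκ]; positivity
    simp only [abs_of_nonneg hκ0]
    have c0 := χ0 z.1
    have c1 := χ1 z.1
    have factor : 1 / 2 * (χ z.1 * ux' z * W z ^ 2) + 3 / 2 * b * (χ z.1 * u' z * W z ^ 2)
          - b / 2 * (χ z.1 * (χ z.1 * u' z) * W z ^ 2) - χ z.1 * ux z * W z ^ 2
        = (χ z.1 * (1 / 2 * ux' z - ux z + b * (3 / 2 - χ z.1 / 2) * u' z)) * W z ^ 2 := by ring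
    change _ + _ - _ - _ ≤ _
    rw [factor]
    refine mul_le_mul_of_nonneg_right ?_ (sq_nonneg _)
    have a1 : (3 / 2 - χ z.1 / 2) * u' z ≤ 3 / 2 * |u' z| := by
      have := abs_nonneg (u' z)
      have := le_abs_self (u' z)
      nlinarith
    have a2 : 1 / 2 * ux' z - ux z + b * (3 / 2 - χ z.1 / 2) * u' z ≤ κ z := by
      simp only [hκ]
      have := abs_nonneg (ux' z)
      have := le_abs_self (ux' z)
      have := neg_abs_le (ux z)
      have := abs_nonneg (u' z)
      nlinarith
    calc χ z.1 * (1 / 2 * ux' z - ux z + b * (3 / 2 - χ z.1 / 2) * u' z) ≤ χ z.1 * κ z := by gcongr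
      _ ≤ κ z := mul_le_of_le_one_left hκ0 c1
  have lim : Tendsto (fun n : ℕ => -(∫ z in strip B, expWeight b (1 / (n + 1 : ℝ)) b z.1
      * (W z * (u z * p z - u' z * p' z)))) atTop
      (𝓝 (-∫ z in strip B, W z * (u z * p z - u' z * p' z))) := by
    refine Tendsto.neg ?_
    refine tendsto_integral_of_dominated_convergence _ (fun n => ?_) iWG.norm (fun n => ?_) ?_
    · exact ((isWeight_expWeight (by positivity) hb.le le_rfl).continuous.comp
        continuous_fst).aestronglyMeasurable.mul iWG.1
    · refine .of_forall fun z => ?_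
      rw [norm_mul, Real.norm_eq_abs (expWeight _ _ _ _),
        abs_of_nonneg (expWeight_nonneg (by positivity) _)]
      exact mul_le_of_le_one_left (norm_nonneg _) (expWeight_self_le_one (by positivity) _)
    · refine .of_forall fun z => ?_
      simpa using (tendsto_expWeight_self b z.1).mul_const (W z * (u z * p z - u' z * p' z))
  exact le_of_tendsto' lim fun n => key _ (by positivity)

/-- The weighted energy inequality for the difference of two solutions at a fixed time. -/
theorem exists_difference_slice (hb : 0 < b) : ∃ C : ℝ, 0 ≤ C ∧
    ∀ B : ℝ, 0 < B → ∀ u ux w p q r s k wy wt u' ux' w' p' q' r' s' k' wy' wt' : ℝ × ℝ → ℝ,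
    SolutionSlice b B u ux w p q r s k wy wt →
    SolutionSlice b B u' ux' w' p' q' r' s' k' wy' wt' →
    ∫ z in strip B, (w z - w' z) * (wt z - wt' z)
      ≤ C * (1 + (∫ z in strip B, ux z ^ 2) + (∫ z in strip B, ux' z ^ 2)
        + ∫ z in strip B, u' z ^ 2) * ∫ z in strip B, (w z - w' z) ^ 2 := by
  obtain ⟨C, hC0, hC⟩ := exists_integral_mul_sq_le
  -- the dissipation is `∫ (1 + 3 b) P² + b Y²`, of which `ε ∫ 2 P² + Y²` is spent
  set ε : ℝ := min (1 / 2) b with hε_def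
  have hε : 0 < ε := by positivity
  have hε1 : ε ≤ 1 / 2 := min_le_left _ _
  have hε2 : ε ≤ b := min_le_right _ _
  refine ⟨(2 * b ^ 2 + 4 * b ^ 3 + b ^ 2) + C / ε * (3 + 12 * b ^ 2), by positivity, ?_⟩
  intro B hB u ux w p q r s k wy wt u' ux' w' p' q' r' s' k' wy' wt' h h'
  have hd := h.toWeightedProfile.sub h'.toWeightedProfile
  have nl := h.neg_integral_nonlinear_sub_le hb h'
  have lin := hd.integral_linear hB (m := fun _ => 1) (m₁ := fun _ => 2 * b)
    (m₂ := fun _ => 4 * b ^ 2) (m₃ := fun _ => 8 * b ^ 3)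
    ((IsWeight.const 1).congr rfl (by funext x; ring))
    ((IsWeight.const (2 * b)).congr rfl (by funext x; ring))
    ((IsWeight.const (4 * b ^ 2)).congr rfl (by funext x; ring))
  set W : ℝ × ℝ → ℝ := fun z => w z - w' z with hW
  set P : ℝ × ℝ → ℝ := fun z => p z - p' z with hP
  set Y : ℝ × ℝ → ℝ := fun z => wy z - wy' z with hY
  simp only [one_mul, integral_const_mul] at lin
  have mκ : MemLp (fun z => |ux z| + |ux' z| + 2 * b * |u' z|) 2 (stripMeasure B) :=
    (h.mem_ux.abs.add h'.mem_ux.abs).add (h'.mem_u.abs.const_mul (2 * b))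
  have lady := hC (strip B) (measurableSet_strip B) _ _ _ _ mκ hd.lim ε hε
  have grad : ∫ z in strip B, (P z + b * W z) ^ 2
      ≤ 2 * (∫ z in strip B, P z ^ 2) + 2 * b ^ 2 * ∫ z in strip B, W z ^ 2 := by
    have i1 := hd.mem_p.integrable_sq.const_mul 2
    have i2 := hd.mem_w.integrable_sq.const_mul (2 * b ^ 2)
    rw [← integral_const_mul, ← integral_const_mul, ← integral_add i1 i2]
    refine integral_mono hd.lim.mem_x.integrable_sq (i1.add i2) fun z => ?_
    change (P z + b * W z) ^ 2 ≤ 2 * P z ^ 2 + 2 * b ^ 2 * W z ^ 2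
    nlinarith [sq_nonneg (P z - b * W z)]
  have coef : ∫ z in strip B, (|ux z| + |ux' z| + 2 * b * |u' z|) ^ 2
      ≤ 3 * (∫ z in strip B, ux z ^ 2) + 3 * (∫ z in strip B, ux' z ^ 2)
        + 12 * b ^ 2 * ∫ z in strip B, u' z ^ 2 := by
    have i1 := h.mem_ux.integrable_sq.const_mul 3
    have i2 := h'.mem_ux.integrable_sq.const_mul 3
    have i3 := h'.mem_u.integrable_sq.const_mul (12 * b ^ 2)
    rw [← integral_const_mul, ← integral_const_mul, ← integral_const_mul, ← integral_add i1 i2,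
      ← integral_add (by exact i1.add i2) i3]
    refine integral_mono mκ.integrable_sq ((i1.add i2).add i3) fun z => ?_
    change (|ux z| + |ux' z| + 2 * b * |u' z|) ^ 2
      ≤ 3 * ux z ^ 2 + 3 * ux' z ^ 2 + 12 * b ^ 2 * u' z ^ 2
    rw [← sq_abs (ux z), ← sq_abs (ux' z), ← sq_abs (u' z)]
    nlinarith [sq_nonneg (|ux z| - |ux' z|), sq_nonneg (|ux z| - 2 * b * |u' z|),
      sq_nonneg (|ux' z| - 2 * b * |u' z|)]
  have hwt : ∫ z in strip B, W z * (wt z - wt' z)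
      = -(∫ z in strip B, W z * (-(q z - q' z) + (r z - r' z) + (k z - k' z)))
        - ∫ z in strip B, W z * (u z * p z - u' z * p' z) := by
    have i1 : Integrable (fun z => W z * (-(q z - q' z) + (r z - r' z) + (k z - k' z)))
        (stripMeasure B) := hd.mem_w.integrable_mul ((hd.mem_q.neg.add hd.mem_r).add hd.mem_k)
    have i1' : Integrable (fun z => -(W z * (-(q z - q' z) + (r z - r' z) + (k z - k' z))))
        (stripMeasure B) := i1.neg
    have i2 : Integrable (fun z => W z * (u z * p z - u' z * p' z)) (stripMeasure B) :=
      hd.mem_w.integrable_mul (h.mem_nonlinear.sub h'.mem_nonlinear)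
    rw [← integral_neg, ← integral_sub i1' i2]
    refine integral_congr_ae ?_
    filter_upwards [h.equation, h'.equation] with z hz hz'
    have e : wt z - wt' z = -(-(q z - q' z) + (r z - r' z) + (k z - k' z))
        - (u z * p z - u' z * p' z) := by linarith
    rw [e]
    ring
  rw [hwt, lin]
  have n1 : 0 ≤ ∫ z in strip B, W z ^ 2 := integral_nonneg fun z => sq_nonneg _
  have n2 : 0 ≤ ∫ z in strip B, P z ^ 2 := integral_nonneg fun z => sq_nonneg _
  have n3 : 0 ≤ ∫ z in strip B, Y z ^ 2 := integral_nonneg fun z => sq_nonneg _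
  have n4 : 0 ≤ ∫ z in strip B, ux z ^ 2 := integral_nonneg fun z => sq_nonneg _
  have n5 : 0 ≤ ∫ z in strip B, ux' z ^ 2 := integral_nonneg fun z => sq_nonneg _
  have n6 : 0 ≤ ∫ z in strip B, u' z ^ 2 := integral_nonneg fun z => sq_nonneg _
  set A := ∫ z in strip B, W z ^ 2
  set PP := ∫ z in strip B, P z ^ 2
  set YY := ∫ z in strip B, Y z ^ 2
  set U1 := ∫ z in strip B, ux z ^ 2
  set U2 := ∫ z in strip B, ux' z ^ 2
  set U3 := ∫ z in strip B, u' z ^ 2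
  set D := C / ε with hD
  have hD0 : 0 ≤ D := by positivity
  -- the gradient terms are absorbed by the dissipation
  have abs1 : ε * ((∫ z in strip B, (P z + b * W z) ^ 2) + YY) ≤ PP + b ^ 2 * A + b * YY := by
    have s1 := mul_le_mul_of_nonneg_left grad hε.le
    have s2 := mul_le_mul_of_nonneg_right hε1 n2
    have s3 := mul_le_mul_of_nonneg_right hε1 (mul_nonneg (sq_nonneg b) n1)
    have s4 := mul_le_mul_of_nonneg_right hε2 n3
    linarith
  have abs2 : D * (∫ z in strip B, (|ux z| + |ux' z| + 2 * b * |u' z|) ^ 2) * A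
      ≤ D * (3 + 12 * b ^ 2) * (U1 + U2 + U3) * A := by
    rw [mul_assoc D (3 + 12 * b ^ 2)]
    gcongr
    have : 0 ≤ b ^ 2 * U1 := by positivity
    have : 0 ≤ b ^ 2 * U2 := by positivity
    linarith
  have n7 : 0 ≤ D * (3 + 12 * b ^ 2) * A := by positivity
  have n8 : 0 ≤ (2 * b ^ 2 + 4 * b ^ 3 + b ^ 2) * (U1 + U2 + U3) * A := by positivity
  have n9 : 0 ≤ b * PP := by positivity
  have lady2 := lady.trans (add_le_add abs1 abs2)
  have tot := nl.trans lady2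
  have expand : (2 * b ^ 2 + 4 * b ^ 3 + b ^ 2 + D * (3 + 12 * b ^ 2)) * (1 + U1 + U2 + U3) * A
      = (2 * b ^ 2 + 4 * b ^ 3 + b ^ 2) * A + (2 * b ^ 2 + 4 * b ^ 3 + b ^ 2) * (U1 + U2 + U3) * A
        + D * (3 + 12 * b ^ 2) * A + D * (3 + 12 * b ^ 2) * (U1 + U2 + U3) * A := by ring
  rw [expand]
  linarith

end DifferenceSlice

/-! ### The fundamental theorem of calculus for weak derivatives in time -/

section Time

variable {T : ℝ}

theorem IsTestFunction.exists_subset_Icc {L : ℝ} {χ : ℝ → ℝ} (hχ : IsTestFunction (Ioo 0 L) χ) :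
    ∃ a c, 0 < a ∧ c < L ∧ tsupport χ ⊆ Icc a c := by
  have hball : Metric.ball (L / 2) (L / 2) = Ioo 0 L := by
    rw [Real.ball_eq_Ioo]; congr 1 <;> ring
  obtain ⟨r, hr, hK⟩ := exists_lt_subset_ball (isClosed_tsupport χ) (hball ▸ hχ.2.2)
  refine ⟨L / 2 - r, L / 2 + r, by linarith, by linarith, hK.trans ?_⟩
  rw [← Real.closedBall_eq_Icc]
  exact Metric.ball_subset_closedBall

theorem IsTestFunction.setIntegral_Ioo {χ : ℝ → ℝ} (hχ : IsTestFunction (Ioo 0 T) χ)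
    (f : ℝ → ℝ) : ∫ t in Ioo 0 T, χ t * f t = ∫ t, χ t * f t := by
  refine setIntegral_eq_integral_of_forall_compl_eq_zero fun t ht => ?_
  rw [image_eq_zero_of_notMem_tsupport fun h => ht (hχ.2.2 h), zero_mul]

/-- A test function with vanishing mean is the derivative of a test function. -/
theorem IsTestFunction.exists_deriv_eq (hT : 0 < T) {ζ : ℝ → ℝ}
    (hζ : IsTestFunction (Ioo 0 T) ζ) (h0 : ∫ t in Ioo 0 T, ζ t = 0) :
    ∃ χ, IsTestFunction (Ioo 0 T) χ ∧ deriv χ = ζ := by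
  obtain ⟨a, c, ha, hc, hac⟩ := hζ.exists_subset_Icc
  have hz : ∀ t, t ∉ Icc a c → ζ t = 0 := fun t ht =>
    image_eq_zero_of_notMem_tsupport fun h => ht (hac h)
  have hcont := hζ.continuous
  have hd : ∀ t, HasDerivAt (fun t => ∫ s in (0 : ℝ)..t, ζ s) (ζ t) t := fun t =>
    intervalIntegral.integral_hasDerivAt_right (hcont.intervalIntegrable _ _)
      (hcont.stronglyMeasurableAtFilter _ _) hcont.continuousAt
  have hderiv : deriv (fun t => ∫ s in (0 : ℝ)..t, ζ s) = ζ := funext fun t => (hd t).deriv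
  have hsupp : tsupport (fun t => ∫ s in (0 : ℝ)..t, ζ s) ⊆ Icc a c := by
    refine closure_minimal (fun t ht => ?_) isClosed_Icc
    by_contra hcon
    apply ht
    rcases lt_or_ge t a with hta | hta
    · simp only
      rw [intervalIntegral.integral_congr (g := fun _ => 0)]
      · simp
      · intro s hs
        refine hz s fun hs' => ?_
        have := hs.2
        rcases le_max_iff.1 this with h | h <;> linarith [hs'.1]
    · have htc : c < t := by
        by_contra h
        exact hcon ⟨hta, not_lt.1 h⟩
      have h1 : ∫ s in (0 : ℝ)..t, ζ s = ∫ s in (0 : ℝ)..T, ζ s := by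
        rw [← intervalIntegral.integral_add_adjacent_intervals (hcont.intervalIntegrable 0 t)
          (hcont.intervalIntegrable t T)]
        rw [intervalIntegral.integral_congr (a := t) (b := T) (g := fun _ => 0)]
        · simp
        · intro s hs
          refine hz s fun hs' => ?_
          have := hs.1
          rcases min_le_iff.1 this with h | h <;> linarith [hs'.2]
      simp only
      rw [h1, intervalIntegral.integral_of_le hT.le, integral_Ioc_eq_integral_Ioo, h0]
  refine ⟨_, ⟨?_, isCompact_Icc.of_isClosed_subset (isClosed_tsupport _) hsupp,
    hsupp.trans fun t ht => ⟨ha.trans_le ht.1, ht.2.trans_lt hc⟩⟩, hderiv⟩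
  rw [contDiff_infty_iff_deriv, hderiv]
  exact ⟨fun t => (hd t).differentiableAt, hζ.1⟩

/-- A continuous function on `[0, T]` whose weak derivative on `(0, T)` is the integrable
function `h` is a primitive of `h`. -/
theorem sub_eq_integral_of_weak_deriv (hT : 0 < T) {F h : ℝ → ℝ} (hF : ContinuousOn F (Icc 0 T))
    (hh : IntegrableOn h (Ioo 0 T))
    (hw : ∀ χ, IsTestFunction (Ioo 0 T) χ →
      ∫ t in Ioo 0 T, deriv χ t * F t = -∫ t in Ioo 0 T, χ t * h t) :
    ∀ t ∈ Icc 0 T, F t - F 0 = ∫ s in (0 : ℝ)..t, h s := by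
  have hii : IntervalIntegrable h volume 0 T := by
    rwa [intervalIntegrable_iff_integrableOn_Ioo_of_le hT.le]
  set H : ℝ → ℝ := fun t => ∫ s in (0 : ℝ)..t, h s with hH
  have hHac : AbsolutelyContinuousOnInterval H 0 T :=
    hii.absolutelyContinuousOnInterval_intervalIntegral (by simp)
  have hHc : ContinuousOn H (Icc 0 T) := by
    simpa [uIcc_of_le hT.le] using hHac.continuousOn
  have hHd : ∀ᵐ t, t ∈ uIcc 0 T → HasDerivAt H (h t) t := by
    have := hii.ae_hasDerivAt_integral
    filter_upwards [this] with t ht hmem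
    exact ht hmem 0 (by simp)
  -- `H` has the same weak derivative as `F`
  have hHw : ∀ χ, IsTestFunction (Ioo 0 T) χ →
      ∫ t in Ioo 0 T, deriv χ t * H t = -∫ t in Ioo 0 T, χ t * h t := by
    intro χ hχ
    have hχac : AbsolutelyContinuousOnInterval χ 0 T := by
      have hcd : Continuous (deriv χ) := hχ.1.continuous_deriv (by simp)
      have e : (fun t => (∫ s in (0 : ℝ)..t, deriv χ s)) = χ := by
        funext t
        rw [intervalIntegral.integral_deriv_eq_sub (fun s _ => hχ.differentiable s)
          (hcd.intervalIntegrable _ _)]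
        have : χ 0 = 0 := image_eq_zero_of_notMem_tsupport fun h => lt_irrefl _ (hχ.2.2 h).1
        rw [this, sub_zero]
      rw [← e]
      exact (hcd.intervalIntegrable 0 T).absolutelyContinuousOnInterval_intervalIntegral (by simp)
    have key := hχac.integral_mul_deriv_eq_deriv_mul hHac
    have z0 : χ 0 = 0 := image_eq_zero_of_notMem_tsupport fun h => lt_irrefl _ (hχ.2.2 h).1
    have zT : χ T = 0 := image_eq_zero_of_notMem_tsupport fun h => lt_irrefl _ (hχ.2.2 h).2
    rw [z0, zT] at key
    have e1 : ∫ t in (0 : ℝ)..T, χ t * deriv H t = ∫ t in (0 : ℝ)..T, χ t * h t := by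
      refine intervalIntegral.integral_congr_ae ?_
      filter_upwards [hHd] with t ht hmem
      rw [(ht (uIoc_subset_uIcc hmem)).deriv]
    rw [e1] at key
    simp only [intervalIntegral.integral_of_le hT.le, integral_Ioc_eq_integral_Ioo] at key
    linarith
  have hDc : ContinuousOn (fun t => F t - H t) (Icc 0 T) := hF.sub hHc
  have hDi : IntegrableOn (fun t => F t - H t) (Ioo 0 T) :=
    (hDc.integrableOn_Icc).mono_set Ioo_subset_Icc_self
  have hFi : IntegrableOn F (Ioo 0 T) := hF.integrableOn_Icc.mono_set Ioo_subset_Icc_self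
  have hHi : IntegrableOn H (Ioo 0 T) := hHc.integrableOn_Icc.mono_set Ioo_subset_Icc_self
  have test_mul : ∀ {χ f : ℝ → ℝ}, IsTestFunction (Ioo 0 T) χ → IntegrableOn f (Ioo 0 T) →
      IntegrableOn (fun t => χ t * f t) (Ioo 0 T) := fun hχ hf =>
    (hχ.integrable_mul hf.locallyIntegrableOn).congr (.of_forall fun t => mul_comm _ _)
  have hD0 : ∀ χ, IsTestFunction (Ioo 0 T) χ →
      ∫ t in Ioo 0 T, deriv χ t * (F t - H t) = 0 := by
    intro χ hχ
    have hχ' : IsTestFunction (Ioo 0 T) (deriv χ) := by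
      simpa using hχ.fderiv_apply (1 : ℝ)
    have := hw χ hχ
    have := hHw χ hχ
    simp only [mul_sub]
    rw [integral_sub (test_mul hχ' hFi) (test_mul hχ' hHi)]
    linarith
  -- hence `F - H` is constant
  obtain ⟨θ₀, hθ₀, -, hθ1⟩ := exists_cutoff_Ioo hT (K := Icc (T / 3) (2 * T / 3)) isClosed_Icc
    fun t ht => ⟨by linarith [ht.1], by linarith [ht.2]⟩
  have hθsq : IsTestFunction (Ioo 0 T) (fun t => θ₀ t * θ₀ t) := hθ₀.smooth_mul hθ₀.1
  have hθpos : 0 < ∫ t in Ioo 0 T, θ₀ t * θ₀ t := by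
    have hi : IntegrableOn (fun t => θ₀ t * θ₀ t) (Ioo 0 T) :=
      (hθsq.continuous.integrable_of_hasCompactSupport hθsq.2.1).integrableOn
    have h1 : ∫ t in Icc (T / 3) (2 * T / 3), θ₀ t * θ₀ t = T / 3 := by
      rw [setIntegral_congr_fun (g := fun _ => 1) measurableSet_Icc
        (fun t ht => by simp [hθ1 t ht])]
      simp only [setIntegral_const, smul_eq_mul, mul_one, Measure.real, Real.volume_Icc]
      rw [ENNReal.toReal_ofReal (by linarith)]
      ring
    have h2 : ∫ t in Icc (T / 3) (2 * T / 3), θ₀ t * θ₀ t ≤ ∫ t in Ioo 0 T, θ₀ t * θ₀ t :=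
      setIntegral_mono_set hi (.of_forall fun t => mul_self_nonneg _)
        (ae_of_all _ fun t ht => ⟨by linarith [ht.1], by linarith [ht.2]⟩)
    linarith
  set I := ∫ t in Ioo 0 T, θ₀ t * θ₀ t with hI
  set k : ℝ := (∫ t in Ioo 0 T, (θ₀ t * θ₀ t) * (F t - H t)) / I with hk
  have hconst : ∀ᵐ t, t ∈ Ioo 0 T → (F t - H t) - k = 0 := by
    refine isOpen_Ioo.ae_eq_zero_of_integral_contDiff_smul_eq_zero
      (hDi.sub (integrableOn_const (by simp))).locallyIntegrableOn fun ψ h1 h2 h3 => ?_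
    have hψ : IsTestFunction (Ioo 0 T) ψ := ⟨h1, h2, h3⟩
    have iψ : IntegrableOn ψ (Ioo 0 T) :=
      (hψ.continuous.integrable_of_hasCompactSupport h2).integrableOn
    have iθ : IntegrableOn (fun t => θ₀ t * θ₀ t) (Ioo 0 T) :=
      (hθsq.continuous.integrable_of_hasCompactSupport hθsq.2.1).integrableOn
    set A := ∫ t in Ioo 0 T, ψ t with hA
    have hζ : IsTestFunction (Ioo 0 T) (fun t => ψ t - A / I * (θ₀ t * θ₀ t)) :=
      hψ.sub (hθsq.smooth_mul contDiff_const)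
    -- subtracting a multiple of `θ₀²` gives mean zero, hence the derivative of a test function
    obtain ⟨χ, hχ, hχd⟩ := hζ.exists_deriv_eq hT (by
      rw [integral_sub iψ (iθ.const_mul _), integral_const_mul, ← hI, ← hA]
      field_simp
      simp)
    have h5 := hD0 χ hχ
    rw [hχd] at h5
    have e5 : ∫ t in Ioo 0 T, (ψ t - A / I * (θ₀ t * θ₀ t)) * (F t - H t)
        = (∫ t in Ioo 0 T, ψ t * (F t - H t))
          - A / I * ∫ t in Ioo 0 T, (θ₀ t * θ₀ t) * (F t - H t) := by
      rw [← integral_const_mul, ← integral_sub (test_mul hψ hDi)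
        ((test_mul hθsq hDi).const_mul _)]
      exact integral_congr_ae (.of_forall fun t => by ring)
    rw [e5] at h5
    simp only [smul_eq_mul]
    rw [← hψ.setIntegral_Ioo]
    have e6 : ∫ t in Ioo 0 T, ψ t * (F t - H t - k)
        = (∫ t in Ioo 0 T, ψ t * (F t - H t)) - k * A := by
      rw [hA, ← integral_const_mul, ← integral_sub (test_mul hψ hDi) (iψ.const_mul _)]
      exact integral_congr_ae (.of_forall fun t => by ring)
    rw [e6]
    have e7 : A / I * (∫ t in Ioo 0 T, (θ₀ t * θ₀ t) * (F t - H t)) = k * A := by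
      rw [hk]; ring
    linarith
  have heq : EqOn (fun t => F t - H t) (fun _ => k) (Icc 0 T) := by
    refine Measure.eqOn_Icc_of_ae_eq volume hT.ne ?_ hDc continuousOn_const
    rw [← restrict_Ioo_eq_restrict_Icc]
    refine (ae_restrict_iff' measurableSet_Ioo).2 ?_
    filter_upwards [hconst] with t ht hmem
    linarith [ht hmem]
  intro t ht
  have h1 : F t - H t = k := heq ht
  have h2 : F 0 - H 0 = k := heq (left_mem_Icc.2 hT.le)
  have h3 : H 0 = 0 := by simp [hH]
  change _ = H t
  linarith

end Time

/-! ### The energy identity in time -/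

theorem volume_restrict_stripT (B T : ℝ) :
    (volume : Measure ((ℝ × ℝ) × ℝ)).restrict (stripT B T)
      = (stripMeasure B).prod (timeMeasure T) := by
  rw [stripT, Measure.volume_eq_prod, ← Measure.prod_restrict]

instance : (volume : Measure ((ℝ × ℝ) × ℝ)).IsAddHaarMeasure :=
  inferInstanceAs ((volume : Measure (ℝ × ℝ)).prod (volume : Measure ℝ)).IsAddHaarMeasure

/-- Bounded weights give continuous quadratic forms on `L²`. -/
theorem continuous_integral_weight_sq {B : ℝ} {m m' : ℝ → ℝ} (hm : IsWeight m m') :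
    Continuous fun F : Lp ℝ 2 (stripMeasure B) => ∫ z in strip B, m z.1 * F z ^ 2 := by
  have hmem : ∀ F : Lp ℝ 2 (stripMeasure B), MemLp (fun z => m z.1 * F z) 2 (stripMeasure B) :=
    fun F => hm.memLp_mul (Lp.memLp F)
  obtain ⟨C, hC⟩ := hm.bdd
  have hlip : LipschitzWith C.toNNReal
      fun F : Lp ℝ 2 (stripMeasure B) => (hmem F).toLp _ := by
    refine LipschitzWith.of_dist_le_mul fun F G => ?_
    rw [dist_eq_norm, dist_eq_norm]
    refine Lp.norm_le_mul_norm_of_ae_le_mul ?_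
    filter_upwards [Lp.coeFn_sub ((hmem F).toLp _) ((hmem G).toLp _), Lp.coeFn_sub F G,
      (hmem F).coeFn_toLp, (hmem G).coeFn_toLp] with z h1 h2 h3 h4
    rw [h1, h2, Pi.sub_apply, Pi.sub_apply, h3, h4, ← mul_sub, norm_mul]
    gcongr
    exact (hC z.1).trans (Real.le_coe_toNNReal C)
  have h := hlip.continuous.inner (𝕜 := ℝ) (continuous_id (X := Lp ℝ 2 (stripMeasure B)))
  refine h.congr fun F => ?_
  rw [L2.inner_def]
  refine integral_congr_ae ?_
  filter_upwards [(hmem F).coeFn_toLp] with z hz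
  rw [id, hz]
  simp only [RCLike.inner_apply, conj_trivial]
  ring

theorem integrable_weight_stripT {B T : ℝ} {m m' : ℝ → ℝ} (hm : IsWeight m m')
    {f g : (ℝ × ℝ) × ℝ → ℝ} (mf : MemLp f 2 (volume.restrict (stripT B T)))
    (mg : MemLp g 2 (volume.restrict (stripT B T))) :
    Integrable (fun q => m q.1.1 * (f q * g q)) (volume.restrict (stripT B T)) := by
  obtain ⟨C, hC⟩ := hm.bdd
  refine (mf.integrable_mul mg).bdd_mul (c := C) ?_ (.of_forall fun q => hC q.1.1)
  exact (hm.continuous.comp (by fun_prop)).aestronglyMeasurable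

/-- For a function with a weak time derivative, the weighted spatial `L²`-norm is absolutely
continuous in time, and its derivative is the expected one. -/
theorem energy_identity {B T : ℝ} (hB : 0 < B) (hT : 0 < T) {v vt : (ℝ × ℝ) × ℝ → ℝ}
    (hv : IsWeakDeriv (stripT B T) eT v vt) (mv : MemLp v 2 (volume.restrict (stripT B T)))
    (mvt : MemLp vt 2 (volume.restrict (stripT B T))) {m m' : ℝ → ℝ} (hm : IsWeight m m')
    {U : ℝ → Lp ℝ 2 (stripMeasure B)} (hUc : ContinuousOn U (Icc 0 T))
    (hU : ∀ᵐ t ∂timeMeasure T, U t =ᵐ[stripMeasure B] slice v t) :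
    ∀ t ∈ Icc 0 T, (∫ z in strip B, m z.1 * U t z ^ 2) - ∫ z in strip B, m z.1 * U 0 z ^ 2
      = ∫ τ in (0 : ℝ)..t, 2 * ∫ z in strip B, m z.1 * (v (z, τ) * vt (z, τ)) := by
  have ivt := integrable_weight_stripT hm mv mvt
  rw [volume_restrict_stripT] at ivt
  refine sub_eq_integral_of_weak_deriv hT
    ((continuous_integral_weight_sq hm).comp_continuousOn hUc) (ivt.integral_prod_right.const_mul 2)
    fun χ hχ => ?_
  -- With `η = 1` on the support of `χ`, the product of `χ v` and `η m v` is `χ m v²`; both factors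
  -- vanish near `t = 0` and `t = T`, so that integrating their extensions by zero by parts in time
  -- produces no boundary terms.
  obtain ⟨η, hη, -, hη1⟩ := exists_cutoff_Ioo hT (isClosed_tsupport χ) hχ.2.2
  have hχη : ∀ t, χ t * η t = χ t := by
    intro t
    by_cases ht : t ∈ tsupport χ
    · rw [hη1 t ht, mul_one]
    · rw [image_eq_zero_of_notMem_tsupport ht, zero_mul]
  have hχη' : ∀ t, deriv χ t * η t + χ t * deriv η t = deriv χ t := by
    intro t
    have h1 := ((hχ.differentiable t).hasDerivAt.mul (hη.differentiable t).hasDerivAt).deriv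
    rw [← h1]
    congr 1
    funext s
    exact hχη s
  obtain ⟨ζ, z1, z2, z3⟩ := exists_cutoff_seq hB
  have dsnd : ∀ {α : ℝ → ℝ}, Differentiable ℝ α → ∀ q : (ℝ × ℝ) × ℝ,
      fderiv ℝ (fun q : (ℝ × ℝ) × ℝ => α q.2) q eT = deriv α q.2 := by
    intro α hα q
    have hd := (hα q.2).hasFDerivAt.comp q (hasFDerivAt_snd (p := q))
    rw [show (fun q : (ℝ × ℝ) × ℝ => α q.2) = α ∘ Prod.snd from rfl, hd.fderiv]
    simp [eT]
  have dfst : ∀ {α : ℝ × ℝ → ℝ}, Differentiable ℝ α → ∀ q : (ℝ × ℝ) × ℝ,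
      fderiv ℝ (fun q : (ℝ × ℝ) × ℝ => α q.1) q eT = 0 := by
    intro α hα q
    have hd := (hα q.1).hasFDerivAt.comp q (hasFDerivAt_fst (p := q))
    rw [show (fun q : (ℝ × ℝ) × ℝ => α q.1) = α ∘ Prod.fst from rfl, hd.fderiv]
    simp [eT]
  have hzd : ∀ n, Differentiable ℝ fun z : ℝ × ℝ => ζ n z.2 := fun n =>
    (z1 n).differentiable.comp differentiable_snd
  -- extension by zero of `α(t) k(x) v` to the whole space-time
  have ext : ∀ {α k k' : ℝ → ℝ}, IsTestFunction (Ioo 0 T) α → IsWeight k k' →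
      IsWeakDeriv univ eT ((stripT B T).indicator fun q => (k q.1.1 * α q.2) * v q)
        ((stripT B T).indicator fun q => (k q.1.1 * α q.2) * vt q
          + (k q.1.1 * deriv α q.2) * v q) := by
    intro α k k' hα hk
    have hks : ContDiff ℝ ((⊤ : ℕ∞) : WithTop ℕ∞) fun q : (ℝ × ℝ) × ℝ => k q.1.1 :=
      hk.smooth_fst.comp contDiff_fst
    have hαs : ContDiff ℝ ((⊤ : ℕ∞) : WithTop ℕ∞) fun q : (ℝ × ℝ) × ℝ => α q.2 :=
      hα.1.comp contDiff_snd
    have := hv.indicator_univ (isOpen_stripT B T) mv mvt (hks.mul hαs)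
      (fun n q => ζ n q.1.2) (fun n => (z1 n).1.comp (contDiff_snd.comp contDiff_fst)) ?_
      (fun n q => z2 n q.1.2) (fun q hq => z3 q.1.2 hq.1.2) (fun n q => dfst (hzd n) q)
    · refine this.congr (.of_forall fun q => rfl) (.of_forall fun q => ?_)
      have e : fderiv ℝ (fun q : (ℝ × ℝ) × ℝ => k q.1.1 * α q.2) q eT = k q.1.1 * deriv α q.2 := by
        rw [fderiv_mul_apply (hks.differentiable (by simp) q) (hαs.differentiable (by simp) q),
          dsnd hα.differentiable, dfst (hk.smooth_fst.differentiable (by simp)), zero_mul, add_zero]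
      by_cases hq : q ∈ stripT B T
      · simp only [indicator_of_mem hq, e]
      · simp only [indicator_of_notMem hq]
    · intro n q hq
      refine ⟨⟨mem_univ _, (z1 n).2.2 (tsupport_comp_subset_preimage (ζ n)
        (continuous_snd.comp continuous_fst) (tsupport_mul_subset_right hq))⟩, hα.2.2 ?_⟩
      exact tsupport_comp_subset_preimage α continuous_snd
        (tsupport_mul_subset_right (tsupport_mul_subset_left hq))
  have memα : ∀ {α k k' : ℝ → ℝ} {f : (ℝ × ℝ) × ℝ → ℝ}, IsTestFunction (Ioo 0 T) α →
      IsWeight k k' → MemLp f 2 (volume.restrict (stripT B T)) →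
      MemLp (fun q => (k q.1.1 * α q.2) * f q) 2 (volume.restrict (stripT B T)) := by
    intro α k k' f hα hk hf
    obtain ⟨C1, hC1⟩ := hk.bdd
    obtain ⟨C2, hC2⟩ := hα.continuous.bounded_above_of_compact_support hα.2.1
    refine (hf.const_mul (C1 * C2)).mono (AEStronglyMeasurable.mul ?_ hf.1)
      (.of_forall fun q => ?_)
    · exact ((hk.continuous.comp (by fun_prop)).mul
        (hα.continuous.comp continuous_snd)).aestronglyMeasurable
    · rw [norm_mul (k q.1.1 * α q.2) (f q), norm_mul (C1 * C2) (f q)]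
      refine mul_le_mul_of_nonneg_right ?_ (norm_nonneg _)
      rw [norm_mul, Real.norm_eq_abs (C1 * C2)]
      exact (mul_le_mul (hC1 _) (hC2 _) (norm_nonneg _) ((abs_nonneg _).trans (hC1 0))).trans
        (le_abs_self _)
  have h1 : IsWeight (fun _ => (1 : ℝ)) (fun _ => 0) := IsWeight.const 1
  have dtest : ∀ {α : ℝ → ℝ}, IsTestFunction (Ioo 0 T) α → IsTestFunction (Ioo 0 T) (deriv α) :=
    fun hα => by simpa using hα.fderiv_apply (1 : ℝ)
  have ind : ∀ {f : (ℝ × ℝ) × ℝ → ℝ}, MemLp f 2 (volume.restrict (stripT B T)) →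
      MemLp ((stripT B T).indicator f) 2 volume :=
    fun hf => (memLp_indicator_iff_restrict (measurableSet_stripT B T)).2 hf
  have key := (ext hχ h1).integral_add_eq_zero (ext hη hm) (ind (memα hχ h1 mv))
    (ind ((memα hχ h1 mvt).add (memα (dtest hχ) h1 mv))) (ind (memα hη hm mv))
    (ind ((memα hη hm mvt).add (memα (dtest hη) hm mv)))
  have i1 : Integrable (fun q : (ℝ × ℝ) × ℝ => deriv χ q.2 * (m q.1.1 * (v q * v q)))
      (volume.restrict (stripT B T)) :=
    ((memα (dtest hχ) hm mv).integrable_mul mv).congr (.of_forall fun q => by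
      simp only [Pi.mul_apply]; ring)
  have i2 : Integrable (fun q : (ℝ × ℝ) × ℝ => χ q.2 * (m q.1.1 * (v q * vt q)))
      (volume.restrict (stripT B T)) :=
    ((memα hχ hm mv).integrable_mul mvt).congr (.of_forall fun q => by
      simp only [Pi.mul_apply]; ring)
  have key2 : (∫ q in stripT B T, deriv χ q.2 * (m q.1.1 * (v q * v q)))
      + 2 * ∫ q in stripT B T, χ q.2 * (m q.1.1 * (v q * vt q)) = 0 := by
    rw [← integral_const_mul, ← integral_add i1 (i2.const_mul 2), ← key,
      ← integral_indicator (measurableSet_stripT B T)]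
    refine integral_congr_ae (.of_forall fun q => ?_)
    by_cases hq : q ∈ stripT B T
    · simp only [indicator_of_mem hq]
      linear_combination (-(m q.1.1 * v q ^ 2)) * hχη' q.2
        + (-2 * m q.1.1 * v q * vt q) * hχη q.2
    · simp only [indicator_of_notMem hq, mul_zero, add_zero]
  rw [volume_restrict_stripT, integral_prod_symm _ (by rwa [volume_restrict_stripT] at i1),
    integral_prod_symm _ (by rwa [volume_restrict_stripT] at i2)] at key2
  simp only [integral_const_mul] at key2
  have e1 : ∫ t in Ioo 0 T, deriv χ t * ∫ z in strip B, m z.1 * U t z ^ 2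
      = ∫ t in Ioo 0 T, deriv χ t * ∫ z in strip B, m z.1 * (v (z, t) * v (z, t)) := by
    refine integral_congr_ae ?_
    filter_upwards [hU] with t ht
    congr 1
    refine integral_congr_ae ?_
    filter_upwards [ht] with z hz
    rw [hz, slice, sq]
  have e2 : ∫ t in Ioo 0 T, χ t * (2 * ∫ z in strip B, m z.1 * (v (z, t) * vt (z, t)))
      = 2 * ∫ t in Ioo 0 T, χ t * ∫ z in strip B, m z.1 * (v (z, t) * vt (z, t)) := by
    rw [← integral_const_mul]
    exact integral_congr_ae (.of_forall fun t => by ring)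
  change ∫ t in Ioo 0 T, deriv χ t * ∫ z in strip B, m z.1 * U t z ^ 2 = _
  rw [e1, e2]
  linarith

/-! ### Time slices of regular solutions -/

/-- On the bounded time interval, `L^∞(0, T; L²)` and `L²(0, T; L²)` embed into the space of square
integrable functions on the cylinder. -/
theorem MemLpL2.memLp_two {B T : ℝ} {q : ℝ≥0∞} (hq : q = 2 ∨ q = ∞) {f : (ℝ × ℝ) × ℝ → ℝ}
    (hf : MemLpL2 B T q f) : MemLp f 2 (volume.restrict (stripT B T)) := by
  obtain ⟨h1, h2⟩ := hf
  refine ⟨h1, (eLpNorm_lt_top_iff_lintegral_rpow_enorm_lt_top two_ne_zero ENNReal.ofNat_ne_top).2 ?_⟩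
  have e : ∀ t, ∫⁻ z in strip B, ‖f (z, t)‖ₑ ^ (2 : ℝ≥0∞).toReal
      = eLpNorm (slice f t) 2 (stripMeasure B) ^ (2 : ℝ≥0∞).toReal := fun t => by
    rw [eLpNorm_eq_lintegral_rpow_enorm_toReal two_ne_zero ENNReal.ofNat_ne_top, one_div,
      ENNReal.rpow_inv_rpow (by simp)]
    rfl
  rw [volume_restrict_stripT] at h1 ⊢
  rw [lintegral_prod_symm _ (h1.enorm.pow_const _)]
  simp only [e]
  rcases hq with rfl | rfl
  · simpa using
      (eLpNorm_lt_top_iff_lintegral_rpow_enorm_lt_top two_ne_zero ENNReal.ofNat_ne_top).1 h2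
  · rw [eLpNorm_exponent_top] at h2
    refine lt_of_le_of_lt (lintegral_mono_ae (g := fun _ =>
      eLpNormEssSup (fun t => eLpNorm (slice f t) 2 (stripMeasure B)) (timeMeasure T)
        ^ (2 : ℝ≥0∞).toReal) ?_) ?_
    · filter_upwards [ae_le_eLpNormEssSup (μ := timeMeasure T)
        (f := fun t => eLpNorm (slice f t) 2 (stripMeasure B))] with t ht
      exact ENNReal.rpow_le_rpow (by simpa using ht) (by simp)
    · rw [lintegral_const]
      exact ENNReal.mul_lt_top (ENNReal.rpow_lt_top_of_nonneg (by simp) h2.ne)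
        (measure_lt_top _ _)

theorem ae_memLp_slice {B T : ℝ} {f : (ℝ × ℝ) × ℝ → ℝ}
    (hf : MemLp f 2 (volume.restrict (stripT B T))) :
    ∀ᵐ t ∂timeMeasure T, MemLp (slice f t) 2 (stripMeasure B) := by
  rw [volume_restrict_stripT] at hf
  filter_upwards [hf.1.prod_swap.prodMk_left, hf.integrable_sq.prod_left_ae] with t h1 h2
  exact (memLp_two_iff_integrable_sq h1).2 h2

/-- The product rule for `e^{bx} f` in the `x`-direction. -/
theorem IsWeakDeriv.expMul_eX {B : ℝ} (b : ℝ) {f g : ℝ × ℝ → ℝ}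
    (h : IsWeakDeriv (strip B) eX f g) :
    IsWeakDeriv (strip B) eX (expMul b f) (fun z => expMul b g z + b * expMul b f z) := by
  have hd : ∀ z : ℝ × ℝ, fderiv ℝ (fun z : ℝ × ℝ => Real.exp (b * z.1)) z eX
      = b * Real.exp (b * z.1) := fun z => by
    have h1 : HasFDerivAt (fun z : ℝ × ℝ => Real.exp (b * z.1)) _ z :=
      ((hasFDerivAt_fst (𝕜 := ℝ) (p := z)).const_mul b).exp
    rw [h1.fderiv]
    simp [eX, mul_comm]
  have := h.smooth_mul (isOpen_strip B) (a := fun z : ℝ × ℝ => Real.exp (b * z.1)) (by fun_prop)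
  refine this.congr (.of_forall fun z => rfl) (.of_forall fun z => ?_)
  simp only [hd, expMul]
  ring

theorem IsWeakDeriv.expMul_eY {B : ℝ} (b : ℝ) {f g : ℝ × ℝ → ℝ}
    (h : IsWeakDeriv (strip B) eY f g) :
    IsWeakDeriv (strip B) eY (expMul b f) (expMul b g) := by
  have hd : ∀ z : ℝ × ℝ, fderiv ℝ (fun z : ℝ × ℝ => Real.exp (b * z.1)) z eY = 0 := fun z => by
    have h1 : HasFDerivAt (fun z : ℝ × ℝ => Real.exp (b * z.1)) _ z :=
      ((hasFDerivAt_fst (𝕜 := ℝ) (p := z)).const_mul b).exp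
    rw [h1.fderiv]
    simp [eY]
  have := h.smooth_mul (isOpen_strip B) (a := fun z : ℝ × ℝ => Real.exp (b * z.1)) (by fun_prop)
  refine this.congr (.of_forall fun z => rfl) (.of_forall fun z => ?_)
  simp only [hd, expMul]
  ring

theorem IsWeakDeriv.expMulT_eT {B T : ℝ} (b : ℝ) {f g : (ℝ × ℝ) × ℝ → ℝ}
    (h : IsWeakDeriv (stripT B T) eT f g) :
    IsWeakDeriv (stripT B T) eT (expMulT b f) (expMulT b g) := by
  have hd : ∀ q : (ℝ × ℝ) × ℝ,
      fderiv ℝ (fun q : (ℝ × ℝ) × ℝ => Real.exp (b * q.1.1)) q eT = 0 := fun q => by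
    have h1 : HasFDerivAt (fun q : (ℝ × ℝ) × ℝ => Real.exp (b * q.1.1)) _ q :=
      ((((hasFDerivAt_fst (𝕜 := ℝ) (p := q.1))).comp q hasFDerivAt_fst).const_mul b).exp
    rw [h1.fderiv]
    simp [eT]
  have := h.smooth_mul (isOpen_stripT B T)
    (a := fun q : (ℝ × ℝ) × ℝ => Real.exp (b * q.1.1)) (by fun_prop)
  refine this.congr (.of_forall fun z => rfl) (.of_forall fun z => ?_)
  simp only [hd, expMulT]
  ring

/-- A measurable function `G` whose (possibly non-convergent) integrals against all
square integrable functions vanish is zero: test with `G / (1 + G²)` times an integrable weight,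
for which the integral does converge. -/
theorem ae_eq_zero_of_integral_mul_eq_zero {B : ℝ} {G : ℝ × ℝ → ℝ}
    (hG : AEStronglyMeasurable G (stripMeasure B))
    (h : ∀ φ : ℝ × ℝ → ℝ, MemLp φ 2 (stripMeasure B) → ∫ z in strip B, G z * φ z = 0) :
    ∀ᵐ z ∂stripMeasure B, G z = 0 := by
  have hκ : Integrable (fun z : ℝ × ℝ => (1 + z.1 ^ 2)⁻¹) (stripMeasure B) := by
    have := integrable_inv_one_add_sq.mul_prod
      (integrable_const (μ := (volume : Measure ℝ).restrict (Ioo 0 B)) (1 : ℝ))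
    rw [stripMeasure, strip, Measure.volume_eq_prod, ← Measure.prod_restrict,
      Measure.restrict_univ]
    simpa using this
  have κ0 : ∀ x : ℝ, 0 < (1 + x ^ 2)⁻¹ := fun x => by positivity
  have κ1 : ∀ x : ℝ, (1 + x ^ 2)⁻¹ ≤ 1 := fun x =>
    inv_le_one_of_one_le₀ (by nlinarith [sq_nonneg x])
  have mφ : AEStronglyMeasurable (fun z => G z / (1 + G z ^ 2) * (1 + z.1 ^ 2)⁻¹)
      (stripMeasure B) := by
    refine AEStronglyMeasurable.mul ?_ hκ.1
    have : Continuous fun x : ℝ => x / (1 + x ^ 2) :=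
      continuous_id.div (by fun_prop) fun x => by positivity
    exact this.comp_aestronglyMeasurable hG
  have φ2 : MemLp (fun z => G z / (1 + G z ^ 2) * (1 + z.1 ^ 2)⁻¹) 2 (stripMeasure B) := by
    refine (memLp_two_iff_integrable_sq mφ).2 (hκ.mono' (mφ.pow 2) (.of_forall fun z => ?_))
    have b1 : (G z / (1 + G z ^ 2)) ^ 2 ≤ 1 := by
      rw [div_pow, div_le_one (by positivity)]
      nlinarith [sq_nonneg (G z), sq_nonneg (G z ^ 2)]
    rw [Real.norm_eq_abs, abs_of_nonneg (sq_nonneg _), mul_pow]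
    nlinarith [κ0 z.1, κ1 z.1, sq_nonneg (G z / (1 + G z ^ 2)), sq_nonneg (1 + z.1 ^ 2)⁻¹]
  have n0 : ∀ z, 0 ≤ G z * (G z / (1 + G z ^ 2) * (1 + z.1 ^ 2)⁻¹) := fun z => by
    rw [← mul_assoc, mul_div_assoc', ← sq]
    positivity
  have int : Integrable (fun z => G z * (G z / (1 + G z ^ 2) * (1 + z.1 ^ 2)⁻¹))
      (stripMeasure B) := by
    refine hκ.mono' (hG.mul mφ) (.of_forall fun z => ?_)
    rw [Real.norm_eq_abs, abs_of_nonneg (n0 z), ← mul_assoc, mul_div_assoc', ← sq]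
    refine mul_le_of_le_one_left (κ0 _).le ?_
    rw [div_le_one (by positivity)]
    linarith
  have := (integral_eq_zero_iff_of_nonneg n0 int).1 (h _ φ2)
  filter_upwards [this] with z hz
  by_contra hne
  have : 0 < G z * (G z / (1 + G z ^ 2) * (1 + z.1 ^ 2)⁻¹) := by
    rw [← mul_assoc, mul_div_assoc', ← sq]
    positivity
  exact this.ne' hz

namespace IsRegularSolutionWith

variable {b B T : ℝ} {u₀ : ℝ × ℝ → ℝ} {u ux uxx uxy uxxx uxyy ut : (ℝ × ℝ) × ℝ → ℝ}

theorem memLp_u (h : IsRegularSolutionWith b B T u₀ u ux uxx uxy uxxx uxyy ut) :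
    MemLp u 2 (volume.restrict (stripT B T)) := h.mem_u.memLp_two (.inr rfl)

theorem memLp_ux (h : IsRegularSolutionWith b B T u₀ u ux uxx uxy uxxx uxyy ut) :
    MemLp ux 2 (volume.restrict (stripT B T)) := h.mem_ux.memLp_two (.inl rfl)

theorem memLp_expMulT_u (h : IsRegularSolutionWith b B T u₀ u ux uxx uxy uxxx uxyy ut) :
    MemLp (expMulT b u) 2 (volume.restrict (stripT B T)) :=
  h.mem_weighted_u.1.1.memLp_two (.inr rfl)

theorem memLp_expMulT_ut (h : IsRegularSolutionWith b B T u₀ u ux uxx uxy uxxx uxyy ut) :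
    MemLp (expMulT b ut) 2 (volume.restrict (stripT B T)) :=
  h.mem_weighted_ut.1.memLp_two (.inr rfl)

/-- At almost every time the weighted derivatives are square integrable and the equation holds
almost everywhere on the strip. -/
theorem ae_solutionSlice (h : IsRegularSolutionWith b B T u₀ u ux uxx uxy uxxx uxyy ut) :
    ∀ᵐ t ∂timeMeasure T, ∃ wy, SolutionSlice b B (slice u t) (slice ux t) (slice (expMulT b u) t)
      (slice (expMulT b ux) t) (slice (expMulT b uxx) t) (slice (expMulT b uxxx) t)
      (slice (expMulT b uxy) t) (slice (expMulT b uxyy) t) wy (slice (expMulT b ut) t) := by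
  obtain ⟨mp, fx, fy, hfx, hfy, ⟨mfx, fxx, -, hfxx, -, mfxx, -⟩, ⟨mfy, -, fyy, -, hfyy, -, mfyy⟩⟩ :=
    h.mem_weighted_ux.1
  have L2 : ∀ {f : (ℝ × ℝ) × ℝ → ℝ}, MemLpL2 B T ∞ f →
      ∀ᵐ t ∂timeMeasure T, MemLp (slice f t) 2 (stripMeasure B) :=
    fun hf => ae_memLp_slice (hf.memLp_two (.inr rfl))
  filter_upwards [h.deriv_x, h.deriv_xx, h.deriv_xy, h.deriv_xxx, h.deriv_xyy, h.equation,
    h.boundary, ae_memLp_slice h.memLp_u, ae_memLp_slice h.memLp_ux,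
    ae_memLp_slice h.memLp_expMulT_ut, hfx, hfy, hfxx, hfyy, L2 mp, L2 mfx, L2 mfy, L2 mfxx,
    L2 mfyy] with t dx dxx dxy dxxx dxyy heq hbd mu mux mwt dfx dfy dfxx dfyy mp mfx mfy mfxx mfyy
  have wx := dx.expMul_eX b
  have px := dxx.expMul_eX b
  have py := dxy.expMul_eY b
  have qx := dxxx.expMul_eX b
  have sy := dxyy.expMul_eY b
  -- Weak derivatives are unique, so the integrability of the derivatives of `e^{bx} uₓ` is that of
  -- combinations of `e^{bx} uₓₓ`, `e^{bx} uₓₓₓ`, `e^{bx} uₓᵧ` and `e^{bx} uₓᵧᵧ`.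
  have efx := dfx.ae_unique (isOpen_strip B) px
  have efy := dfy.ae_unique (isOpen_strip B) py
  have mq : MemLp (expMul b (slice uxx t)) 2 (stripMeasure B) := by
    refine (mfx.sub (mp.const_mul b)).ae_eq ?_
    filter_upwards [efx] with z hz
    rw [Pi.sub_apply, hz, slice, expMulT, expMul, expMul, slice, slice]
    ring
  have ms : MemLp (expMul b (slice uxy t)) 2 (stripMeasure B) := mfy.ae_eq efy
  have efyy := (dfyy.congr efy .rfl).ae_unique (isOpen_strip B) sy
  have mk : MemLp (expMul b (slice uxyy t)) 2 (stripMeasure B) := mfyy.ae_eq efyy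
  have px' : IsWeakDeriv (strip B) eX (fun z => b * expMul b (slice ux t) z)
      (fun z => b * (expMul b (slice uxx t) z + b * expMul b (slice ux t) z)) := by
    simpa using px.smooth_mul (isOpen_strip B) (a := fun _ => b) contDiff_const
  have efxx := (dfxx.congr efx .rfl).ae_unique (isOpen_strip B) (qx.add px')
  have mr : MemLp (expMul b (slice uxxx t)) 2 (stripMeasure B) := by
    refine ((mfxx.sub (mq.const_mul (2 * b))).sub (mp.const_mul (b ^ 2))).ae_eq ?_
    filter_upwards [efxx] with z hz
    rw [Pi.sub_apply, Pi.sub_apply, hz, slice, expMulT, expMul, expMul, expMul, slice, slice, slice]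
    ring
  obtain ⟨vx, wy, hvx, hwy, hlim⟩ := hbd.exists_isTestLimit
  have hvx' := hvx.ae_unique (isOpen_strip B) wx
  refine ⟨wy, ⟨wx, hwy, px, py, qx, sy, mp, mq, mr, ms, mk, hlim.congr_x hvx'⟩, fun z => rfl,
    fun z => rfl, mu, mux, mwt, ?_⟩
  have mG : AEStronglyMeasurable (fun z => slice (expMulT b ut) t z - slice (expMulT b uxx) t z
      + slice (expMulT b uxxx) t z + slice u t z * slice (expMulT b ux) t z
      + slice (expMulT b uxyy) t z) (stripMeasure B) :=
    (((mwt.1.sub mq.1).add mr.1).add (mu.1.mul mp.1)).add mk.1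
  refine ae_eq_zero_of_integral_mul_eq_zero mG fun φ hφ => ?_
  rw [← heq φ hφ]
  refine integral_congr_ae (.of_forall fun z => ?_)
  simp only [slice, expMulT]
  ring

end IsRegularSolutionWith

/-! ### The `L²` bound -/

theorem expWeight_two_mul_sq (b δ x a : ℝ) :
    expWeight (4 * b) δ (2 * b) x * (Real.exp (b * x) * a) ^ 2
      = expWeight (4 * b) δ (4 * b) x * a ^ 2 := by
  rw [show 4 * b = 2 * b + 2 * b by ring, expWeight_add, mul_pow, ← Real.exp_nat_mul]
  push_cast
  ring_nf

theorem expWeight_sq_mul_sq (b : ℝ) {δ : ℝ} (hδ : 0 < δ) (x a : ℝ) :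
    4 * b * δ * expWeight (4 * b) δ b x ^ 2 * (Real.exp (b * x) * a) ^ 2
      = expWeight (4 * b) δ (4 * b) x * (1 - expWeight (4 * b) δ (4 * b) x) * (4 * b * a ^ 2) := by
  have e : Real.exp (4 * b * x) = Real.exp (b * x) ^ 4 := by
    rw [← Real.exp_nat_mul]; congr 1; push_cast; ring
  have hpos : Real.exp (b * x) ^ 4 + δ ≠ 0 := by positivity
  simp only [expWeight, e]
  field_simp
  ring

/-- The weights `e^{cx} / (e^{cx} + 1/(n+1))` increase to one, so that dominated convergence
applies to continuous functions of them. -/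
theorem tendsto_integral_expWeight {α : Type*} [MeasurableSpace α] {μ : Measure α} {ξ f : α → ℝ}
    (hξ : Measurable ξ) (hf : Integrable f μ) (c : ℝ) (hc : 0 ≤ c) {G : ℝ → ℝ} (hG : Continuous G)
    (hG1 : ∀ s ∈ Icc (0 : ℝ) 1, |G s| ≤ 1) :
    Tendsto (fun n : ℕ => ∫ x, G (expWeight c (1 / (n + 1 : ℝ)) c (ξ x)) * f x ∂μ) atTop
      (𝓝 (∫ x, G 1 * f x ∂μ)) := by
  refine tendsto_integral_of_dominated_convergence (fun x => ‖f x‖) (fun n => ?_) hf.norm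
    (fun n => .of_forall fun x => ?_) (.of_forall fun x => ?_)
  · have hw := (isWeight_expWeight (c := c) (δ := 1 / (n + 1 : ℝ)) (a := c)
      Nat.one_div_pos_of_nat hc le_rfl).continuous
    exact ((hG.comp hw).measurable.comp hξ).aestronglyMeasurable.mul hf.1
  · rw [norm_mul]
    have hδ : (0 : ℝ) < 1 / (n + 1 : ℝ) := Nat.one_div_pos_of_nat
    exact mul_le_of_le_one_left (norm_nonneg _)
      (hG1 _ ⟨expWeight_nonneg hδ _, expWeight_self_le_one hδ _⟩)
  · exact ((hG.tendsto 1).comp (tendsto_expWeight_self c (ξ x))).mul_const (f x)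

theorem intervalIntegral_le_setIntegral_Ioo {T t : ℝ} (ht : t ∈ Icc 0 T) {g k : ℝ → ℝ}
    (hg : IntegrableOn g (Ioo 0 T)) (hk : IntegrableOn k (Ioo 0 T))
    (h0 : ∀ᵐ τ ∂timeMeasure T, 0 ≤ k τ) (h : ∀ᵐ τ ∂timeMeasure T, g τ ≤ k τ) :
    ∫ τ in (0 : ℝ)..t, g τ ≤ ∫ τ in Ioo 0 T, k τ := by
  have hs : Ioo 0 t ⊆ Ioo 0 T := Ioo_subset_Ioo_right ht.2
  rw [intervalIntegral.integral_of_le ht.1, integral_Ioc_eq_integral_Ioo]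
  refine (setIntegral_mono_ae_restrict (hg.mono_set hs) (hk.mono_set hs)
    (ae_restrict_of_ae_restrict_of_subset hs h)).trans ?_
  exact setIntegral_mono_set hk h0 (.of_forall hs)

theorem integral_stripT {B T : ℝ} {f : (ℝ × ℝ) × ℝ → ℝ}
    (hf : Integrable f (volume.restrict (stripT B T))) :
    ∫ q in stripT B T, f q = ∫ t in Ioo 0 T, ∫ z in strip B, f (z, t) := by
  rw [volume_restrict_stripT] at hf ⊢
  exact integral_prod_symm _ hf

theorem integrableOn_integral_strip {B T : ℝ} {f : (ℝ × ℝ) × ℝ → ℝ}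
    (hf : Integrable f (volume.restrict (stripT B T))) :
    IntegrableOn (fun t => ∫ z in strip B, f (z, t)) (Ioo 0 T) := by
  rw [volume_restrict_stripT] at hf
  exact hf.integral_prod_right

theorem integral_sq_le_of_eLpNorm_le {α : Type*} [MeasurableSpace α] {μ : Measure α} {f : α → ℝ}
    (hf : MemLp f 2 μ) {M : ℝ≥0∞} (hM : M ≠ ∞) (h : eLpNorm f 2 μ ≤ M) :
    ∫ z, f z ^ 2 ∂μ ≤ M.toReal ^ 2 := by
  rw [integral_sq_eq_toReal hf]
  gcongr

namespace IsRegularSolutionWith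

variable {b B T : ℝ} {u₀ : ℝ × ℝ → ℝ} {u ux uxx uxy uxxx uxyy ut : (ℝ × ℝ) × ℝ → ℝ}

theorem exists_ae_integral_sq_le (h : IsRegularSolutionWith b B T u₀ u ux uxx uxy uxxx uxyy ut) :
    ∃ M : ℝ, 0 ≤ M ∧ ∀ᵐ t ∂timeMeasure T, ∫ z in strip B, u (z, t) ^ 2 ≤ M := by
  refine ⟨(eLpNormEssSup (fun t => eLpNorm (slice u t) 2 (stripMeasure B))
    (timeMeasure T)).toReal ^ 2, sq_nonneg _, ?_⟩
  have hfin := h.mem_u.2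
  rw [eLpNorm_exponent_top] at hfin
  filter_upwards [ae_le_eLpNormEssSup (μ := timeMeasure T)
    (f := fun t => eLpNorm (slice u t) 2 (stripMeasure B)), ae_memLp_slice h.memLp_u] with t ht mu
  exact integral_sq_le_of_eLpNorm_le mu hfin.ne (by simpa using ht)

/-- The a priori `L²` estimate: `‖u(t)‖² ≤ ‖u₀‖²` and `2 ∫ ‖uₓ‖² ≤ ‖u₀‖²`. The solution is only
controlled in `L²` with a weight that decays at `-∞`, so the energy identity is
localized by `S = e^{4bx} / (e^{4bx} + δ)`; the commutator terms are bounded by `∫∫ S (1 - S) u²`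
and disappear as `δ → 0`. -/
theorem integral_sq_le (hb : 0 < b) (hB : 0 < B) (hT : 0 < T)
    (h : IsRegularSolutionWith b B T u₀ u ux uxx uxy uxxx uxyy ut)
    (hu₀ : MemLp u₀ 2 (stripMeasure B)) {R : ℝ} (hR : 0 ≤ R)
    (hu₀R : eLpNorm u₀ 2 (stripMeasure B) ≤ ENNReal.ofReal R) :
    (∀ᵐ t ∂timeMeasure T, ∫ z in strip B, u (z, t) ^ 2 ≤ R ^ 2) ∧
      2 * ∫ q in stripT B T, ux q ^ 2 ≤ R ^ 2 := by
  obtain ⟨C, hC0, hC⟩ := exists_energy_slice hb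
  obtain ⟨M, hM0, hM⟩ := h.exists_ae_integral_sq_le
  obtain ⟨U, ⟨hUc, hU⟩, hU0⟩ := h.initial
  set δ : ℕ → ℝ := fun n => 1 / (n + 1 : ℝ) with hδ_def
  have hδ : ∀ n, 0 < δ n := fun n => Nat.one_div_pos_of_nat
  set S : ℕ → ℝ → ℝ := fun n => expWeight (4 * b) (δ n) (4 * b) with hS_def
  have S0 : ∀ n x, 0 ≤ S n x := fun n => expWeight_nonneg (hδ n)
  have S1 : ∀ n x, S n x ≤ 1 := fun n => expWeight_self_le_one (hδ n)
  have hSw := fun n => isWeight_expWeight (c := 4 * b) (a := 4 * b) (hδ n) (by positivity) le_rfl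
  have hmw := fun n => isWeight_expWeight (c := 4 * b) (a := 2 * b) (hδ n) (by positivity)
    (by linarith)
  have iu : Integrable (fun q => u q ^ 2) (volume.restrict (stripT B T)) :=
    h.memLp_u.integrable_sq
  have iux : Integrable (fun q => ux q ^ 2) (volume.restrict (stripT B T)) :=
    h.memLp_ux.integrable_sq
  have mS : ∀ n, AEStronglyMeasurable (fun q : (ℝ × ℝ) × ℝ => S n q.1.1)
      (volume.restrict (stripT B T)) := fun n =>
    ((hSw n).continuous.comp (by fun_prop)).aestronglyMeasurable
  have iSux : ∀ n, Integrable (fun q => S n q.1.1 * ux q ^ 2) (volume.restrict (stripT B T)) :=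
    fun n => iux.bdd_mul (c := 1) (mS n) (.of_forall fun q => by
      rw [Real.norm_eq_abs, abs_of_nonneg (S0 n _)]; exact S1 n _)
  have bG : ∀ s ∈ Icc (0 : ℝ) 1, |s * (1 - s)| ≤ 1 := fun s hs => by
    rw [abs_of_nonneg (mul_nonneg hs.1 (by linarith [hs.2]))]
    nlinarith [hs.1, hs.2]
  have iSu : ∀ n, Integrable (fun q => S n q.1.1 * (1 - S n q.1.1) * (4 * b * u q ^ 2))
      (volume.restrict (stripT B T)) :=
    fun n => (iu.const_mul (4 * b)).bdd_mul (c := 1)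
      ((mS n).mul (aestronglyMeasurable_const.sub (mS n)))
      (.of_forall fun q => bG _ ⟨S0 n _, S1 n _⟩)
  set ε : ℕ → ℝ := fun n => 2 * (C * (1 + M)) *
    ∫ q in stripT B T, S n q.1.1 * (1 - S n q.1.1) * (4 * b * u q ^ 2) with hε_def
  have hε : Tendsto ε atTop (𝓝 0) := by
    have t1 := tendsto_integral_expWeight (μ := volume.restrict (stripT B T))
      (ξ := fun q : (ℝ × ℝ) × ℝ => q.1.1) (by fun_prop) (iu.const_mul (4 * b)) (4 * b)
      (by positivity) (G := fun s => s * (1 - s)) (by fun_prop) bG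
    have t2 := t1.const_mul (2 * (C * (1 + M)))
    simp only [sub_self, mul_zero, zero_mul, integral_zero] at t2
    exact t2
  -- the localized energy inequality at almost every time
  have slice_le : ∀ n, ∀ᵐ τ ∂timeMeasure T,
      2 * (∫ z in strip B, expWeight (4 * b) (δ n) (2 * b) z.1
          * (expMulT b u (z, τ) * expMulT b ut (z, τ)))
        ≤ 2 * (C * (1 + M)) *
            (∫ z in strip B, S n z.1 * (1 - S n z.1) * (4 * b * u (z, τ) ^ 2))
          - 2 * ∫ z in strip B, S n z.1 * ux (z, τ) ^ 2 := by
    intro n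
    filter_upwards [h.ae_solutionSlice, hM] with τ ⟨wy, hτ⟩ hMτ
    have key := hC B hB _ _ _ _ _ _ _ _ _ _ hτ (δ n) (hδ n)
    have e1 : ∫ z in strip B, expWeight (4 * b) (δ n) (2 * b) z.1 * slice (expMulT b ux) τ z ^ 2
        = ∫ z in strip B, S n z.1 * ux (z, τ) ^ 2 :=
      integral_congr_ae (.of_forall fun z => expWeight_two_mul_sq b (δ n) z.1 (ux (z, τ)))
    have e2 : ∫ z in strip B, 4 * b * δ n * expWeight (4 * b) (δ n) b z.1 ^ 2
          * slice (expMulT b u) τ z ^ 2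
        = ∫ z in strip B, S n z.1 * (1 - S n z.1) * (4 * b * u (z, τ) ^ 2) :=
      integral_congr_ae (.of_forall fun z => expWeight_sq_mul_sq b (hδ n) z.1 (u (z, τ)))
    rw [e1, e2] at key
    have n0 : 0 ≤ ∫ z in strip B, S n z.1 * (1 - S n z.1) * (4 * b * u (z, τ) ^ 2) :=
      integral_nonneg fun z => mul_nonneg (mul_nonneg (S0 n _) (by linarith [S1 n z.1]))
        (by positivity)
    have : C * (1 + ∫ z in strip B, slice u τ z ^ 2) ≤ C * (1 + M) := by
      gcongr
      exact hMτ
    have := mul_le_mul_of_nonneg_right this n0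
    change 2 * (∫ z in strip B, expWeight (4 * b) (δ n) (2 * b) z.1
      * (slice (expMulT b u) τ z * slice (expMulT b ut) τ z)) ≤ _
    linarith
  have ident := fun n => energy_identity hB hT (h.deriv_t.expMulT_eT b) h.memLp_expMulT_u
    h.memLp_expMulT_ut (hmw n) hUc hU
  have hstart : ∀ n, ∫ z in strip B, expWeight (4 * b) (δ n) (2 * b) z.1 * U 0 z ^ 2 ≤ R ^ 2 := by
    intro n
    have e : ∫ z in strip B, expWeight (4 * b) (δ n) (2 * b) z.1 * U 0 z ^ 2
        = ∫ z in strip B, S n z.1 * u₀ z ^ 2 := by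
      refine integral_congr_ae ?_
      filter_upwards [hU0] with z hz
      rw [hz, expMul, expWeight_two_mul_sq]
    rw [e]
    refine (integral_mono_of_nonneg (.of_forall fun z => mul_nonneg (S0 n _) (sq_nonneg _))
      hu₀.integrable_sq (.of_forall fun z =>
        mul_le_of_le_one_left (sq_nonneg _) (S1 n _))).trans ?_
    have := integral_sq_le_of_eLpNorm_le hu₀ ENNReal.ofReal_ne_top hu₀R
    rwa [ENNReal.toReal_ofReal hR] at this
  have ig : ∀ n, IntegrableOn (fun τ => 2 * (∫ z in strip B, expWeight (4 * b) (δ n) (2 * b) z.1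
      * (expMulT b u (z, τ) * expMulT b ut (z, τ)))) (Ioo 0 T) := fun n =>
    (integrableOn_integral_strip
      (integrable_weight_stripT (hmw n) h.memLp_expMulT_u h.memLp_expMulT_ut)).const_mul 2
  have ic : ∀ n, IntegrableOn (fun τ => 2 * (C * (1 + M)) *
      (∫ z in strip B, S n z.1 * (1 - S n z.1) * (4 * b * u (z, τ) ^ 2))) (Ioo 0 T) := fun n =>
    (integrableOn_integral_strip (iSu n)).const_mul _
  have ia : ∀ n, IntegrableOn (fun τ => 2 * ∫ z in strip B, S n z.1 * ux (z, τ) ^ 2) (Ioo 0 T) :=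
    fun n => (integrableOn_integral_strip (iSux n)).const_mul _
  have a0 : ∀ n τ, 0 ≤ 2 * ∫ z in strip B, S n z.1 * ux (z, τ) ^ 2 := fun n τ =>
    mul_nonneg two_pos.le (integral_nonneg fun z => mul_nonneg (S0 n _) (sq_nonneg _))
  have c0 : ∀ n τ, 0 ≤ 2 * (C * (1 + M)) *
      (∫ z in strip B, S n z.1 * (1 - S n z.1) * (4 * b * u (z, τ) ^ 2)) := fun n τ =>
    mul_nonneg (by positivity) (integral_nonneg fun z =>
      mul_nonneg (mul_nonneg (S0 n _) (by linarith [S1 n z.1])) (by positivity))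
  have ec : ∀ n, ∫ τ in Ioo 0 T, 2 * (C * (1 + M)) *
      (∫ z in strip B, S n z.1 * (1 - S n z.1) * (4 * b * u (z, τ) ^ 2)) = ε n := fun n => by
    rw [integral_const_mul]
    exact congrArg _ (integral_stripT (iSu n)).symm
  have ea : ∀ n, ∫ τ in Ioo 0 T, 2 * (∫ z in strip B, S n z.1 * ux (z, τ) ^ 2)
      = 2 * ∫ q in stripT B T, S n q.1.1 * ux q ^ 2 := fun n => by
    rw [integral_const_mul]
    exact congrArg _ (integral_stripT (iSux n)).symm
  constructor
  · filter_upwards [hU, ae_memLp_slice h.memLp_u, ae_restrict_mem measurableSet_Ioo]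
      with t hUt mu ht
    have le : ∀ n, ∫ z in strip B, S n z.1 * u (z, t) ^ 2 ≤ R ^ 2 + ε n := fun n => by
      have e : ∫ z in strip B, expWeight (4 * b) (δ n) (2 * b) z.1 * U t z ^ 2
          = ∫ z in strip B, S n z.1 * u (z, t) ^ 2 := by
        refine integral_congr_ae ?_
        filter_upwards [hUt] with z hz
        rw [hz, expMul, expWeight_two_mul_sq, slice]
      have h1 := ident n t ⟨ht.1.le, ht.2.le⟩
      have h2 := intervalIntegral_le_setIntegral_Ioo ⟨ht.1.le, ht.2.le⟩ (ig n) (ic n)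
        (.of_forall (c0 n)) (by
          filter_upwards [slice_le n] with τ hτ
          linarith [a0 n τ])
      rw [ec] at h2
      linarith [hstart n]
    have lim := tendsto_integral_expWeight (μ := stripMeasure B)
      (ξ := fun z : ℝ × ℝ => z.1) (by fun_prop) mu.integrable_sq (4 * b)
      (by positivity) (G := fun s => s) (by fun_prop) fun s hs => by
        rw [abs_of_nonneg hs.1]; exact hs.2
    simp only [one_mul] at lim
    exact le_of_tendsto_of_tendsto' lim (by simpa using hε.const_add (R ^ 2)) le
  · have le : ∀ n, 2 * ∫ q in stripT B T, S n q.1.1 * ux q ^ 2 ≤ R ^ 2 + ε n := fun n => by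
      have h1 := ident n T ⟨hT.le, le_rfl⟩
      have h0 : 0 ≤ ∫ z in strip B, expWeight (4 * b) (δ n) (2 * b) z.1 * U T z ^ 2 :=
        integral_nonneg fun z => mul_nonneg (expWeight_nonneg (hδ n) _) (sq_nonneg _)
      have h2 := integral_mono_ae (ig n) ((ic n).sub (ia n)) (slice_le n)
      rw [intervalIntegral.integral_of_le hT.le, integral_Ioc_eq_integral_Ioo] at h1
      simp only [Pi.sub_apply] at h2
      rw [integral_sub (ic n) (ia n), ec, ea] at h2
      linarith [hstart n]
    have lim := tendsto_integral_expWeight (μ := volume.restrict (stripT B T))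
      (ξ := fun q : (ℝ × ℝ) × ℝ => q.1.1) (by fun_prop) iux (4 * b)
      (by positivity) (G := fun s => s) (by fun_prop) fun s hs => by
        rw [abs_of_nonneg hs.1]; exact hs.2
    simp only [one_mul] at lim
    exact le_of_tendsto_of_tendsto' (lim.const_mul 2) (by simpa using hε.const_add (R ^ 2)) le

end IsRegularSolutionWith

/-! ### A Grönwall inequality with integrable coefficient -/

theorem le_two_mul_of_sub_le_integral {s t : ℝ} (hst : s ≤ t) {E k : ℝ → ℝ}
    (hE : ContinuousOn E (Icc s t)) (E0 : ∀ r ∈ Icc s t, 0 ≤ E r)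
    (hk : IntervalIntegrable k volume s t) (k0 : ∀ r, 0 ≤ k r)
    (h : ∀ r ∈ Icc s t, E r - E s ≤ ∫ τ in s..r, k τ * E τ)
    (hkst : ∫ τ in s..t, k τ ≤ 1 / 2) : E t ≤ 2 * E s := by
  obtain ⟨r, hr, hmax⟩ := isCompact_Icc.exists_isMaxOn (nonempty_Icc.2 hst) hE
  have hkr : IntervalIntegrable k volume s r :=
    hk.mono_set (by rw [uIcc_of_le hr.1, uIcc_of_le hst]; exact Icc_subset_Icc_right hr.2)
  have hsub : Icc s r ⊆ Icc s t := Icc_subset_Icc_right hr.2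
  have h1 : ∫ τ in s..r, k τ * E τ ≤ ∫ τ in s..r, k τ * E r :=
    intervalIntegral.integral_mono_on hr.1
      (hkr.mul_continuousOn (by rw [uIcc_of_le hr.1]; exact hE.mono hsub)) (hkr.mul_const _)
      fun τ hτ => mul_le_mul_of_nonneg_left (hmax (hsub hτ)) (k0 τ)
  have h2 : ∫ τ in s..r, k τ ≤ ∫ τ in s..t, k τ :=
    intervalIntegral.integral_mono_interval le_rfl hr.1 hr.2 (.of_forall k0) hk
  rw [intervalIntegral.integral_mul_const] at h1
  have h3 := h r hr
  -- at a maximum point `r` of `E` the increment is at most `E r / 2`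
  have h4 := mul_le_mul_of_nonneg_right (h2.trans hkst) (E0 r hr)
  have h5 : E t ≤ E r := hmax (right_mem_Icc.2 hst)
  linarith

/-- Grönwall's inequality for an integrable coefficient `k`: a continuous function whose increments
are bounded by `∫ k E` at most doubles on each interval where `∫ k ≤ 1/2`. -/
theorem le_two_pow_mul_of_sub_le_integral {T : ℝ} {E k : ℝ → ℝ}
    (hE : ContinuousOn E (Icc 0 T)) (E0 : ∀ r ∈ Icc 0 T, 0 ≤ E r)
    (hk : IntervalIntegrable k volume 0 T) (k0 : ∀ r, 0 ≤ k r)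
    (h : ∀ s r, 0 ≤ s → s ≤ r → r ≤ T → E r - E s ≤ ∫ τ in s..r, k τ * E τ) (n : ℕ) :
    ∀ t ∈ Icc 0 T, ∫ τ in (0 : ℝ)..t, k τ ≤ (n + 1 : ℝ) / 2 → E t ≤ 2 ^ (n + 1) * E 0 := by
  have sub : ∀ {s t : ℝ}, 0 ≤ s → s ≤ t → t ≤ T → IntervalIntegrable k volume s t :=
    fun h0 h1 h2 => hk.mono_set (by
      rw [uIcc_of_le h1, uIcc_of_le (h0.trans (h1.trans h2))]; exact Icc_subset_Icc h0 h2)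
  have step : ∀ {s t : ℝ}, 0 ≤ s → s ≤ t → t ≤ T → ∫ τ in s..t, k τ ≤ 1 / 2 → E t ≤ 2 * E s :=
    fun h0 h1 h2 h3 => le_two_mul_of_sub_le_integral h1 (hE.mono (Icc_subset_Icc h0 h2))
      (fun r hr => E0 r ⟨h0.trans hr.1, hr.2.trans h2⟩) (sub h0 h1 h2) k0
      (fun r hr => h _ r h0 hr.1 (hr.2.trans h2)) h3
  induction n with
  | zero =>
    intro t ht hkt
    simpa using step le_rfl ht.1 ht.2 (by simpa using hkt)
  | succ n ih =>
    intro t ht hkt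
    have hT : 0 ≤ T := ht.1.trans ht.2
    rcases le_total (∫ τ in (0 : ℝ)..t, k τ) ((n + 1 : ℝ) / 2) with hle | hge
    · refine (ih t ht hle).trans ?_
      have := E0 0 ⟨le_rfl, hT⟩
      gcongr
      · norm_num
      · omega
    · have hcont : ContinuousOn (fun r => ∫ τ in (0 : ℝ)..r, k τ) (Icc 0 t) := by
        have := intervalIntegral.continuousOn_primitive_interval' (sub le_rfl ht.1 ht.2)
          left_mem_uIcc
        rwa [uIcc_of_le ht.1] at this
      obtain ⟨s, hs, hks⟩ := intermediate_value_Icc ht.1 hcont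
        ⟨by rw [intervalIntegral.integral_same]; positivity, hge⟩
      have hsT := hs.2.trans ht.2
      have e := intervalIntegral.integral_add_adjacent_intervals (sub le_rfl hs.1 hsT)
        (sub hs.1 hs.2 ht.2)
      simp only at hks
      push_cast at hkt
      have h1 := step hs.1 hs.2 ht.2 (by linarith)
      have h2 := ih s ⟨hs.1, hsT⟩ hks.le
      rw [pow_succ]
      linarith

/-! ### Stability of regular solutions -/

theorem norm_sq_eq_integral {α : Type*} [MeasurableSpace α] {μ : Measure α} (F : Lp ℝ 2 μ) :
    ‖F‖ ^ 2 = ∫ z, F z ^ 2 ∂μ := by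
  rw [integral_sq_eq_toReal (Lp.memLp F), Lp.norm_def]

theorem IsContRep.eqOn {b B T : ℝ} (hT : 0 < T) {u : (ℝ × ℝ) × ℝ → ℝ}
    {U V : ℝ → Lp ℝ 2 (stripMeasure B)} (hU : IsContRep b B T u U) (hV : IsContRep b B T u V) :
    EqOn U V (Icc 0 T) := by
  refine Measure.eqOn_Icc_of_ae_eq volume hT.ne ?_ hU.1 hV.1
  rw [← Measure.restrict_congr_set (Ioo_ae_eq_Icc (a := (0 : ℝ)) (b := T))]
  filter_upwards [hU.2, hV.2] with t h1 h2
  exact Lp.ext (h1.trans h2.symm)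

/-- Every continuous representative, not just the one provided by the definition of a solution,
takes the initial value. -/
theorem IsRegularSolutionWith.contRep_zero {b B T : ℝ} (hT : 0 < T) {u₀ : ℝ × ℝ → ℝ}
    {u ux uxx uxy uxxx uxyy ut : (ℝ × ℝ) × ℝ → ℝ}
    (h : IsRegularSolutionWith b B T u₀ u ux uxx uxy uxxx uxyy ut)
    {U : ℝ → Lp ℝ 2 (stripMeasure B)} (hU : IsContRep b B T u U) :
    U 0 =ᵐ[stripMeasure B] expMul b u₀ := by
  obtain ⟨V, hV, hV0⟩ := h.initial
  rwa [hU.eqOn hT hV ⟨le_rfl, hT.le⟩]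

/-- Continuous dependence on the initial data in the weighted norm, with a constant depending only
on `b`, `T` and a bound for the `L²`-norms of the data. -/
theorem exists_norm_sub_sq_le {b T R : ℝ} (hb : 0 < b) (hT : 0 < T) (hR : 0 ≤ R) :
    ∃ C : ℝ, ∀ B : ℝ, 0 < B → ∀ u₀ v₀ : ℝ × ℝ → ℝ,
      MemLp u₀ 2 (stripMeasure B) → MemLp v₀ 2 (stripMeasure B) →
      eLpNorm u₀ 2 (stripMeasure B) ≤ ENNReal.ofReal R →
      eLpNorm v₀ 2 (stripMeasure B) ≤ ENNReal.ofReal R →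
      ∀ u v : (ℝ × ℝ) × ℝ → ℝ, IsRegularSolution b B T u₀ u → IsRegularSolution b B T v₀ v →
      ∀ U V : ℝ → Lp ℝ 2 (stripMeasure B), IsContRep b B T u U → IsContRep b B T v V →
      ∀ t ∈ Icc (0 : ℝ) T, ‖U t - V t‖ ^ 2
        ≤ C * ∫ p in strip B, Real.exp (2 * b * p.1) * (u₀ p - v₀ p) ^ 2 := by
  obtain ⟨C, hC0, hC⟩ := exists_difference_slice hb
  -- `K` bounds the integral of the coefficient `k` below; the exponent makes `K ≤ (n + 1) / 2` in
  -- the Grönwall inequality.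
  set K : ℝ := 2 * C * (T + R ^ 2 + T * R ^ 2) with hK
  refine ⟨2 ^ (⌈2 * K⌉₊ + 1), fun B hB u₀ v₀ hu₀ hv₀ hu₀R hv₀R u v hu hv U V hU hV => ?_⟩
  obtain ⟨ux, uxx, uxy, uxxx, uxyy, ut, hu⟩ := hu
  obtain ⟨vx, vxx, vxy, vxxx, vxyy, vt, hv⟩ := hv
  obtain ⟨-, bux⟩ := hu.integral_sq_le hb hB hT hu₀ hR hu₀R
  obtain ⟨bv, bvx⟩ := hv.integral_sq_le hb hB hT hv₀ hR hv₀R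
  have sq_int : ∀ {f : (ℝ × ℝ) × ℝ → ℝ}, MemLp f 2 (volume.restrict (stripT B T)) →
      IntegrableOn (fun t => ∫ z in strip B, f (z, t) ^ 2) (Ioo 0 T) := fun hf =>
    integrableOn_integral_strip hf.integrable_sq
  have n0 : ∀ (f : (ℝ × ℝ) × ℝ → ℝ) t, 0 ≤ ∫ z in strip B, f (z, t) ^ 2 := fun f t =>
    integral_nonneg fun z => sq_nonneg _
  set k : ℝ → ℝ := fun t => 2 * C * (1 + (∫ z in strip B, ux (z, t) ^ 2)
    + (∫ z in strip B, vx (z, t) ^ 2) + ∫ z in strip B, v (z, t) ^ 2) with hk_def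
  have k0 : ∀ t, 0 ≤ k t := fun t => by
    have := n0 ux t
    have := n0 vx t
    have := n0 v t
    positivity
  have i1 : IntegrableOn (fun _ : ℝ => (1 : ℝ)) (Ioo 0 T) := integrable_const _
  have i2 : IntegrableOn (fun t => 1 + ∫ z in strip B, ux (z, t) ^ 2) (Ioo 0 T) :=
    i1.add (sq_int hu.memLp_ux)
  have i3 : IntegrableOn (fun t => 1 + (∫ z in strip B, ux (z, t) ^ 2)
      + ∫ z in strip B, vx (z, t) ^ 2) (Ioo 0 T) := i2.add (sq_int hv.memLp_ux)
  have ik' : IntegrableOn k (Ioo 0 T) := (i3.add (sq_int hv.memLp_u)).const_mul (2 * C)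
  have ik : IntervalIntegrable k volume 0 T := by
    rwa [intervalIntegrable_iff_integrableOn_Ioo_of_le hT.le]
  have hkT : ∫ τ in (0 : ℝ)..T, k τ ≤ K := by
    have eu := integral_stripT (f := fun q => ux q ^ 2) hu.memLp_ux.integrable_sq
    have ev := integral_stripT (f := fun q => vx q ^ 2) hv.memLp_ux.integrable_sq
    have hv2 : ∫ t in Ioo 0 T, (∫ z in strip B, v (z, t) ^ 2) ≤ T * R ^ 2 := by
      refine (integral_mono_ae (sq_int hv.memLp_u) (integrable_const (R ^ 2)) bv).trans ?_
      simp [hT.le]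
    have e : ∫ τ in (0 : ℝ)..T, k τ = 2 * C * (T + (∫ q in stripT B T, ux q ^ 2)
        + (∫ q in stripT B T, vx q ^ 2) + ∫ t in Ioo 0 T, ∫ z in strip B, v (z, t) ^ 2) := by
      rw [intervalIntegral.integral_of_le hT.le, integral_Ioc_eq_integral_Ioo, hk_def,
        integral_const_mul, integral_add i3 (sq_int hv.memLp_u),
        integral_add i2 (sq_int hv.memLp_ux), integral_add i1 (sq_int hu.memLp_ux), eu, ev]
      simp [hT.le]
    rw [e, hK]
    exact mul_le_mul_of_nonneg_left (by linarith) (by positivity)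
  set w : (ℝ × ℝ) × ℝ → ℝ := fun q => expMulT b u q - expMulT b v q with hw
  set wt : (ℝ × ℝ) × ℝ → ℝ := fun q => expMulT b ut q - expMulT b vt q with hwt
  have mw : MemLp w 2 (volume.restrict (stripT B T)) := hu.memLp_expMulT_u.sub hv.memLp_expMulT_u
  have mwt : MemLp wt 2 (volume.restrict (stripT B T)) :=
    hu.memLp_expMulT_ut.sub hv.memLp_expMulT_ut
  have hUV : ∀ᵐ t ∂timeMeasure T, (U t - V t : Lp ℝ 2 (stripMeasure B))
      =ᵐ[stripMeasure B] slice w t := by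
    filter_upwards [hU.2, hV.2] with t h1 h2
    filter_upwards [Lp.coeFn_sub (U t) (V t), h1, h2] with z e e1 e2
    rw [e, Pi.sub_apply, e1, e2]
    rfl
  set E : ℝ → ℝ := fun t => ‖U t - V t‖ ^ 2 with hE
  set g : ℝ → ℝ := fun τ => 2 * ∫ z in strip B, w (z, τ) * wt (z, τ) with hg
  have ident : ∀ t ∈ Icc 0 T, E t - E 0 = ∫ τ in (0 : ℝ)..t, g τ := fun t ht => by
    have := energy_identity hB hT ((hu.deriv_t.expMulT_eT b).sub (hv.deriv_t.expMulT_eT b)) mw mwt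
      (IsWeight.const 1) (U := fun t => U t - V t) (hU.1.sub hV.1) hUV t ht
    simp only [hE, norm_sq_eq_integral]
    simpa only [one_mul] using this
  have ig : IntegrableOn g (Ioo 0 T) :=
    (integrableOn_integral_strip (mw.integrable_mul mwt)).const_mul 2
  have ig' : IntervalIntegrable g volume 0 T := by
    rwa [intervalIntegrable_iff_integrableOn_Ioo_of_le hT.le]
  have hEc : ContinuousOn E (Icc 0 T) := (hU.1.sub hV.1).norm.pow 2
  have hgk : ∀ᵐ τ ∂timeMeasure T, g τ ≤ k τ * E τ := by
    filter_upwards [hu.ae_solutionSlice, hv.ae_solutionSlice, hUV] with τ ⟨_, h1⟩ ⟨_, h2⟩ h3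
    have key := hC B hB _ _ _ _ _ _ _ _ _ _ _ _ _ _ _ _ _ _ _ _ h1 h2
    have e : E τ = ∫ z in strip B, (slice (expMulT b u) τ z - slice (expMulT b v) τ z) ^ 2 := by
      rw [hE]
      simp only [norm_sq_eq_integral]
      refine integral_congr_ae ?_
      filter_upwards [h3] with z hz
      rw [hz]
      rfl
    rw [e, hg, hk_def]
    change 2 * (∫ z in strip B, (slice (expMulT b u) τ z - slice (expMulT b v) τ z)
      * (slice (expMulT b ut) τ z - slice (expMulT b vt) τ z)) ≤ 2 * C * (1
      + (∫ z in strip B, slice ux τ z ^ 2) + (∫ z in strip B, slice vx τ z ^ 2)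
      + ∫ z in strip B, slice v τ z ^ 2) * _
    linarith
  have hincr : ∀ s r, 0 ≤ s → s ≤ r → r ≤ T → E r - E s ≤ ∫ τ in s..r, k τ * E τ := by
    intro s r hs hsr hr
    have sub : ∀ {f : ℝ → ℝ} {a c : ℝ}, IntervalIntegrable f volume 0 T → 0 ≤ a → a ≤ c → c ≤ T →
        IntervalIntegrable f volume a c := fun hf h0 h1 h2 => hf.mono_set (by
      rw [uIcc_of_le h1, uIcc_of_le hT.le]; exact Icc_subset_Icc h0 h2)
    have e := intervalIntegral.integral_add_adjacent_intervals (sub ig' le_rfl hs (hsr.trans hr))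
      (sub ig' hs hsr hr)
    have e1 := ident s ⟨hs, hsr.trans hr⟩
    have e2 := ident r ⟨hs.trans hsr, hr⟩
    have e3 : E r - E s = ∫ τ in s..r, g τ := by linarith
    have ikE : IntervalIntegrable (fun τ => k τ * E τ) volume 0 T :=
      ik.mul_continuousOn (by rwa [uIcc_of_le hT.le])
    rw [e3]
    refine intervalIntegral.integral_mono_ae_restrict hsr (sub ig' hs hsr hr)
      (sub ikE hs hsr hr) ?_
    rw [← Measure.restrict_congr_set (Ioo_ae_eq_Icc (a := s) (b := r))]
    exact ae_restrict_of_ae_restrict_of_subset (Ioo_subset_Ioo hs hr) hgk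
  intro t ht
  have hstart : E 0 = ∫ p in strip B, Real.exp (2 * b * p.1) * (u₀ p - v₀ p) ^ 2 := by
    rw [hE]
    simp only [norm_sq_eq_integral]
    refine integral_congr_ae ?_
    filter_upwards [Lp.coeFn_sub (U 0) (V 0), hu.contRep_zero hT hU, hv.contRep_zero hT hV]
      with z e e1 e2
    rw [e, Pi.sub_apply, e1, e2, expMul, expMul, ← mul_sub, mul_pow, ← Real.exp_nat_mul]
    push_cast
    ring_nf
  rw [← hstart]
  refine le_two_pow_mul_of_sub_le_integral hEc (fun r _ => sq_nonneg _) ik k0 hincr _ t ht ?_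
  have h1 : ∫ τ in (0 : ℝ)..t, k τ ≤ ∫ τ in (0 : ℝ)..T, k τ :=
    intervalIntegral.integral_mono_interval le_rfl ht.1 ht.2 (.of_forall k0) ik
  have h2 := Nat.le_ceil (2 * K)
  linarith

theorem IsRegularSolution.unique {b B T : ℝ} (hb : 0 < b) (hB : 0 < B) (hT : 0 < T)
    {u₀ : ℝ × ℝ → ℝ} (hu₀ : MemLp u₀ 2 (stripMeasure B)) {u v : (ℝ × ℝ) × ℝ → ℝ}
    (hu : IsRegularSolution b B T u₀ u) (hv : IsRegularSolution b B T u₀ v) :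
    u =ᵐ[volume.restrict (stripT B T)] v := by
  obtain ⟨C, hC⟩ := exists_norm_sub_sq_le hb hT
    (ENNReal.toReal_nonneg (a := eLpNorm u₀ 2 (stripMeasure B)))
  have hle := (ENNReal.ofReal_toReal hu₀.2.ne).ge
  have hC := hC B hB u₀ u₀ hu₀ hu₀ hle hle u v hu hv
  obtain ⟨_, _, _, _, _, _, hu⟩ := hu
  obtain ⟨_, _, _, _, _, _, hv⟩ := hv
  obtain ⟨U, hU, -⟩ := hu.initial
  obtain ⟨V, hV, -⟩ := hv.initial
  have i : Integrable (fun q => (u q - v q) ^ 2) (volume.restrict (stripT B T)) :=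
    (hu.memLp_u.sub hv.memLp_u).integrable_sq
  have h0 : ∫ q in stripT B T, (u q - v q) ^ 2 = 0 := by
    rw [integral_stripT i]
    refine integral_eq_zero_of_ae ?_
    filter_upwards [hU.2, hV.2, ae_restrict_mem measurableSet_Ioo] with t h1 h2 ht
    refine integral_eq_zero_of_ae ?_
    have h3 := hC U V hU hV t ⟨ht.1.le, ht.2.le⟩
    simp only [sub_self, ne_eq, OfNat.ofNat_ne_zero, not_false_eq_true, zero_pow, mul_zero,
      integral_zero] at h3
    have h4 : U t = V t := sub_eq_zero.1 (norm_eq_zero.1 (by nlinarith [norm_nonneg (U t - V t)]))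
    rw [h4] at h1
    filter_upwards [h1, h2] with z e1 e2
    have e : Real.exp (b * z.1) * u (z, t) = Real.exp (b * z.1) * v (z, t) := e1.symm.trans e2
    rw [mul_left_cancel₀ (Real.exp_pos _).ne' e]
    simp
  filter_upwards [(integral_eq_zero_iff_of_nonneg (fun q => sq_nonneg _) i).1 h0] with q hq
  exact sub_eq_zero.1 (by simpa using hq)

theorem mainTheorem4 :
    (∀ b B T : ℝ, 0 < b → 0 < B → 0 < T →
      ∀ u₀ : ℝ × ℝ → ℝ, IsAdmissibleDatum b B u₀ →
      ∀ u₁ u₂ : (ℝ × ℝ) × ℝ → ℝ,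
        IsRegularSolution b B T u₀ u₁ → IsRegularSolution b B T u₀ u₂ →
        u₁ =ᵐ[volume.restrict (stripT B T)] u₂) ∧
    (∀ b T R : ℝ, 0 < b → 0 < T → 0 ≤ R →
      ∃ C : ℝ, ∀ B : ℝ, 0 < B →
      ∀ u₀₁ u₀₂ : ℝ × ℝ → ℝ, IsAdmissibleDatum b B u₀₁ → IsAdmissibleDatum b B u₀₂ →
        eLpNorm u₀₁ 2 (stripMeasure B) ≤ ENNReal.ofReal R →
        eLpNorm u₀₂ 2 (stripMeasure B) ≤ ENNReal.ofReal R →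
      ∀ u₁ u₂ : (ℝ × ℝ) × ℝ → ℝ,
        IsRegularSolution b B T u₀₁ u₁ → IsRegularSolution b B T u₀₂ u₂ →
      ∀ U₁ U₂ : ℝ → Lp ℝ 2 (stripMeasure B),
        IsContRep b B T u₁ U₁ → IsContRep b B T u₂ U₂ →
      ∀ t ∈ Icc (0 : ℝ) T,
        ‖U₁ t - U₂ t‖ ^ 2
          ≤ C * ∫ p in strip B, Real.exp (2 * b * p.1) * (u₀₁ p - u₀₂ p) ^ 2) := by
  refine ⟨fun b B T hb hB hT u₀ hu₀ u₁ u₂ h₁ h₂ => ?_, fun b T R hb hT hR => ?_⟩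
  · obtain ⟨-, _, _, _, _, _, -, -, -, -, -, hmem, -⟩ := hu₀
    exact h₁.unique hb hB hT hmem h₂
  · obtain ⟨C, hC⟩ := exists_norm_sub_sq_le hb hT hR
    refine ⟨C, fun B hB u₀₁ u₀₂ h₀₁ h₀₂ => ?_⟩
    obtain ⟨-, _, _, _, _, _, -, -, -, -, -, hmem₁, -⟩ := h₀₁
    obtain ⟨-, _, _, _, _, _, -, -, -, -, -, hmem₂, -⟩ := h₀₂
    exact hC B hB u₀₁ u₀₂ hmem₁ hmem₂
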